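/- Let $K$ be an algebraically closed field of characteristic $0$, let $z=\{z_1,\dots,z_k\}$ be a finite set of points on a smooth surface $S$ over $K$ (for instance one point), and let $\mathcal O_{S,z}=\prod_i\mathcal O_{S,z_i}$ with $\mathcal O_{S,z_i}\cong K[[x,y]]$ the (formal) local ring. For $f\in\mathcal O_{S,z_i}$ and a point $q$ equal or infinitely near to $z_i$, let $\hat f_{(q)}$ and $f_{(q)}$ be the total and the strict transform of $f$ under the composition of blowing ups defining $q$, and let $\mathrm{mt}$ denote multiplicity (order). For a reduced curve germ $(C,z_i)$ (possibly empty, i.e. given by a unit) let $T(C,z_i)$ be the tree of all points $q$ equal or infinitely near to $z_i$ with $q\in C_{(q)}$, ordered by being infinitely near. Let $T^*(C,z_i)\subset T(C,z_i)$ be the set of essential points: $z_i$ is essential if $C$ is singular at $z_i$; a point $q\ne z_i$ of $T(C,z_i)$ is essential unless it is a node of the union of $C_{(q)}$ with the reduced exceptional divisor. A generalized singularity scheme $X=X(C,T^*)$ centred at $z$ is given by reduced germs $(C,z_i)$ together with finite sets $T^*_i$, $T^*(C,z_i)\subset T^*_i\subset T(C,z_i)$, each closed under passing to predecessors (so each is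 empty or a connected subtree with root $z_i$). Put $T^*=\bigcup_i T^*_i$. Then $X$ is the scheme with ideal $$J_X=\{f\in\mathcal O_{S,z}\mid \mathrm{mt}(\hat f_{(q)},q)\ge \mathrm{mt}(\widehat C_{(q)},q)\ \text{for all } q\in T^*\}.$$ Write $T^*_X=T^*$, $\mathrm{mt}(X,q)=\mathrm{mt}(C_{(q)},q)$ for $q\in T^*_X$, $\mathrm{mt}(X,q)=0$ for $q\notin T^*_X$, and $\deg Z=\dim_K\mathcal O_{S,z}/J$ for a scheme $Z=Z(J)$ concentrated on $z$. Let $L\in\mathcal O_{S,z}$ be a germ which at every $z_i$ is either smooth or a unit (i.e. it does not pass through $z_i$). Let $X:L$ be the scheme defined by $J_X:L=\{f\mid fL\in J_X\}$, let $X\cap L$ be the scheme defined by $J_X+(L)$, and let $T^*\cap L=\{q\in T^*\mid q\in L_{(q)}\}$. Then: (i) $X:L$ is a generalized singularity scheme centred at $z$, and its tree $T^*_{X:L}$ is a subtree of $T^*$ (for every presentation of $X:L$ by germs and trees as above). (ii) $\mathrm{mt}(X,q)-1\le \mathrm{mt}(X:L,q)\le \mathrm{mt}(X,q)$ for all $q\in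 T^*$. (iii) $\deg X$ is finite, $\deg(X:L)=\deg(X)-\deg(X\cap L)$, and $\deg(X\cap L)=\sum_{q\in T^*\cap L}\mathrm{mt}(X,q)$. (iv) If $S=\mathbb P^2$, $L\subset\mathbb P^2$ is a line and $d\in\mathbb Z$, then, with the first map given by multiplication with an equation of $L$ and the second by restriction to $L$, there is an exact sequence of sheaves on $\mathbb P^2$ $$0\longrightarrow \mathcal J_{X:L/\mathbb P^2}(d-1)\xrightarrow{\ \cdot L\ }\mathcal J_{X/\mathbb P^2}(d)\longrightarrow\mathcal J_{X\cap L/L}(d)\longrightarrow 0 .$$ -/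

import Mathlib

universe u

noncomputable section

namespace PlaneCurveGerm

open CategoryTheory TopologicalSpace

/-! ### Local theory: germs, infinitely near points, generalized singularity schemes -/

/-- The (formal) local ring `K[[x, y]]` of a smooth surface over `K` at a point, with respect to
chosen local coordinates `x = X 0`, `y = X 1`. -/
abbrev LocalRing (K : Type u) [Field K] : Type u := MvPowerSeries (Fin 2) K

/-- A point infinitely near to the base point `z`, given by the directions that are successively
blown up. `[]` is `z` itself and `[a₁, …, aₙ]` is a point of the `n`-th infinitesimal neighbourhood.
A direction is a point of the exceptional line `ℙ¹(K) = K ∪ {∞}`: `some t` is the tangent direction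
`y = t x`, and `none` is the tangent direction `x = 0`. -/
abbrev InfNear (K : Type u) : Type u := List (Option K)

variable {K : Type u} [Field K]

/-- The blowing up of the closed point, in coordinates `(u, v)` at the point of the exceptional
line with direction `a`: `(x, y) = (u, u (v + t))` for `a = t` and `(x, y) = (u v, u)` for `a = ∞`.
In both cases the exceptional line is `u = 0`. -/
def blowupCoord : Option K → Fin 2 → LocalRing K
  | some t => ![MvPowerSeries.X 0, MvPowerSeries.X 0 * (MvPowerSeries.X 1 + MvPowerSeries.C t)]
  | none => ![MvPowerSeries.X 0 * MvPowerSeries.X 1, MvPowerSeries.X 0]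

theorem hasSubst_blowupCoord (a : Option K) : MvPowerSeries.HasSubst (blowupCoord a) := by
  apply MvPowerSeries.hasSubst_of_constantCoeff_zero
  intro i
  cases a <;> fin_cases i <;> simp [blowupCoord]

/-- Pull-back of functions under one blowing up, at the point with direction `a`. -/
def blowup (a : Option K) : LocalRing K →ₐ[K] LocalRing K :=
  MvPowerSeries.substAlgHom (hasSubst_blowupCoord a)

/-- Total transform `f ↦ f̂_(q)` under the composition of blowing ups that defines `q`. -/
def totalTransform : InfNear K → LocalRing K →ₐ[K] LocalRing K
  | [] => AlgHom.id K _
  | a :: q => (totalTransform q).comp (blowup a)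

/-- Division by `u ^ n` (`u = X 0`), for power series divisible by `u ^ n`. -/
def divX (n : ℕ) (f : LocalRing K) : LocalRing K :=
  fun m => MvPowerSeries.coeff (m + Finsupp.single 0 n) f

/-- Strict transform under one blowing up: the total transform divided by the exceptional line to
the power of the multiplicity of `f` (with value `0` for `f = 0`). -/
def strictTransform₁ (a : Option K) (f : LocalRing K) : LocalRing K :=
  divX f.order.toNat (blowup a f)

/-- Strict transform `f_(q)` under the composition of blowing ups that defines `q`. -/
def strictTransform : InfNear K → LocalRing K → LocalRing K
  | [], f => f
  | a :: q, f => strictTransform q (strictTransform₁ a f)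

/-- Auxiliary recursion for `exceptional`: if `e` is an equation of the reduced exceptional divisor
at the present point, go on to `q`. In each step the new exceptional line `u = 0` is added to the
strict transform of the old exceptional divisor. -/
def exceptionalAux : LocalRing K → InfNear K → LocalRing K
  | e, [] => e
  | e, a :: q => exceptionalAux (MvPowerSeries.X 0 * strictTransform₁ a e) q

/-- Local equation at `q` of the reduced exceptional divisor of the composition of blowing ups
that defines `q` (the unit `1` for `q = z`). -/
def exceptional (q : InfNear K) : LocalRing K := exceptionalAux 1 q

/-- `q` lies on (the strict transform of) the germ `f`: `q ∈ f_(q)`. -/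
def PassesThrough (f : LocalRing K) (q : InfNear K) : Prop :=
  1 ≤ (strictTransform q f).order

/-- `f = 0` is a node (ordinary double point): multiplicity two, with non-degenerate quadratic
initial form `a x² + b x y + c y²`. -/
def IsNode (f : LocalRing K) : Prop :=
  f.order = 2 ∧
    MvPowerSeries.coeff (Finsupp.single 0 1 + Finsupp.single 1 1) f ^ 2 -
      4 * MvPowerSeries.coeff (Finsupp.single 0 2) f *
        MvPowerSeries.coeff (Finsupp.single 1 2) f ≠ 0

/-- The complete embedded resolution tree `T(C, z)`: all infinitely near points lying on the
strict transforms of `C`. It is empty if `C` is a unit. -/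
def resolutionTree (C : LocalRing K) : Set (InfNear K) := {q | PassesThrough C q}

/-- The tree `T*(C, z)` of essential points of `C`: the point `z`, if `C` is singular at `z`; and
the points `q ≠ z` of `T(C, z)` that are not a node of the union of the strict transform of `C`
with the reduced exceptional divisor. -/
def essentialTree (C : LocalRing K) : Set (InfNear K) :=
  {q | q ∈ resolutionTree C ∧
    (q = [] → 2 ≤ C.order) ∧ (q ≠ [] → ¬ IsNode (strictTransform q C * exceptional q))}

/-- The ideal of all power series of order at least `n`. -/
def orderIdeal (n : ℕ∞) : Ideal (LocalRing K) where
  carrier := {f | n ≤ f.order}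
  zero_mem' := by simp
  add_mem' ha hb := (le_min ha hb).trans MvPowerSeries.min_order_le_add
  smul_mem' c _ hf := (le_add_of_le_right hf).trans MvPowerSeries.le_order_mul

/-- The ideal `J(C, T) = {f | mt(f̂_(q), q) ≥ mt(Ĉ_(q), q) for all q ∈ T}`. -/
def clusterIdeal (C : LocalRing K) (T : Finset (InfNear K)) : Ideal (LocalRing K) :=
  ⨅ q ∈ T, (orderIdeal (totalTransform q C).order).comap (totalTransform q)

/-- A generalized singularity scheme `X = X(C, T*)`, centred at finitely many points `z k`
(`k : ι`) of smooth surfaces: at each point, a reduced curve germ `C` and a finite connected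
subtree `T*` (a finite set of infinitely near points that is closed under predecessors) with
`T*(C, z) ⊆ T* ⊆ T(C, z)`. A one-element `ι` gives the schemes with one centre. -/
structure GenSing (K : Type u) [Field K] (ι : Type*) where
  /-- the curve germs -/
  curve : ι → LocalRing K
  /-- the trees `T*` -/
  tree : ι → Finset (InfNear K)
  reduced : ∀ k, Squarefree (curve k)
  essential_subset : ∀ k, essentialTree (curve k) ⊆ ↑(tree k)
  subset_resolution : ∀ k, ↑(tree k) ⊆ resolutionTree (curve k)
  connected : ∀ k, ∀ q ∈ tree k, ∀ p, p <+: q → p ∈ tree k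

variable {ι : Type*}

namespace GenSing

/-- The ideal `J_X`, as the family of its components in the local rings of the points `z k`. -/
def ideal (X : GenSing K ι) (k : ι) : Ideal (LocalRing K) := clusterIdeal (X.curve k) (X.tree k)

open scoped Classical in
/-- The multiplicity `mt(X, q)`, i.e. the multiplicity at `q` of the strict transform of the curve;
it is zero if `q` is not in the tree of `X`. -/
def mult (X : GenSing K ι) (k : ι) (q : InfNear K) : ℕ :=
  if q ∈ X.tree k then (strictTransform q (X.curve k)).order.toNat else 0

open scoped Classical in
/-- The set `T* ∩ L` of the points of the tree that lie on the strict transforms of `L`. -/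
def treeInter (X : GenSing K ι) (L : ι → LocalRing K) (k : ι) : Finset (InfNear K) :=
  (X.tree k).filter (PassesThrough (L k))

end GenSing

/-- The coordinate ring `(∏ₖ 𝒪_{S, z k}) / J` of the scheme that is concentrated in the points `z k`
and is defined there by the ideals `J k`. -/
abbrev CoordRing (J : ι → Ideal (LocalRing K)) : Type _ := (ι → LocalRing K) ⧸ Ideal.pi J

/-- The degree of a zero-dimensional scheme: the dimension over `K` of its coordinate ring. -/
def degree (J : ι → Ideal (LocalRing K)) : ℕ := Module.finrank K (CoordRing J)

/-- The ideal `J : L = {f | f L ∈ J}`. -/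
def reduction (J : ι → Ideal (LocalRing K)) (L : ι → LocalRing K) (k : ι) : Ideal (LocalRing K) :=
  (J k).colon {L k}

/-- The ideal `J + (L)` of the scheme-theoretic intersection of `Z(J)` with `L`. -/
def intersection (J : ι → Ideal (LocalRing K)) (L : ι → LocalRing K) (k : ι) :
    Ideal (LocalRing K) :=
  J k ⊔ Ideal.span {L k}

/-! ### Ideal sheaves on the projective plane -/

/-- The homogeneous coordinate ring `K[x₀, x₁, x₂]` of `ℙ²`. -/
abbrev HomogCoordRing (K : Type u) [Field K] : Type u := MvPolynomial (Fin 3) K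

/-- Its grading. -/
abbrev grading (K : Type u) [Field K] : ℕ → Submodule K (HomogCoordRing K) :=
  MvPolynomial.homogeneousSubmodule (Fin 3) K

instance instGradedAlgebra (K : Type u) [Field K] : GradedAlgebra (grading K) :=
  MvPolynomial.gradedAlgebra

/-- The projective plane over `K`, i.e. `Proj K[x₀, x₁, x₂]`, as a topological space. -/
abbrev Plane (K : Type u) [Field K] : TopCat.{u} := TopCat.of (ProjectiveSpectrum (grading K))

/-- The closed point of the plane with homogeneous coordinates `v`: its homogeneous prime ideal is
generated by the homogeneous polynomials that vanish at `v`. -/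
def closedPoint (v : Fin 3 → K) (hv : v ≠ 0) : Plane K where
  asHomogeneousIdeal :=
    (RingHom.ker (MvPolynomial.eval v)).homogeneousCore (grading K)
  isPrime := (RingHom.ker_isPrime (MvPolynomial.eval v)).homogeneousCore
  not_irrelevant_le h := by
    obtain ⟨i, hi⟩ := Function.ne_iff.mp hv
    have h1 : (MvPolynomial.X i : HomogCoordRing K) ∈ HomogeneousIdeal.irrelevant (grading K) :=
      HomogeneousIdeal.mem_irrelevant_of_mem (grading K) Nat.one_pos
        (MvPolynomial.isHomogeneous_X K i)
    have h2 := Ideal.toIdeal_homogeneousCore_le (grading K) _ (h h1)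
    rw [RingHom.mem_ker, MvPolynomial.eval_X] at h2
    exact hi h2

/-- A frame `e` of `K³` gives the closed point `[e 0]` of the plane, together with affine
coordinates `x, y` centred at it, `(x, y) ↦ [e 0 + x e 1 + y e 2]`. -/
abbrev Frame (K : Type u) [Field K] : Type u := Module.Basis (Fin 3) K (Fin 3 → K)

/-- The centre `[e 0]` of a frame. -/
def Frame.center (e : Frame K) : Plane K := closedPoint (e 0) (e.ne_zero 0)

/-- The germ of a homogeneous polynomial `a` at the centre of the frame, in the affine coordinates
of the frame: `a (e 0 + x e 1 + y e 2)`. -/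
def Frame.germ (e : Frame K) : HomogCoordRing K →ₐ[K] LocalRing K :=
  MvPolynomial.aeval fun i => MvPowerSeries.C (e 0 i) +
    MvPowerSeries.X 0 * MvPowerSeries.C (e 1 i) + MvPowerSeries.X 1 * MvPowerSeries.C (e 2 i)

/-- The localization of `A = K[x₀, x₁, x₂]` at a point `p` of the plane. -/
abbrev At (p : ProjectiveSpectrum (grading K)) : Type u := Localization.AtPrime p.asHomogeneousIdeal.toIdeal

/-- For a homogeneous ideal `I` of `A`, the fibre `A_p / I A_p` in which sections of the
sheaves `𝒪_{V(I)}(d)` take their values at `p`. It is zero for `p` outside `V(I)`. -/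
def FibreAt (I : Ideal (HomogCoordRing K)) (p : ProjectiveSpectrum (grading K)) : Type u :=
  At p ⧸ I.map (algebraMap (HomogCoordRing K) (At p))

instance (I : Ideal (HomogCoordRing K)) (p : ProjectiveSpectrum (grading K)) :
    CommRing (FibreAt I p) :=
  inferInstanceAs (CommRing (At p ⧸ I.map (algebraMap (HomogCoordRing K) (At p))))

instance (I : Ideal (HomogCoordRing K)) (p : ProjectiveSpectrum (grading K)) :
    Algebra (HomogCoordRing K) (FibreAt I p) :=
  inferInstanceAs (Algebra (HomogCoordRing K) (At p ⧸ I.map (algebraMap (HomogCoordRing K) (At p))))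

instance (I : Ideal (HomogCoordRing K)) (p : ProjectiveSpectrum (grading K)) :
    Algebra K (FibreAt I p) :=
  ((algebraMap (HomogCoordRing K) (FibreAt I p)).comp MvPolynomial.C).toAlgebra

instance (I : Ideal (HomogCoordRing K)) (p : ProjectiveSpectrum (grading K)) :
    IsScalarTower K (HomogCoordRing K) (FibreAt I p) :=
  IsScalarTower.of_algebraMap_eq fun _ => rfl

/-- Let `Z` be the zero-dimensional subscheme of the plane that is concentrated at the centres of
the frames `e k` and is defined there by `J k`. A function `s` on the open set `U` is a fraction of
degree `d` in the ideal of `Z ∩ V(I)` in `V(I)` if `s = a / b` on `U`, with `a`, `b` homogeneous,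
`deg a = deg b + d`, `b` without zeros on `U`, and such that at each centre in `U` the
numerator `a` belongs to the ideal `J k + I`. -/
def IsFraction (I : Ideal (HomogCoordRing K)) (e : ι → Frame K) (J : ι → Ideal (LocalRing K))
    (d : ℤ) {U : Opens (Plane K)} (s : ∀ p : U, FibreAt I p.1) : Prop :=
  ∃ (i j : ℕ) (a b : HomogCoordRing K), a ∈ grading K i ∧ b ∈ grading K j ∧ (i : ℤ) = j + d ∧
    (∀ k, (e k).center ∈ U → (e k).germ a ∈ J k ⊔ I.map (e k).germ) ∧
    ∀ p : U, b ∉ p.1.asHomogeneousIdeal ∧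
      algebraMap (HomogCoordRing K) (FibreAt I p.1) b * s p = algebraMap _ _ a

/-- `IsFraction` as a condition that is stable under restriction. -/
def isFractionPrelocal (I : Ideal (HomogCoordRing K)) (e : ι → Frame K)
    (J : ι → Ideal (LocalRing K)) (d : ℤ) :
    TopCat.PrelocalPredicate fun p : Plane K => FibreAt I p where
  pred s := IsFraction I e J d s
  res := by
    rintro U V f s ⟨i, j, a, b, ha, hb, hd, hJ, h⟩
    exact ⟨i, j, a, b, ha, hb, hd, fun k hk => hJ k (f.le hk), fun p => h ⟨p.1, f.le p.2⟩⟩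

/-- Functions that are locally a fraction of degree `d` in the sense of `IsFraction`. -/
def isLocallyFraction (I : Ideal (HomogCoordRing K)) (e : ι → Frame K)
    (J : ι → Ideal (LocalRing K)) (d : ℤ) : TopCat.LocalPredicate fun p : Plane K => FibreAt I p :=
  (isFractionPrelocal I e J d).sheafify

theorem exists_homogeneous_not_mem (p : ProjectiveSpectrum (grading K)) :
    ∃ (m : ℕ) (c : HomogCoordRing K), 0 < m ∧ c ∈ grading K m ∧ c ∉ p.asHomogeneousIdeal := by
  obtain ⟨f, hf, hfp⟩ := SetLike.not_le_iff_exists.mp p.not_irrelevant_le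
  by_contra! h
  refine hfp ?_
  classical
  rw [← DirectSum.sum_support_decompose (grading K) f]
  refine sum_mem fun i hi => ?_
  rcases Nat.eq_zero_or_pos i with rfl | hpos
  · have h0 := (HomogeneousIdeal.mem_irrelevant_iff (grading K) f).mp hf
    rw [GradedRing.proj_apply] at h0
    rw [h0]
    exact zero_mem _
  · exact h i _ hpos (SetLike.coe_mem _)

/-- The sections over `U` of the sheaf `𝒥_{Z ∩ V(I) / V(I)}(d)`. -/
def sections (I : Ideal (HomogCoordRing K)) (e : ι → Frame K) (J : ι → Ideal (LocalRing K))
    (d : ℤ) (U : Opens (Plane K)) : Submodule K (∀ p : U, FibreAt I p.1) where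
  carrier := {s | (isLocallyFraction I e J d).pred s}
  zero_mem' := by
    intro x
    obtain ⟨m, c, hpos, hc, hm⟩ := exists_homogeneous_not_mem x.1
    refine ⟨U ⊓ ProjectiveSpectrum.basicOpen (grading K) c, ⟨x.2, hm⟩, Opens.infLELeft _ _,
      ((-d).toNat * m + d).toNat, (-d).toNat * m, 0, c ^ (-d).toNat, zero_mem _, ?_, ?_,
      fun k _ => by simp, fun p => ⟨fun h => ?_, by simp⟩⟩
    · rw [mul_comm]
      exact (MvPolynomial.IsHomogeneous.pow hc _ : _)
    · have h1 : (-d).toNat ≤ (-d).toNat * m := Nat.le_mul_of_pos_right _ hpos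
      have h2 := Int.self_le_toNat (-d)
      push_cast [Int.toNat_of_nonneg (show 0 ≤ (((-d).toNat * m : ℕ) : ℤ) + d by omega)]
      rw [Int.toNat_of_nonneg]
      zify at h1
      omega
    · exact p.2.2 (p.1.isPrime.mem_of_pow_mem _ h)
  add_mem' := by
    intro s t hs ht x
    obtain ⟨V, hxV, f, i, j, a, b, ha, hb, hd, hJ, h⟩ := hs x
    obtain ⟨V', hxV', f', i', j', a', b', ha', hb', hd', hJ', h'⟩ := ht x
    refine ⟨V ⊓ V', ⟨hxV, hxV'⟩, Opens.infLELeft _ _ ≫ f, i + j', j + j', a * b' + a' * b, b * b',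
      ?_, hb.mul hb', by push_cast; omega, fun k hk => ?_, fun p => ?_⟩
    · refine add_mem (ha.mul hb') ?_
      have e : i + j' = i' + j := by omega
      rw [e]
      exact ha'.mul hb
    · rw [map_add, map_mul, map_mul]
      exact add_mem (Ideal.mul_mem_right _ _ (hJ k hk.1)) (Ideal.mul_mem_right _ _ (hJ' k hk.2))
    · obtain ⟨h1, h2⟩ := h ⟨p.1, p.2.1⟩
      obtain ⟨h3, h4⟩ := h' ⟨p.1, p.2.2⟩
      change _ * s ⟨p.1, f.le p.2.1⟩ = _ at h2
      change _ * t ⟨p.1, f'.le p.2.2⟩ = _ at h4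
      refine ⟨fun hbb => (p.1.isPrime.mem_or_mem hbb).elim h1 h3, ?_⟩
      rw [map_mul, map_add, map_mul, map_mul, ← h2, ← h4]
      change _ * (s ⟨p.1, f.le p.2.1⟩ + t ⟨p.1, f'.le p.2.2⟩) = _
      ring
  smul_mem' := by
    intro c s hs x
    obtain ⟨V, hxV, f, i, j, a, b, ha, hb, hd, hJ, h⟩ := hs x
    refine ⟨V, hxV, f, i, j, c • a, b, Submodule.smul_mem _ _ ha, hb, hd, fun k hk => ?_,
      fun p => ⟨(h p).1, ?_⟩⟩
    · rw [map_smul]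
      exact Submodule.smul_of_tower_mem _ c (hJ k hk)
    · have := (h p).2
      change _ * s ⟨p.1, f.le p.2⟩ = _ at this
      change _ * (c • s ⟨p.1, f.le p.2⟩) = _
      rw [mul_smul_comm, this, Algebra.smul_def, IsScalarTower.algebraMap_apply K (HomogCoordRing K),
        ← map_mul, ← Algebra.smul_def]

/-- The presheaf of `sections`. -/
def idealSheafPre (I : Ideal (HomogCoordRing K)) (e : ι → Frame K) (J : ι → Ideal (LocalRing K))
    (d : ℤ) : TopCat.Presheaf (ModuleCat.{u} K) (Plane K) where
  obj U := ModuleCat.of K (sections I e J d U.unop)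
  map {U V} f := ModuleCat.ofHom
    { toFun := fun s => ⟨fun p => s.1 ⟨p.1, f.unop.le p.2⟩, (isLocallyFraction I e J d).res f.unop s.1 s.2⟩
      map_add' := fun _ _ => rfl
      map_smul' := fun _ _ => rfl }

/-- The sheaf `𝒥_{Z ∩ V(I) / V(I)}(d)` on the plane: the ideal sheaf of `Z ∩ V(I)` in `V(I)`, twisted
by `𝒪(d)` and extended by zero from `V(I)` to the plane. For `I = 0` this is `𝒥_{Z / ℙ²}(d)`. -/
def idealSheaf (I : Ideal (HomogCoordRing K)) (e : ι → Frame K) (J : ι → Ideal (LocalRing K))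
    (d : ℤ) : TopCat.Sheaf (ModuleCat.{u} K) (Plane K) :=
  ⟨idealSheafPre I e J d,
    (TopCat.Presheaf.isSheaf_iff_isSheaf_comp (forget (ModuleCat.{u} K)) _).mpr
      (TopCat.Presheaf.isSheaf_of_iso
        (NatIso.ofComponents (fun _ => Iso.refl _) (by cat_disch))
        (TopCat.subsheafToTypes (isLocallyFraction I e J d)).property)⟩

/-- The morphism of sheaves given by a family of linear maps between the fibres that maps fractions
in the first ideal sheaf to fractions in the second one. -/
def idealSheafHom {I I' : Ideal (HomogCoordRing K)} {e : ι → Frame K}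
    {J J' : ι → Ideal (LocalRing K)} {d d' : ℤ}
    (φ : ∀ p : Plane K, FibreAt I p →ₗ[K] FibreAt I' p)
    (hφ : ∀ (U : Opens (Plane K)) (s : ∀ p : U, FibreAt I p.1), IsFraction I e J d s →
      IsFraction I' e J' d' fun p : U => φ p.1 (s p)) :
    idealSheaf I e J d ⟶ idealSheaf I' e J' d' :=
  ⟨{ app := fun U => ModuleCat.ofHom
      { toFun := fun s => ⟨fun p => φ p.1 (s.1 p), fun x => by
          obtain ⟨V, hxV, f, h⟩ := s.2 x
          exact ⟨V, hxV, f, hφ V _ h⟩⟩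
        map_add' := fun s t => Subtype.ext (funext fun p => map_add (φ p.1) (s.1 p) (t.1 p))
        map_smul' := fun c s => Subtype.ext (funext fun p => map_smul (φ p.1) c (s.1 p)) }
     naturality := fun _ _ _ => rfl }⟩

/-- The morphism `𝒥_{Z : L}(d - 1) ⟶ 𝒥_Z(d)` on `ℙ²` given by multiplication with the linear form
`ℓ` that defines the line `L`. -/
def mulLine (e : ι → Frame K) (J : ι → Ideal (LocalRing K)) (d : ℤ) (ℓ : HomogCoordRing K)
    (hℓ : ℓ ∈ grading K 1) :
    idealSheaf ⊥ e (reduction J fun k => (e k).germ ℓ) (d - 1) ⟶ idealSheaf ⊥ e J d :=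
  idealSheafHom
    (fun p => LinearMap.mulLeft K (algebraMap (HomogCoordRing K) (FibreAt ⊥ p) ℓ))
    (by
      rintro U s ⟨i, j, a, b, ha, hb, hd, hJ, h⟩
      refine ⟨1 + i, j, ℓ * a, b, hℓ.mul ha, hb, by push_cast; omega, fun k hk => ?_,
        fun p => ⟨(h p).1, ?_⟩⟩
      · have := hJ k hk
        rw [Ideal.map_bot, sup_bot_eq] at this ⊢
        rw [map_mul, mul_comm]
        exact Submodule.mem_colon_singleton.mp this
      · change _ * (_ * s p) = _
        rw [mul_left_comm, (h p).2, map_mul])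

/-- The projection `A_p / I A_p → A_p / I' A_p` for `I ⊆ I'`. -/
def fibreMap {I I' : Ideal (HomogCoordRing K)} (h : I ≤ I') (p : ProjectiveSpectrum (grading K)) :
    FibreAt I p →ₐ[HomogCoordRing K] FibreAt I' p :=
  Ideal.Quotient.factorₐ (HomogCoordRing K) (Ideal.map_mono h)

/-- The restriction `𝒥_Z(d) ⟶ 𝒥_{Z ∩ L / L}(d)` to the closed subscheme `L = V(I)`. -/
def restrictTo (I : Ideal (HomogCoordRing K)) (e : ι → Frame K) (J : ι → Ideal (LocalRing K))
    (d : ℤ) : idealSheaf ⊥ e J d ⟶ idealSheaf I e J d :=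
  idealSheafHom (fun p => ((fibreMap bot_le p).restrictScalars K).toLinearMap)
    (by
      rintro U s ⟨i, j, a, b, ha, hb, hd, hJ, h⟩
      refine ⟨i, j, a, b, ha, hb, hd, fun k hk => ?_, fun p => ⟨(h p).1, ?_⟩⟩
      · have := hJ k hk
        rw [Ideal.map_bot, sup_bot_eq] at this
        exact Ideal.mem_sup_left this
      · have := congrArg (fibreMap (bot_le : ⊥ ≤ I) p.1) (h p).2
        rw [map_mul, AlgHom.commutes, AlgHom.commutes] at this
        exact this)

/-- The sequence `0 → 𝒥_{Z : L}(d - 1) → 𝒥_Z(d) → 𝒥_{Z ∩ L / L}(d) → 0` of sheaves on `ℙ²`, for the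
line `L` with equation `ℓ`. -/
def lineSequence (e : ι → Frame K) (J : ι → Ideal (LocalRing K)) (d : ℤ) (ℓ : HomogCoordRing K)
    (hℓ : ℓ ∈ grading K 1) : ShortComplex (TopCat.Sheaf (ModuleCat.{u} K) (Plane K)) :=
  ShortComplex.mk (mulLine e J d ℓ hℓ) (restrictTo (Ideal.span {ℓ}) e J d) (by
    have key : ∀ (p : Plane K) (x : FibreAt ⊥ p),
        fibreMap (bot_le : ⊥ ≤ Ideal.span {ℓ}) p
          (algebraMap (HomogCoordRing K) (FibreAt ⊥ p) ℓ * x) = 0 := by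
      intro p x
      rw [map_mul, AlgHom.commutes]
      have : algebraMap (HomogCoordRing K) (FibreAt (Ideal.span {ℓ}) p) ℓ = 0 :=
        Ideal.Quotient.eq_zero_iff_mem.mpr
          (Ideal.mem_map_of_mem _ (Ideal.mem_span_singleton_self ℓ))
      rw [this, zero_mul]
    refine ObjectProperty.hom_ext _ (NatTrans.ext (funext fun U =>
      ModuleCat.hom_ext (LinearMap.ext fun s => ?_)))
    exact Subtype.ext (funext fun p => key p.1 (s.1 p)))

end PlaneCurveGerm

end

open PlaneCurveGerm

noncomputable section

namespace PlaneCurveGerm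

/-! ### Order, division by the exceptional line, weak transforms -/

section Basic

variable {K : Type*} [Field K]

/-! A scheme X is encoded by its multiplicities m on the infinitely near points, and a multiplicity
function m by the ideal `multIdeal m` of germs with virtual multiplicities m: at every point the
weak transform divides by the prescribed power of the exceptional equation, not by the actual one,
so the conditions are linear. Multiplicities of a curve germ on a finite connected tree satisfy the
proximity inequalities (`IsConsistent`), and J_X is `multIdeal m` (`isConsistent_treeMult`).

Two facts on the exceptional line ℙ¹ carry the local theory. An initial form of degree n has at most
n zeros (`sum_le_of_le_axis_order`). Conversely, germs of order at least n realize arbitrary weak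
transforms modulo conditions whose total contact with the line is at most n + 1
(`exists_weakTransform_sub_mem`); this is the vanishing of H¹(ℙ¹, 𝒪(k)) for k ≥ -1. For consistent
m, every element of the ideal at a point of the first neighbourhood therefore lifts, up to multiples
by the maximal ideal. Induction on the tree gives Noether's formula along smooth arcs with equality
attained (`IsConsistent.pathSum_le_order`, `IsConsistent.exists_order_arc_eq`), and Nakayama shows
that m is determined by its ideal (`IsConsistent.eq_of_multIdeal_eq`).

Multiplicities are additive, so J_X : L belongs to m lowered by one along L (`multIdeal_colon`). The
lowered function may violate proximity; unloading (`IsConsistent.exists_unloading`) replaces it by a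
consistent one with the same ideal, still between m - 1 and m. A germ in general position with these
multiplicities exists (`IsConsistent.exists_isGeneral`). Being general is an open condition and
reduced germs are dense (`exists_squarefree_sub_mem`), so J_X : L comes from a generalized
singularity scheme; by uniqueness the bounds hold for each of its presentations.

For the degrees, multiplication by L identifies 𝒪/(J : L) with the kernel of 𝒪/J → 𝒪/(J + (L)). The
last ring is the ring of the arc L modulo the e-th power of its parameter, where e is the Noether
sum along L (`IsConsistent.finrank_sup`).

In the sheaf sequence, injectivity and exactness in the middle reduce to division by ℓ. Surjectivity
is local: a neighbourhood contains at most one centre, and power series there may be truncated to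
homogeneous polynomials because J contains all germs of high order (`exists_isFraction_lift`). -/

theorem divX_X_pow_mul (n : ℕ) (g : LocalRing K) : divX n (MvPowerSeries.X 0 ^ n * g) = g := by
  ext m
  change MvPowerSeries.coeff (m + Finsupp.single 0 n) (MvPowerSeries.X 0 ^ n * g) = _
  rw [MvPowerSeries.X_pow_eq, add_comm, MvPowerSeries.coeff_add_monomial_mul, one_mul]

theorem X_pow_mul_divX {n : ℕ} {g : LocalRing K} (h : MvPowerSeries.X 0 ^ n ∣ g) :
    MvPowerSeries.X 0 ^ n * divX n g = g := by
  obtain ⟨c, rfl⟩ := h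
  rw [divX_X_pow_mul]

theorem divX_add (n : ℕ) (f g : LocalRing K) : divX n (f + g) = divX n f + divX n g := rfl

theorem X_ne_zero (i : Fin 2) : (MvPowerSeries.X i : LocalRing K) ≠ 0 := by
  intro h
  have := congrArg (MvPowerSeries.coeff (Finsupp.single i 1)) h
  simp at this

@[simp] theorem order_X (i : Fin 2) : (MvPowerSeries.X i : LocalRing K).order = 1 := by
  rw [MvPowerSeries.X, MvPowerSeries.order_monomial_of_ne_zero one_ne_zero]
  simp

theorem order_pow (f : LocalRing K) (n : ℕ) : (f ^ n).order = n * f.order := by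
  induction n with
  | zero =>
    have := MvPowerSeries.order_monomial_of_ne_zero (d := (0 : Fin 2 →₀ ℕ)) (one_ne_zero' K)
    simpa [MvPowerSeries.monomial_zero_one] using this
  | succ n ih => rw [pow_succ, MvPowerSeries.order_mul, ih]; push_cast; ring

@[simp] theorem order_one : (1 : LocalRing K).order = 0 := by
  simpa using order_pow (1 : LocalRing K) 0

theorem order_X_pow (i : Fin 2) (n : ℕ) : (MvPowerSeries.X i ^ n : LocalRing K).order = n := by
  rw [order_pow, order_X, mul_one]

theorem isUnit_iff_order_eq_zero {f : LocalRing K} : IsUnit f ↔ f.order = 0 := by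
  rw [MvPowerSeries.isUnit_iff_constantCoeff, isUnit_iff_ne_zero, ← not_iff_not, not_not,
    ← MvPowerSeries.order_ne_zero_iff_constCoeff_eq_zero]

theorem one_le_order_iff {f : LocalRing K} :
    1 ≤ f.order ↔ MvPowerSeries.constantCoeff f = 0 :=
  MvPowerSeries.one_le_order_iff_constCoeff_eq_zero

theorem exists_order_eq {f : LocalRing K} (hf : f ≠ 0) : ∃ n : ℕ, f.order = n :=
  ⟨f.order.toNat, (MvPowerSeries.ne_zero_iff_order_finite.mp hf).symm⟩

theorem mem_orderIdeal {n : ℕ∞} {f : LocalRing K} : f ∈ orderIdeal n ↔ n ≤ f.order := Iff.rfl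

theorem le_order_add {n : ℕ∞} {f g : LocalRing K} (hf : n ≤ f.order) (hg : n ≤ g.order) :
    n ≤ (f + g).order := (orderIdeal n).add_mem hf hg

theorem le_order_sub {n : ℕ∞} {f g : LocalRing K} (hf : n ≤ f.order) (hg : n ≤ g.order) :
    n ≤ (f - g).order := sub_mem (show f ∈ orderIdeal n from hf) hg

theorem orderIdeal_anti {m n : ℕ∞} (h : m ≤ n) : (orderIdeal n : Ideal (LocalRing K)) ≤ orderIdeal m :=
  fun _ hf => h.trans hf

theorem X_pow_mem_orderIdeal (i : Fin 2) (n : ℕ) :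
    (MvPowerSeries.X i ^ n : LocalRing K) ∈ orderIdeal (n : ℕ∞) := (order_X_pow i n).ge

theorem blowup_X_zero_some (t : K) :
    blowup (some t) (MvPowerSeries.X 0) = MvPowerSeries.X 0 := by
  rw [blowup, MvPowerSeries.substAlgHom_X]; rfl

theorem blowup_X_one_some (t : K) : blowup (some t) (MvPowerSeries.X 1) =
    MvPowerSeries.X 0 * (MvPowerSeries.X 1 + MvPowerSeries.C t) := by
  rw [blowup, MvPowerSeries.substAlgHom_X]; rfl

theorem blowup_X_zero_none : blowup (K := K) none (MvPowerSeries.X 0) =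
    MvPowerSeries.X 0 * MvPowerSeries.X 1 := by
  rw [blowup, MvPowerSeries.substAlgHom_X]; rfl

theorem blowup_X_one_none :
    blowup (K := K) none (MvPowerSeries.X 1) = MvPowerSeries.X 0 := by
  rw [blowup, MvPowerSeries.substAlgHom_X]; rfl

theorem algHom_C {A : Type*} [Semiring A] [Algebra K A] (φ : LocalRing K →ₐ[K] A) (c : K) :
    φ (MvPowerSeries.C c) = algebraMap K A c := by
  rw [← φ.commutes c]; rfl

@[simp] theorem blowup_C (a : Option K) (c : K) :
    blowup a (MvPowerSeries.C c) = MvPowerSeries.C c := algHom_C _ _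

theorem constantCoeff_blowup (a : Option K) (f : LocalRing K) :
    MvPowerSeries.constantCoeff (blowup a f) = MvPowerSeries.constantCoeff f := by
  have h : ∀ g : LocalRing K, MvPowerSeries.constantCoeff g = 0 →
      MvPowerSeries.constantCoeff (blowup a g) = 0 := fun g hg => by
    rw [blowup, MvPowerSeries.substAlgHom_apply]
    refine MvPowerSeries.constantCoeff_subst_eq_zero (hasSubst_blowupCoord a) ?_ hg
    intro i
    cases a <;> fin_cases i <;> simp [blowupCoord]
  have := h (f - MvPowerSeries.C (MvPowerSeries.constantCoeff f)) (by simp)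
  rw [map_sub, blowup_C, map_sub, MvPowerSeries.constantCoeff_C, sub_eq_zero] at this
  exact this

theorem X_dvd_blowupCoord (a : Option K) (i : Fin 2) :
    (MvPowerSeries.X 0 : LocalRing K) ∣ blowupCoord a i := by
  cases a <;> fin_cases i <;> simp [blowupCoord]

/-- Both blown-up coordinates are multiples of u, so a monomial of degree at least n maps to a
multiple of uⁿ; monomials of lower degree do not occur in f. -/
theorem X_pow_dvd_blowup (a : Option K) {n : ℕ} {f : LocalRing K} (h : (n : ℕ∞) ≤ f.order) :
    MvPowerSeries.X 0 ^ n ∣ blowup a f := by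
  rw [MvPowerSeries.X_pow_dvd_iff]
  intro m hm
  rw [blowup, MvPowerSeries.substAlgHom_apply, MvPowerSeries.coeff_subst (hasSubst_blowupCoord a)]
  refine finsum_eq_zero_of_forall_eq_zero fun d => ?_
  by_cases hd : Finsupp.degree d < n
  · rw [MvPowerSeries.coeff_of_lt_order (lt_of_lt_of_le (by exact_mod_cast hd) h), zero_smul]
  · have : MvPowerSeries.X 0 ^ n ∣ d.prod fun s e => blowupCoord a s ^ e := by
      rw [Finsupp.prod_fintype _ _ (by simp), Fin.prod_univ_two]
      refine (pow_dvd_pow _ (show n ≤ d 0 + d 1 from ?_)).trans ?_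
      · rw [Finsupp.degree_eq_sum, Fin.sum_univ_two] at hd
        omega
      · rw [pow_add]
        exact mul_dvd_mul (pow_dvd_pow_of_dvd (X_dvd_blowupCoord a 0) _)
          (pow_dvd_pow_of_dvd (X_dvd_blowupCoord a 1) _)
    rw [MvPowerSeries.X_pow_dvd_iff.mp this m hm, smul_zero]

/-- The weak transform `u⁻ⁿ f_a` of a germ of order at least `n`. -/
def weakTransform (n : ℕ) (a : Option K) (f : LocalRing K) : LocalRing K := divX n (blowup a f)

theorem X_pow_mul_weakTransform {n : ℕ} (a : Option K) {f : LocalRing K}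
    (h : (n : ℕ∞) ≤ f.order) : MvPowerSeries.X 0 ^ n * weakTransform n a f = blowup a f :=
  X_pow_mul_divX (X_pow_dvd_blowup a h)

theorem weakTransform_eq {n : ℕ} {a : Option K} {f g : LocalRing K}
    (h : blowup a f = MvPowerSeries.X 0 ^ n * g) : weakTransform n a f = g := by
  rw [weakTransform, h, divX_X_pow_mul]

theorem strictTransform₁_eq {n : ℕ} {f : LocalRing K} (h : f.order = n) (a : Option K) :
    strictTransform₁ a f = weakTransform n a f := by
  rw [strictTransform₁, h]; rfl

theorem weakTransform_add (n : ℕ) (a : Option K) (f g : LocalRing K) :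
    weakTransform n a (f + g) = weakTransform n a f + weakTransform n a g := by
  rw [weakTransform, map_add, divX_add]; rfl

theorem weakTransform_sub (n : ℕ) (a : Option K) (f g : LocalRing K) :
    weakTransform n a (f - g) = weakTransform n a f - weakTransform n a g := by
  rw [eq_sub_iff_add_eq, ← weakTransform_add, sub_add_cancel]

@[simp] theorem weakTransform_zero (n : ℕ) (a : Option K) :
    weakTransform n a (0 : LocalRing K) = 0 := by
  simpa using weakTransform_sub n a (0 : LocalRing K) 0

theorem weakTransform_mul {m n : ℕ} (a : Option K) {f g : LocalRing K}
    (hf : (m : ℕ∞) ≤ f.order) (hg : (n : ℕ∞) ≤ g.order) :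
    weakTransform (m + n) a (f * g) = weakTransform m a f * weakTransform n a g := by
  apply weakTransform_eq
  rw [map_mul, ← X_pow_mul_weakTransform a hf, ← X_pow_mul_weakTransform a hg, pow_add]
  ring

theorem weakTransform_zero_left (a : Option K) (f : LocalRing K) :
    weakTransform 0 a f = blowup a f := weakTransform_eq (by simp)

theorem weakTransform_mul_blowup {n : ℕ} (a : Option K) {f : LocalRing K} (g : LocalRing K)
    (hf : (n : ℕ∞) ≤ f.order) :
    weakTransform n a (f * g) = weakTransform n a f * blowup a g := by
  rw [← weakTransform_zero_left]
  exact weakTransform_mul (n := 0) a hf (by simp)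

theorem weakTransform_C_mul (n : ℕ) (a : Option K) (c : K) (f : LocalRing K)
    (hf : (n : ℕ∞) ≤ f.order) :
    weakTransform n a (MvPowerSeries.C c * f) = MvPowerSeries.C c * weakTransform n a f := by
  rw [mul_comm, weakTransform_mul_blowup a _ hf, blowup_C, mul_comm]

theorem weakTransform_of_le {m n : ℕ} (hmn : n ≤ m) (a : Option K) {f : LocalRing K}
    (hf : (m : ℕ∞) ≤ f.order) :
    weakTransform n a f = MvPowerSeries.X 0 ^ (m - n) * weakTransform m a f := by
  apply weakTransform_eq
  rw [← mul_assoc, ← pow_add, Nat.add_sub_cancel' hmn, X_pow_mul_weakTransform a hf]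

theorem weakTransform_succ (n : ℕ) (a : Option K) {f : LocalRing K}
    (hf : ((n + 1 : ℕ) : ℕ∞) ≤ f.order) :
    weakTransform n a f = MvPowerSeries.X 0 * weakTransform (n + 1) a f := by
  rw [weakTransform_of_le n.le_succ a hf]; simp

theorem le_order_mul_left {n : ℕ∞} {f : LocalRing K} (g : LocalRing K) (hf : n ≤ f.order) :
    n ≤ (f * g).order := (orderIdeal n).mul_mem_right g hf

theorem le_order_weakTransform {m n : ℕ} (a : Option K) {f : LocalRing K}
    (hf : ((m + n : ℕ) : ℕ∞) ≤ f.order) : (m : ℕ∞) ≤ (weakTransform n a f).order := by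
  rw [weakTransform_of_le (Nat.le_add_left n m) a hf, Nat.add_sub_cancel]
  exact le_order_mul_left _ (order_X_pow 0 m).ge

/-! ### Smooth arcs -/

theorem hasSubst_graph (h : PowerSeries K) :
    MvPowerSeries.HasSubst (![PowerSeries.X, PowerSeries.X * h] : Fin 2 → MvPowerSeries Unit K) := by
  apply MvPowerSeries.hasSubst_of_constantCoeff_zero
  intro i
  fin_cases i
  · exact PowerSeries.constantCoeff_X
  · change PowerSeries.constantCoeff (PowerSeries.X * h) = 0
    simp

/-- Restriction of germs to the graph `y = x h(x)`. -/
def graphArc (h : PowerSeries K) : LocalRing K →ₐ[K] PowerSeries K :=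
  MvPowerSeries.substAlgHom (hasSubst_graph h)

/-- Restriction of germs to the smooth arc that passes through the infinitely near point `[a]` and
is there the graph `v = u h(u)`. -/
def arc (a : Option K) (h : PowerSeries K) : LocalRing K →ₐ[K] PowerSeries K :=
  (graphArc h).comp (blowup a)

@[simp] theorem graphArc_X_zero (h : PowerSeries K) :
    graphArc h (MvPowerSeries.X 0) = PowerSeries.X := by
  rw [graphArc, MvPowerSeries.substAlgHom_X]; rfl

@[simp] theorem graphArc_X_one (h : PowerSeries K) :
    graphArc h (MvPowerSeries.X 1) = PowerSeries.X * h := by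
  rw [graphArc, MvPowerSeries.substAlgHom_X]; rfl

/-- Units map to units: if the two constant terms differed, subtracting the one of the image from f
would leave a unit whose image is not a unit. -/
theorem constantCoeff_algHom (φ : LocalRing K →ₐ[K] PowerSeries K) (f : LocalRing K) :
    PowerSeries.constantCoeff (φ f) = MvPowerSeries.constantCoeff f := by
  have h : ∀ g : LocalRing K, MvPowerSeries.constantCoeff g ≠ 0 →
      PowerSeries.constantCoeff (φ g) ≠ 0 := fun g hg => by
    have := (MvPowerSeries.isUnit_iff_constantCoeff.mpr (isUnit_iff_ne_zero.mpr hg)).map φ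
    exact isUnit_iff_ne_zero.mp (PowerSeries.isUnit_iff_constantCoeff.mp this)
  by_contra hne
  refine h (f - MvPowerSeries.C (PowerSeries.constantCoeff (φ f))) ?_ ?_
  · rw [map_sub, MvPowerSeries.constantCoeff_C, sub_ne_zero]
    exact Ne.symm hne
  · rw [map_sub, algHom_C]
    simp

/-- The shift `(h - h(0)) / X` of a power series. -/
def shift (h : PowerSeries K) : PowerSeries K := PowerSeries.mk fun n => PowerSeries.coeff (n + 1) h

theorem eq_X_mul_shift (h : PowerSeries K) :
    h = PowerSeries.X * shift h + PowerSeries.C (PowerSeries.constantCoeff h) :=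
  PowerSeries.eq_X_mul_shift_add_const h

/-- The graph y = x h(x) has slope h(0). Writing h = h(0) + x k, it becomes v = u k(u) at that
point, a graph of the same shape; so an arc can be followed recursively through its infinitely near
points. -/
theorem graphArc_eq_arc (h : PowerSeries K) :
    graphArc h = arc (some (PowerSeries.constantCoeff h)) (shift h) := by
  apply AlgHom.ext
  intro f
  rw [arc, AlgHom.comp_apply, graphArc, graphArc, blowup,
    MvPowerSeries.substAlgHom_comp_substAlgHom_apply]
  rw [MvPowerSeries.substAlgHom_apply, MvPowerSeries.substAlgHom_apply]
  congr 1
  funext i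
  have h0 := graphArc_X_zero (shift h)
  have h1 := graphArc_X_one (shift h)
  have hC := algHom_C (graphArc (shift h)) (PowerSeries.constantCoeff h)
  fin_cases i
  · exact h0.symm
  · change PowerSeries.X * h =
      graphArc (shift h) (MvPowerSeries.X 0 * (MvPowerSeries.X 1 + MvPowerSeries.C _))
    rw [map_mul, map_add, h0, h1, hC]
    conv_lhs => rw [eq_X_mul_shift h]
    rfl

/-- One step of Noether's formula: the blowing up splits off Xⁿ, and the rest of the restriction
lives on the continued arc. -/
theorem arc_eq (a : Option K) (h : PowerSeries K) {n : ℕ} {f : LocalRing K}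
    (hf : (n : ℕ∞) ≤ f.order) : arc a h f = PowerSeries.X ^ n *
      arc (some (PowerSeries.constantCoeff h)) (shift h) (weakTransform n a f) := by
  rw [← graphArc_eq_arc, arc, AlgHom.comp_apply, ← X_pow_mul_weakTransform a hf, map_mul, map_pow,
    graphArc_X_zero]

theorem X_pow_dvd_arc (a : Option K) (h : PowerSeries K) {n : ℕ} {f : LocalRing K}
    (hf : (n : ℕ∞) ≤ f.order) : PowerSeries.X ^ n ∣ arc a h f := ⟨_, arc_eq a h hf⟩

/-- Restriction of germs to the axis `u = 0`. -/
abbrev axis : LocalRing K →ₐ[K] PowerSeries K := arc none 0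

theorem axis_X_zero : axis (K := K) (MvPowerSeries.X 0) = 0 := by
  rw [axis, arc, AlgHom.comp_apply, blowup_X_zero_none, map_mul, graphArc_X_one]; simp

theorem axis_X_one : axis (K := K) (MvPowerSeries.X 1) = PowerSeries.X := by
  rw [axis, arc, AlgHom.comp_apply, blowup_X_one_none, graphArc_X_zero]

/-- Weierstrass-type decomposition with respect to the axis `u = 0`. -/
theorem exists_eq_add_of_coeff_eq_zero (f : LocalRing K) (e : ℕ)
    (he : ∀ j < e, MvPowerSeries.coeff (Finsupp.single 1 j) f = 0) :
    ∃ p q : LocalRing K, f = MvPowerSeries.X 0 * p + MvPowerSeries.X 1 ^ e * q ∧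
      MvPowerSeries.constantCoeff q = MvPowerSeries.coeff (Finsupp.single 1 e) f := by
  classical
  -- `r` collects the monomials of f without X 0, so X 0 divides f - r and X 1 ^ e divides r.
  let r : LocalRing K := fun m => if m 0 = 0 then MvPowerSeries.coeff m f else 0
  have hr : ∀ m, MvPowerSeries.coeff m r = if m 0 = 0 then MvPowerSeries.coeff m f else 0 :=
    fun m => rfl
  have h1 : MvPowerSeries.X 0 ∣ f - r := by
    rw [MvPowerSeries.X_dvd_iff]
    intro m hm
    simp [hr, hm]
  have h2 : MvPowerSeries.X 1 ^ e ∣ r := by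
    rw [MvPowerSeries.X_pow_dvd_iff]
    intro m hm
    rw [hr]
    split_ifs with h0
    · have : m = Finsupp.single 1 (m 1) := by
        ext i; fin_cases i <;> simp [h0]
      rw [this]
      exact he _ hm
    · rfl
  obtain ⟨p, hp⟩ := h1
  obtain ⟨q, hq⟩ := h2
  refine ⟨p, q, ?_, ?_⟩
  · rw [← hp, ← hq]; ring
  · have := hr (Finsupp.single 1 e)
    rw [hq, MvPowerSeries.X_pow_eq] at this
    have h3 := MvPowerSeries.coeff_add_monomial_mul (Finsupp.single (1 : Fin 2) e) 0 q (1 : K)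
    rw [add_zero, this] at h3
    simpa using h3.symm

theorem axis_order_eq {f p q : LocalRing K} {e : ℕ}
    (h : f = MvPowerSeries.X 0 * p + MvPowerSeries.X 1 ^ e * q)
    (hq : MvPowerSeries.constantCoeff q ≠ 0) : (axis f).order = e := by
  rw [h, map_add, map_mul, axis_X_zero, zero_mul, zero_add, map_mul, map_pow, axis_X_one,
    PowerSeries.order_mul, PowerSeries.order_X_pow]
  have : (axis q).order = 0 := by
    rw [← constantCoeff_algHom axis] at hq
    exact PowerSeries.order_zero_of_unit
      (PowerSeries.isUnit_iff_constantCoeff.mpr (isUnit_iff_ne_zero.mpr hq))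
  rw [this, add_zero]

theorem exists_eq_add_of_axis_order {f : LocalRing K} {e : ℕ} (he : (axis f).order = e) :
    ∃ p q : LocalRing K, f = MvPowerSeries.X 0 * p + MvPowerSeries.X 1 ^ e * q ∧
      MvPowerSeries.constantCoeff q ≠ 0 := by
  classical
  by_cases hex : ∃ j, MvPowerSeries.coeff (Finsupp.single 1 j) f ≠ 0
  · obtain ⟨p, q, h, hq⟩ := exists_eq_add_of_coeff_eq_zero f (Nat.find hex)
      (fun j hj => not_not.mp (Nat.find_min hex hj))
    have hq' : MvPowerSeries.constantCoeff q ≠ 0 := hq ▸ Nat.find_spec hex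
    have := axis_order_eq h hq'
    rw [he] at this
    have h2 : e = Nat.find hex := by exact_mod_cast this
    rw [h2]
    exact ⟨p, q, h, hq'⟩
  · push Not at hex
    have : MvPowerSeries.X 0 ∣ f := by
      rw [MvPowerSeries.X_dvd_iff]
      intro m hm
      have : m = Finsupp.single 1 (m 1) := by
        ext i; fin_cases i <;> simp [hm]
      rw [this]
      exact hex _
    obtain ⟨p, rfl⟩ := this
    rw [map_mul, axis_X_zero, zero_mul, PowerSeries.order_zero] at he
    exact absurd he (by simp)

end Basic

/-! ### Initial forms and their zeros on the exceptional line -/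

section InitialForm

variable {K : Type*} [Field K]

open Polynomial in
/-- The homogeneous form `∑ cⱼ xⁿ⁻ʲ yʲ` with dehomogenization `∑ cⱼ sʲ`. -/
def homForm (n : ℕ) (P : K[X]) : LocalRing K :=
  ∑ j ∈ Finset.range (n + 1),
    MvPowerSeries.C (P.coeff j) * (MvPowerSeries.X 0 ^ (n - j) * MvPowerSeries.X 1 ^ j)

theorem X_pow_mul_X_pow (i j : ℕ) : (MvPowerSeries.X 0 ^ i * MvPowerSeries.X 1 ^ j : LocalRing K) =
    MvPowerSeries.monomial (Finsupp.single 0 i + Finsupp.single 1 j) 1 := by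
  rw [MvPowerSeries.X_pow_eq, MvPowerSeries.X_pow_eq, MvPowerSeries.monomial_mul_monomial, one_mul]

theorem degree_fin_two (m : Fin 2 →₀ ℕ) : Finsupp.degree m = m 0 + m 1 := by
  rw [Finsupp.degree_eq_sum, Fin.sum_univ_two]

theorem eq_single_add_single (m : Fin 2 →₀ ℕ) :
    m = Finsupp.single 0 (m 0) + Finsupp.single 1 (m 1) := by
  ext i; fin_cases i <;> simp

theorem coeff_homForm (n : ℕ) (P : Polynomial K) (m : Fin 2 →₀ ℕ) :
    MvPowerSeries.coeff m (homForm n P) = if Finsupp.degree m = n then P.coeff (m 1) else 0 := by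
  classical
  have h1 : ∀ j, MvPowerSeries.coeff m (MvPowerSeries.C (P.coeff j) *
      (MvPowerSeries.X 0 ^ (n - j) * MvPowerSeries.X 1 ^ j)) =
        if m 0 = n - j ∧ m 1 = j then P.coeff j else 0 := by
    intro j
    rw [MvPowerSeries.coeff_C_mul, X_pow_mul_X_pow, MvPowerSeries.coeff_monomial]
    have : m = Finsupp.single 0 (n - j) + Finsupp.single 1 j ↔ m 0 = n - j ∧ m 1 = j := by
      constructor
      · intro h; rw [h]; simp
      · rintro ⟨h, h'⟩; rw [eq_single_add_single m, h, h']
    simp only [this]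
    split_ifs <;> simp
  rw [homForm, map_sum, Finset.sum_congr rfl fun j _ => h1 j, degree_fin_two]
  by_cases hm : m 0 + m 1 = n
  · rw [if_pos hm, Finset.sum_eq_single (m 1)]
    · rw [if_pos ⟨by omega, rfl⟩]
    · intro j _ hj
      rw [if_neg]
      exact fun h => hj h.2.symm
    · intro h
      simp at h
      omega
  · rw [if_neg hm]
    refine Finset.sum_eq_zero fun j hj => if_neg ?_
    rintro ⟨h, h'⟩
    rw [Finset.mem_range] at hj
    omega

/-- The dehomogenization of the homogeneous part of degree `n`. -/
def initialPoly (n : ℕ) (f : LocalRing K) : Polynomial K :=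
  ∑ j ∈ Finset.range (n + 1), Polynomial.monomial j
    (MvPowerSeries.coeff (Finsupp.single 0 (n - j) + Finsupp.single 1 j) f)

theorem coeff_initialPoly {n j : ℕ} (hj : j ≤ n) (f : LocalRing K) : (initialPoly n f).coeff j =
    MvPowerSeries.coeff (Finsupp.single 0 (n - j) + Finsupp.single 1 j) f := by
  rw [initialPoly, Polynomial.finsetSum_coeff, Finset.sum_eq_single j]
  · simp
  · intro i _ hi
    rw [Polynomial.coeff_monomial, if_neg hi]
  · intro h
    simp at h
    omega

theorem natDegree_initialPoly_lt (n : ℕ) (f : LocalRing K) :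
    (initialPoly n f).natDegree < n + 1 := by
  refine Nat.lt_succ_of_le (Polynomial.natDegree_sum_le_of_forall_le _ _ fun j hj => ?_)
  exact (Polynomial.natDegree_monomial_le _).trans (Finset.mem_range_succ_iff.mp hj)

theorem le_order_sub_homForm {n : ℕ} {f : LocalRing K} (hf : (n : ℕ∞) ≤ f.order) :
    ((n + 1 : ℕ) : ℕ∞) ≤ (f - homForm n (initialPoly n f)).order := by
  apply MvPowerSeries.nat_le_order
  intro d hd
  rw [map_sub, coeff_homForm]
  split_ifs with h
  · rw [degree_fin_two] at h
    rw [coeff_initialPoly (by omega)]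
    have : d = Finsupp.single 0 (n - d 1) + Finsupp.single 1 (d 1) := by
      conv_lhs => rw [eq_single_add_single d]
      congr 2; omega
    rw [← this, sub_self]
  · rw [sub_zero]
    exact MvPowerSeries.coeff_of_lt_order (lt_of_lt_of_le (by exact_mod_cast (by omega)) hf)

theorem weakTransform_homForm_some (n : ℕ) (P : Polynomial K) (t : K) :
    weakTransform n (some t) (homForm n P) = ∑ j ∈ Finset.range (n + 1),
      MvPowerSeries.C (P.coeff j) * (MvPowerSeries.X 1 + MvPowerSeries.C t) ^ j := by
  apply weakTransform_eq
  rw [homForm, map_sum, Finset.mul_sum]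
  refine Finset.sum_congr rfl fun j hj => ?_
  rw [map_mul, map_mul, map_pow, map_pow, blowup_C, blowup_X_zero_some, blowup_X_one_some, mul_pow]
  have : n = n - j + j := by rw [Finset.mem_range] at hj; omega
  conv_rhs => rw [this, pow_add]
  ring

theorem weakTransform_homForm_none (n : ℕ) (P : Polynomial K) :
    weakTransform n none (homForm n P) = ∑ j ∈ Finset.range (n + 1),
      MvPowerSeries.C (P.coeff j) * MvPowerSeries.X 1 ^ (n - j) := by
  apply weakTransform_eq
  rw [homForm, map_sum, Finset.mul_sum]
  refine Finset.sum_congr rfl fun j hj => ?_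
  rw [map_mul, map_mul, map_pow, map_pow, blowup_C, blowup_X_zero_none, blowup_X_one_none, mul_pow]
  have : n = n - j + j := by rw [Finset.mem_range] at hj; omega
  conv_rhs => rw [this, pow_add, Nat.add_sub_cancel]
  ring

theorem axis_C (c : K) : axis (MvPowerSeries.C c) = PowerSeries.C c := algHom_C _ _

/-- The part of f of order above n contributes a multiple of u, which vanishes on the exceptional
line. -/
theorem axis_weakTransform_eq {n : ℕ} {f : LocalRing K} (hf : (n : ℕ∞) ≤ f.order)
    (a : Option K) : axis (weakTransform n a f) =
      axis (weakTransform n a (homForm n (initialPoly n f))) := by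
  rw [← sub_eq_zero, ← map_sub, ← weakTransform_sub, weakTransform_succ n a (le_order_sub_homForm hf),
    map_mul, axis_X_zero, zero_mul]

theorem axis_weakTransform_some {n : ℕ} {f : LocalRing K} (hf : (n : ℕ∞) ≤ f.order) (t : K) :
    axis (weakTransform n (some t) f) =
      ((initialPoly n f).comp (Polynomial.X + Polynomial.C t) : Polynomial K) := by
  rw [axis_weakTransform_eq hf, weakTransform_homForm_some, Polynomial.comp,
    Polynomial.eval₂_eq_sum_range' _ (natDegree_initialPoly_lt n f), map_sum,
    ← Polynomial.coeToPowerSeries.ringHom_apply, map_sum]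
  refine Finset.sum_congr rfl fun j _ => ?_
  simp only [map_mul, map_pow, map_add, axis_C, axis_X_one,
    Polynomial.coeToPowerSeries.ringHom_apply, Polynomial.coe_C, Polynomial.coe_X]

theorem axis_weakTransform_none {n : ℕ} {f : LocalRing K} (hf : (n : ℕ∞) ≤ f.order) :
    axis (weakTransform n none f) = ∑ j ∈ Finset.range (n + 1),
      PowerSeries.C ((initialPoly n f).coeff j) * PowerSeries.X ^ (n - j) := by
  rw [axis_weakTransform_eq hf, weakTransform_homForm_none, map_sum]
  refine Finset.sum_congr rfl fun j _ => ?_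
  simp only [map_mul, map_pow, axis_C, axis_X_one]

/-- At ∞ the form is read backwards, so the drop of the degree of the dehomogenization below n
measures the zero there. -/
theorem coeff_axis_weakTransform_none {n : ℕ} {f : LocalRing K} (hf : (n : ℕ∞) ≤ f.order) {j : ℕ}
    (hj : j ≤ n) : PowerSeries.coeff (n - j) (axis (weakTransform n none f)) =
      (initialPoly n f).coeff j := by
  rw [axis_weakTransform_none hf, map_sum, Finset.sum_eq_single j]
  · simp
  · intro i hi hij
    rw [Finset.mem_range] at hi
    rw [PowerSeries.coeff_C_mul, PowerSeries.coeff_X_pow, if_neg (by omega), mul_zero]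
  · intro h
    simp at h
    omega

theorem initialPoly_ne_zero {n : ℕ} {f : LocalRing K} (hf : f.order = n) : initialPoly n f ≠ 0 := by
  intro h
  have := le_order_sub_homForm hf.ge
  rw [h, homForm] at this
  simp [hf] at this
  norm_cast at this
  omega

theorem X_sub_C_pow_dvd {P : Polynomial K} {t : K} {e : ℕ}
    (h : (e : ℕ∞) ≤ ((P.comp (Polynomial.X + Polynomial.C t) : Polynomial K) : PowerSeries K).order) :
    (Polynomial.X - Polynomial.C t) ^ e ∣ P := by
  have h1 : Polynomial.X ^ e ∣ P.comp (Polynomial.X + Polynomial.C t) := by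
    rw [Polynomial.X_pow_dvd_iff]
    intro d hd
    rw [← Polynomial.coeff_coe]
    exact PowerSeries.coeff_of_lt_order _ (lt_of_lt_of_le (by exact_mod_cast hd) h)
  have h2 := map_dvd (Polynomial.compRingHom (Polynomial.X - Polynomial.C t)) h1
  simpa [Polynomial.comp_assoc] using h2

/-- The initial form of degree `n` has at most `n` zeros on the exceptional line. -/
theorem sum_le_of_le_axis_order {n : ℕ} {f : LocalRing K} (hf : f.order = n)
    (A : Finset (Option K)) (e : Option K → ℕ)
    (he : ∀ a ∈ A, (e a : ℕ∞) ≤ (axis (weakTransform n a f)).order) : ∑ a ∈ A, e a ≤ n := by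
  classical
  -- Extension by zero permits splitting off ∞: finite directions are counted by linear factors of
  -- P, and ∞ by n minus the degree of P.
  let e' : Option K → ℕ := fun a => if a ∈ A then e a else 0
  have he' : ∀ a, (e' a : ℕ∞) ≤ (axis (weakTransform n a f)).order := by
    intro a
    by_cases ha : a ∈ A <;> simp [e', ha, he]
  have h1 : ∑ a ∈ A, e a ≤ ∑ a ∈ Finset.insertNone (Finset.eraseNone A), e' a := by
    rw [Finset.sum_congr rfl (g := e') fun a ha => by simp [e', ha]]
    refine Finset.sum_le_sum_of_subset fun a ha => ?_
    cases a <;> simp [ha]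
  refine h1.trans ?_
  rw [Finset.sum_insertNone]
  have hP := initialPoly_ne_zero hf
  set P := initialPoly n f
  have h2 : ∏ t ∈ Finset.eraseNone A, (Polynomial.X - Polynomial.C t) ^ e' (some t) ∣ P := by
    refine Finset.prod_dvd_of_coprime ?_ fun t _ => X_sub_C_pow_dvd ?_
    · intro s _ t _ hst
      exact (Polynomial.isCoprime_X_sub_C_of_isUnit_sub
        (isUnit_iff_ne_zero.mpr (sub_ne_zero.mpr hst))).pow
    · rw [← axis_weakTransform_some hf.ge]
      exact he' _
  have h3 := Polynomial.natDegree_le_of_dvd h2 hP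
  rw [Polynomial.natDegree_prod_of_monic _ _ fun t _ => (Polynomial.monic_X_sub_C t).pow _] at h3
  simp only [Polynomial.natDegree_pow, Polynomial.natDegree_X_sub_C, mul_one] at h3
  have h4 : P.coeff P.natDegree ≠ 0 := by
    rwa [Polynomial.coeff_natDegree, Polynomial.leadingCoeff_ne_zero]
  have h5 : P.natDegree ≤ n := Nat.le_of_lt_succ (natDegree_initialPoly_lt n f)
  rw [← coeff_axis_weakTransform_none hf.ge h5] at h4
  have h6 := (he' none).trans (PowerSeries.order_le _ h4)
  norm_cast at h6
  omega

/-- A germ of order at least `n` with too many zeros has order greater than `n`. -/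
theorem succ_le_order_of_lt_sum {n : ℕ} {f : LocalRing K} (hf : (n : ℕ∞) ≤ f.order)
    (A : Finset (Option K)) (e : Option K → ℕ)
    (he : ∀ a ∈ A, (e a : ℕ∞) ≤ (axis (weakTransform n a f)).order) (h : n < ∑ a ∈ A, e a) :
    ((n + 1 : ℕ) : ℕ∞) ≤ f.order := by
  by_contra hlt
  have : f.order = n := by
    refine le_antisymm ?_ hf
    rw [not_le] at hlt
    exact Order.le_of_lt_add_one (by exact_mod_cast hlt)
  exact absurd (sum_le_of_le_axis_order this A e he) (by omega)

/-- A vanishing restriction has order ⊤ and would count as a zero of multiplicity n + 1. -/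
theorem axis_weakTransform_ne_zero {n : ℕ} {f : LocalRing K} (hf : f.order = n) (a : Option K) :
    axis (weakTransform n a f) ≠ 0 := by
  intro h
  have := sum_le_of_le_axis_order hf {a} (fun _ => n + 1) (by simp [h])
  simp at this

theorem blowup_injective (a : Option K) : Function.Injective (blowup a : LocalRing K → LocalRing K) := by
  rw [injective_iff_map_eq_zero]
  intro f hf
  by_contra hne
  obtain ⟨n, hn⟩ := exists_order_eq hne
  refine axis_weakTransform_ne_zero hn a ?_
  rw [weakTransform_eq (g := 0) (by simpa using hf), map_zero]

end InitialForm

/-! ### Interpolation along the exceptional line -/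

section Interpolation

variable {K : Type*} [Field K]

/-- The line through the origin with direction `a`. -/
def line : Option K → LocalRing K
  | some t => MvPowerSeries.X 1 - MvPowerSeries.C t * MvPowerSeries.X 0
  | none => MvPowerSeries.X 0

theorem one_le_order_line (a : Option K) : ((1 : ℕ) : ℕ∞) ≤ (line a).order := by
  rw [Nat.cast_one, one_le_order_iff]
  cases a <;> simp [line]

theorem weakTransform_line_self (a : Option K) :
    weakTransform 1 a (line a) = MvPowerSeries.X 1 := by
  apply weakTransform_eq
  rw [pow_one]
  cases a with
  | none => exact blowup_X_zero_none
  | some t =>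
    rw [line, map_sub, map_mul, blowup_X_one_some, blowup_X_zero_some, blowup_C]
    ring

theorem constantCoeff_weakTransform_line {a b : Option K} (h : a ≠ b) :
    MvPowerSeries.constantCoeff (weakTransform 1 b (line a)) ≠ 0 := by
  cases a with
  | none =>
    cases b with
    | none => exact absurd rfl h
    | some s =>
      rw [weakTransform_eq (g := 1) (by rw [line, blowup_X_zero_some]; simp)]
      simp
  | some t =>
    cases b with
    | none =>
      rw [weakTransform_eq (g := 1 - MvPowerSeries.C t * MvPowerSeries.X 1) (by
        rw [line, map_sub, map_mul, blowup_X_one_none, blowup_X_zero_none, blowup_C]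
        ring)]
      simp
    | some s =>
      rw [weakTransform_eq (g := MvPowerSeries.X 1 + MvPowerSeries.C (s - t)) (by
        rw [line, map_sub, map_mul, blowup_X_one_some, blowup_X_zero_some, blowup_C, map_sub]
        ring)]
      simp only [map_add, MvPowerSeries.constantCoeff_X, MvPowerSeries.constantCoeff_C, zero_add]
      exact sub_ne_zero.mpr fun hst => h (by rw [hst])

theorem le_order_pow_of_le {f : LocalRing K} {n : ℕ} (hf : (n : ℕ∞) ≤ f.order) (k : ℕ) :
    ((n * k : ℕ) : ℕ∞) ≤ (f ^ k).order := by
  rw [order_pow, mul_comm]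
  push_cast
  gcongr

theorem weakTransform_pow {n : ℕ} (a : Option K) {f : LocalRing K} (hf : (n : ℕ∞) ≤ f.order)
    (k : ℕ) : weakTransform (n * k) a (f ^ k) = weakTransform n a f ^ k := by
  apply weakTransform_eq
  rw [map_pow, ← X_pow_mul_weakTransform a hf, mul_pow, pow_mul]

theorem le_order_line_pow (a : Option K) (k : ℕ) : (k : ℕ∞) ≤ (line a ^ k).order := by
  simpa using le_order_pow_of_le (one_le_order_line a) k

theorem weakTransform_line_pow (a b : Option K) (k : ℕ) :
    weakTransform k b (line a ^ k) = weakTransform 1 b (line a) ^ k := by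
  simpa using weakTransform_pow b (one_le_order_line a) k

theorem le_order_mul_of_le {m n : ℕ} {f g : LocalRing K} (hf : (m : ℕ∞) ≤ f.order)
    (hg : (n : ℕ∞) ≤ g.order) : ((m + n : ℕ) : ℕ∞) ≤ (f * g).order := by
  rw [MvPowerSeries.order_mul]
  push_cast
  gcongr

/-- A product of lines, with prescribed multiplicities on the exceptional line. -/
theorem exists_prod_lines (A : Finset (Option K)) (e : Option K → ℕ) (he : ∀ a ∉ A, e a = 0) :
    ∃ F : LocalRing K, ((∑ a ∈ A, e a : ℕ) : ℕ∞) ≤ F.order ∧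
      ∀ b, ∃ w, MvPowerSeries.constantCoeff w ≠ 0 ∧
        weakTransform (∑ a ∈ A, e a) b F = MvPowerSeries.X 1 ^ e b * w := by
  classical
  induction A using Finset.induction_on generalizing e with
  | empty =>
    refine ⟨1, by simp, fun b => ⟨1, by simp, ?_⟩⟩
    rw [he b (by simp), Finset.sum_empty, weakTransform_zero_left]
    simp
  | insert c A hc ih =>
    have h0 : ∑ a ∈ A, Function.update e c 0 a = ∑ a ∈ A, e a :=
      Finset.sum_congr rfl fun a ha => Function.update_of_ne (ne_of_mem_of_not_mem ha hc) _ _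
    obtain ⟨F, hF, h⟩ := ih (Function.update e c 0) fun a ha => by
      by_cases hac : a = c
      · simp [hac]
      · rw [Function.update_of_ne hac]
        exact he a (by simp [hac, ha])
    rw [h0] at hF h
    rw [Finset.sum_insert hc]
    refine ⟨line c ^ e c * F, le_order_mul_of_le (le_order_line_pow c _) hF, fun b => ?_⟩
    obtain ⟨w, hw, hb⟩ := h b
    rw [weakTransform_mul b (le_order_line_pow c _) hF, hb, weakTransform_line_pow]
    by_cases hbc : b = c
    · subst hbc
      refine ⟨w, hw, ?_⟩
      rw [weakTransform_line_self, Function.update_self, pow_zero, one_mul]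
    · refine ⟨weakTransform 1 b (line c) ^ e c * w, ?_, ?_⟩
      · rw [map_mul, map_pow]
        exact mul_ne_zero (pow_ne_zero _ (constantCoeff_weakTransform_line (Ne.symm hbc))) hw
      · rw [Function.update_of_ne hbc]
        ring

theorem mem_span_X_of_constantCoeff {f : LocalRing K} (h : MvPowerSeries.constantCoeff f = 0) :
    ∃ p q, f = MvPowerSeries.X 0 * p + MvPowerSeries.X 1 * q := by
  obtain ⟨p, q, hf, -⟩ := exists_eq_add_of_coeff_eq_zero f 1 (by
    intro j hj
    have : j = 0 := by omega
    subst this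
    simpa using h)
  exact ⟨p, q, by simpa using hf⟩

/-- Interpolation of restrictions to the exceptional line by germs of order at least `n`. -/
theorem exists_interpolation (n : ℕ) (A : Finset (Option K)) (e : Option K → ℕ)
    (he : ∑ a ∈ A, e a ≤ n + 1) (g : Option K → LocalRing K) :
    ∃ F : LocalRing K, (n : ℕ∞) ≤ F.order ∧ ∀ a ∈ A, ∃ p q,
      weakTransform n a F - g a = MvPowerSeries.X 0 * p + MvPowerSeries.X 1 ^ e a * q := by
  classical
  -- Conditions are imposed one at a time: the last one, at a, is met by adding a multiple of a form
  -- of degree n that satisfies the earlier ones homogeneously and has no further contact at a.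
  induction hs : ∑ a ∈ A, e a generalizing e with
  | zero =>
    refine ⟨0, by simp, fun a ha => ⟨0, weakTransform n a 0 - g a, ?_⟩⟩
    rw [Finset.sum_eq_zero_iff.mp hs a ha]
    simp
  | succ s ih =>
    obtain ⟨a, haA, ha⟩ : ∃ a ∈ A, e a ≠ 0 := by
      by_contra! h
      rw [Finset.sum_eq_zero h] at hs
      omega
    let e' := Function.update e a (e a - 1)
    have hsum : ∑ b ∈ A, e' b = s := by
      have h1 := Finset.add_sum_erase A e haA
      have h2 := Finset.add_sum_erase A e' haA
      have h3 : ∑ x ∈ A.erase a, e' x = ∑ x ∈ A.erase a, e x :=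
        Finset.sum_congr rfl fun b hb => Function.update_of_ne (Finset.ne_of_mem_erase hb) _ _
      have h4 : e' a = e a - 1 := Function.update_self ..
      omega
    obtain ⟨F, hF, h⟩ := ih e' (by omega) hsum
    -- A power of a line in a direction c ≠ a raises the degree from s to n without a new zero at a.
    -- The bound n + 1 on the total gives s ≤ n.
    obtain ⟨c, hc⟩ := exists_ne a
    let e'' : Option K → ℕ := fun b => if b ∈ A then e' b else 0
    obtain ⟨G, hG, hG'⟩ := exists_prod_lines A e'' (by intro b hb; simp [e'', hb])
    have hsum' : ∑ b ∈ A, e'' b = s := by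
      rw [← hsum]
      exact Finset.sum_congr rfl fun b hb => by simp [e'', hb]
    rw [hsum'] at hG hG'
    have hn : n = s + (n - s) := by omega
    have hGc : (n : ℕ∞) ≤ (G * line c ^ (n - s)).order := by
      have := le_order_mul_of_le hG (le_order_line_pow c (n - s))
      rwa [← hn] at this
    have hGc' : ∀ b, weakTransform n b (G * line c ^ (n - s)) =
        weakTransform s b G * weakTransform 1 b (line c) ^ (n - s) := by
      intro b
      conv_lhs => rw [hn]
      rw [Nat.add_sub_cancel_left, weakTransform_mul b hG (le_order_line_pow c _),
        weakTransform_line_pow]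
    obtain ⟨p, q, hpq⟩ := h a haA
    obtain ⟨w, hw, hwa⟩ := hG' a
    have hw' : MvPowerSeries.constantCoeff (w * weakTransform 1 a (line c) ^ (n - s)) ≠ 0 := by
      rw [map_mul, map_pow]
      exact mul_ne_zero hw (pow_ne_zero _ (constantCoeff_weakTransform_line hc))
    set w' := w * weakTransform 1 a (line c) ^ (n - s)
    -- This scalar cancels the constant term of q, which raises the contact at a by one.
    let k : K := MvPowerSeries.constantCoeff q / MvPowerSeries.constantCoeff w'
    refine ⟨F - MvPowerSeries.C k * (G * line c ^ (n - s)), le_order_sub hF ?_, fun b hb => ?_⟩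
    · rw [mul_comm]
      exact le_order_mul_left _ hGc
    · rw [weakTransform_sub, weakTransform_C_mul _ _ _ _ hGc, hGc']
      by_cases hba : b = a
      · subst hba
        obtain ⟨p', q', hq⟩ := mem_span_X_of_constantCoeff (f := q - MvPowerSeries.C k * w') (by
          rw [map_sub, map_mul, MvPowerSeries.constantCoeff_C, div_mul_cancel₀ _ hw', sub_self])
        refine ⟨p + MvPowerSeries.X 1 ^ (e b - 1) * p', q', ?_⟩
        have h5 : e'' b = e b - 1 := by simp [e'', hb, e']
        have h6 : e' b = e b - 1 := by simp [e']
        rw [h5] at hwa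
        rw [h6] at hpq
        have h7 : (MvPowerSeries.X 1 : LocalRing K) ^ e b =
            MvPowerSeries.X 1 ^ (e b - 1) * MvPowerSeries.X 1 := by
          rw [← pow_succ]; congr 1; omega
        change q - MvPowerSeries.C k * (w * weakTransform 1 b (line c) ^ (n - s)) = _ at hq
        rw [sub_sub, add_comm (MvPowerSeries.C k * _), ← sub_sub, hpq, hwa, h7]
        linear_combination MvPowerSeries.X 1 ^ (e b - 1) * hq
      · obtain ⟨p₁, q₁, h₁⟩ := h b hb
        obtain ⟨w₁, -, hw₁⟩ := hG' b
        have h5 : e'' b = e b := by simp [e'', hb, e', hba]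
        have h6 : e' b = e b := by simp [e', hba]
        rw [h5] at hw₁
        rw [h6] at h₁
        refine ⟨p₁, q₁ - MvPowerSeries.C k * (w₁ * weakTransform 1 b (line c) ^ (n - s)), ?_⟩
        rw [sub_sub, add_comm (MvPowerSeries.C k * _), ← sub_sub, h₁, hw₁]
        ring

/-- Germs of order at least `n` have arbitrary weak transforms modulo ideals whose total
intersection number with the exceptional line is at most `n + 1`. -/
theorem exists_weakTransform_sub_mem (n : ℕ) (A : Finset (Option K)) (e : Option K → ℕ)
    (he : ∑ a ∈ A, e a ≤ n + 1) (J : Option K → Ideal (LocalRing K)) (N : ℕ)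
    (hN : ∀ a ∈ A, MvPowerSeries.X 0 ^ N ∈ J a)
    (hJ : ∀ a ∈ A, ∃ p, MvPowerSeries.X 1 ^ e a - MvPowerSeries.X 0 * p ∈ J a)
    (g : Option K → LocalRing K) :
    ∃ f : LocalRing K, (n : ℕ∞) ≤ f.order ∧ ∀ a ∈ A, weakTransform n a f - g a ∈ J a := by
  -- Interpolation along u = 0 leaves an error -X 0 * r modulo J a. The weak transform of weight n
  -- is X 0 times the one of weight n + 1, so it remains to hit r by germs of order n + 1 modulo the
  -- colon ideals by X 0. These contain a lower power of X 0, and the same contact orders suffice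
  -- for them.
  induction N generalizing n J g with
  | zero =>
    refine ⟨0, by simp, fun a ha => ?_⟩
    have h1 : J a = ⊤ := (Ideal.eq_top_iff_one _).mpr (by simpa using hN a ha)
    rw [h1]
    trivial
  | succ N ih =>
    obtain ⟨F, hF, h⟩ := exists_interpolation n A e he g
    have key : ∀ a, ∃ r, a ∈ A → weakTransform n a F - g a + MvPowerSeries.X 0 * r ∈ J a := by
      intro a
      by_cases ha : a ∈ A
      · obtain ⟨p, q, hpq⟩ := h a ha
        obtain ⟨p', hp'⟩ := hJ a ha
        refine ⟨-(p + p' * q), fun _ => ?_⟩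
        rw [hpq]
        convert (J a).mul_mem_right q hp' using 1
        ring
      · exact ⟨0, fun h => absurd h ha⟩
    choose r hr using key
    obtain ⟨f, hf, hfr⟩ := ih (n + 1) (he.trans (by omega))
      (fun a => (J a).colon {MvPowerSeries.X 0})
      (fun a ha => by
        rw [Submodule.mem_colon_singleton, smul_eq_mul, ← pow_succ]
        exact hN a ha)
      (fun a ha => by
        obtain ⟨p, hp⟩ := hJ a ha
        exact ⟨p, Submodule.mem_colon_singleton.mpr ((J a).mul_mem_right _ hp)⟩) r
    have hf' : (n : ℕ∞) ≤ f.order := le_trans (by exact_mod_cast n.le_succ) hf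
    refine ⟨F + f, le_order_add hF hf', fun a ha => ?_⟩
    have h1 := hr a ha
    have h2 := Submodule.mem_colon_singleton.mp (hfr a ha)
    rw [weakTransform_add, weakTransform_succ n a hf]
    convert add_mem h1 h2 using 1
    rw [smul_eq_mul]
    ring

end Interpolation

/-! ### Ideals defined by virtual multiplicities -/

section Cluster

variable {K : Type*} [Field K]

/-- The restriction of a multiplicity function to the points infinitely near to `[a]`. -/
def subMult (a : Option K) (m : InfNear K → ℕ) : InfNear K → ℕ := fun q => m (a :: q)

/-- Germs that have the virtual multiplicities `m` in the first `k` neighbourhoods. -/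
def truncMultIdeal : ℕ → (InfNear K → ℕ) → Ideal (LocalRing K)
  | 0, _ => ⊤
  | k + 1, m =>
    { carrier := {f | (m [] : ℕ∞) ≤ f.order ∧
        ∀ a, weakTransform (m []) a f ∈ truncMultIdeal k (subMult a m)}
      zero_mem' := ⟨by simp, fun a => by simp⟩
      add_mem' := fun hf hg => ⟨le_order_add hf.1 hg.1, fun a => by
        rw [weakTransform_add]; exact add_mem (hf.2 a) (hg.2 a)⟩
      smul_mem' := fun c f hf => by
        rw [smul_eq_mul, mul_comm]
        refine ⟨le_order_mul_left _ hf.1, fun a => ?_⟩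
        rw [weakTransform_mul_blowup a c hf.1]
        exact Ideal.mul_mem_right _ _ (hf.2 a) }

/-- The ideal of all germs with virtual multiplicities `m`. -/
def multIdeal (m : InfNear K → ℕ) : Ideal (LocalRing K) := ⨅ k, truncMultIdeal k m

theorem mem_truncMultIdeal_succ {k : ℕ} {m : InfNear K → ℕ} {f : LocalRing K} :
    f ∈ truncMultIdeal (k + 1) m ↔ (m [] : ℕ∞) ≤ f.order ∧
      ∀ a, weakTransform (m []) a f ∈ truncMultIdeal k (subMult a m) := Iff.rfl

/-- Truncation only makes the recursion structural; over all levels it disappears. -/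
theorem mem_multIdeal {m : InfNear K → ℕ} {f : LocalRing K} :
    f ∈ multIdeal m ↔ (m [] : ℕ∞) ≤ f.order ∧
      ∀ a, weakTransform (m []) a f ∈ multIdeal (subMult a m) := by
  simp only [multIdeal, Ideal.mem_iInf]
  constructor
  · intro h
    exact ⟨(h 1).1, fun a k => (h (k + 1)).2 a⟩
  · rintro ⟨h1, h2⟩ k
    cases k with
    | zero => trivial
    | succ k => exact ⟨h1, fun a => h2 a k⟩

theorem truncMultIdeal_zero_right (k : ℕ) : truncMultIdeal k (0 : InfNear K → ℕ) = ⊤ := by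
  rw [Ideal.eq_top_iff_one]
  induction k with
  | zero => trivial
  | succ k ih =>
    refine ⟨by simp, fun a => ?_⟩
    rw [Pi.zero_apply, weakTransform_zero_left, map_one]
    exact ih

@[simp] theorem multIdeal_zero : multIdeal (0 : InfNear K → ℕ) = ⊤ := by
  simp [multIdeal, truncMultIdeal_zero_right]

/-! ### Smooth paths -/

/-- The points infinitely near to the origin on the smooth arc `arc a h`. -/
def pathPoint : Option K → PowerSeries K → ℕ → InfNear K
  | _, _, 0 => []
  | a, h, n + 1 => a :: pathPoint (some (PowerSeries.constantCoeff h)) (shift h) n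

theorem length_pathPoint (a : Option K) (h : PowerSeries K) (n : ℕ) :
    (pathPoint a h n).length = n := by
  induction n generalizing a h with
  | zero => rfl
  | succ n ih => simp [pathPoint, ih]

theorem pathPoint_injective (a : Option K) (h : PowerSeries K) :
    Function.Injective (pathPoint a h) := fun m n hmn => by
  rw [← length_pathPoint a h m, hmn, length_pathPoint]

/-- The sum of the multiplicities along a smooth arc. -/
def pathSum (a : Option K) (h : PowerSeries K) (m : InfNear K → ℕ) : ℕ :=
  ∑ᶠ n, m (pathPoint a h n)

theorem finsum_nat_succ {f : ℕ → ℕ} (hf : f.support.Finite) :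
    ∑ᶠ n, f n = f 0 + ∑ᶠ n, f (n + 1) := by
  obtain ⟨N, hN⟩ := hf.bddAbove
  rw [finsum_eq_sum_of_support_subset (s := Finset.range (N + 1 + 1)) f,
    finsum_eq_sum_of_support_subset (s := Finset.range (N + 1)) (fun n => f (n + 1)),
    Finset.sum_range_succ', add_comm]
  · intro n hn
    have := hN (show n + 1 ∈ f.support from hn)
    simp
    omega
  · intro n hn
    have := hN hn
    simp
    omega

theorem finite_support_comp_pathPoint {m : InfNear K → ℕ} (hm : m.support.Finite) (a : Option K)
    (h : PowerSeries K) : (fun n => m (pathPoint a h n)).support.Finite :=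
  Set.Finite.preimage (pathPoint_injective a h).injOn hm

theorem pathSum_eq {m : InfNear K → ℕ} (hm : m.support.Finite) (a : Option K)
    (h : PowerSeries K) : pathSum a h m =
      m [] + pathSum (some (PowerSeries.constantCoeff h)) (shift h) (subMult a m) :=
  finsum_nat_succ (finite_support_comp_pathPoint hm a h)

@[simp] theorem pathSum_zero (a : Option K) (h : PowerSeries K) : pathSum a h 0 = 0 := by
  simp [pathSum]

theorem support_sub_finite {K : Type*} {m : InfNear K → ℕ} (hm : m.support.Finite) (a : Option K) :
    (subMult a m).support.Finite :=
  Set.Finite.preimage (fun _ _ _ _ hpq => (List.cons.inj hpq).2) hm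

theorem exists_range_pathSum {m : InfNear K → ℕ} (hm : m.support.Finite) (a : Option K)
    (h : PowerSeries K) : ∃ N, ∀ n ≥ N, m (pathPoint a h n) = 0 := by
  obtain ⟨N, hN⟩ := (finite_support_comp_pathPoint hm a h).bddAbove
  refine ⟨N + 1, fun n hn => ?_⟩
  by_contra hne
  have := hN hne
  omega

theorem pathSum_eq_sum_range {m : InfNear K → ℕ} (a : Option K) (h : PowerSeries K) {N : ℕ}
    (hN : ∀ n ≥ N, m (pathPoint a h n) = 0) :
    pathSum a h m = ∑ n ∈ Finset.range N, m (pathPoint a h n) := by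
  apply finsum_eq_sum_of_support_subset
  intro n hn
  simp only [Finset.coe_range, Set.mem_Iio]
  by_contra hle
  exact hn (hN n (not_lt.mp hle))

theorem pathSum_mono {m m' : InfNear K → ℕ} (hm : m.support.Finite) (hle : m' ≤ m)
    (a : Option K) (h : PowerSeries K) : pathSum a h m' ≤ pathSum a h m := by
  obtain ⟨N, hN⟩ := exists_range_pathSum hm a h
  rw [pathSum_eq_sum_range a h hN, pathSum_eq_sum_range a h (m := m') (N := N) fun n hn =>
    Nat.le_zero.mp ((hle _).trans (hN n hn).le)]
  exact Finset.sum_le_sum fun n _ => hle _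

/-- Termwise comparison of finite sums. In unloading it shows that no multiplicity was lost along
the exceptional line. -/
theorem eq_of_pathSum_eq {m m' : InfNear K → ℕ} (hm : m.support.Finite) (hle : m' ≤ m)
    (a : Option K) (h : PowerSeries K) (heq : pathSum a h m' = pathSum a h m) (n : ℕ) :
    m' (pathPoint a h n) = m (pathPoint a h n) := by
  obtain ⟨N, hN⟩ := exists_range_pathSum hm a h
  have hN' : ∀ n ≥ N, m' (pathPoint a h n) = 0 := fun n hn =>
    Nat.le_zero.mp ((hle _).trans (hN n hn).le)
  rw [pathSum_eq_sum_range a h hN, pathSum_eq_sum_range a h hN'] at heq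
  by_cases hn : n < N
  · exact (Finset.sum_eq_sum_iff_of_le fun k _ => hle (pathPoint a h k)).mp heq n (Finset.mem_range.mpr hn)
  · rw [hN n (not_lt.mp hn), hN' n (not_lt.mp hn)]

/-! ### Consistent multiplicities -/

/-- Multiplicity functions of finite support that satisfy the proximity inequalities: the
multiplicity at a point is at least the sum of the multiplicities at the points proximate to it. -/
inductive IsConsistent : (InfNear K → ℕ) → Prop
  | zero : IsConsistent 0
  | node {m : InfNear K → ℕ} (A : Finset (Option K)) (hA : ∀ a ∉ A, subMult a m = 0)
    (h : ∀ a, IsConsistent (subMult a m)) (hsum : ∑ a ∈ A, pathSum none 0 (subMult a m) ≤ m []) :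
    IsConsistent m

/-- The zero function is a node without branches, so case distinctions can be avoided. -/
theorem IsConsistent.exists_finset {m : InfNear K → ℕ} (hm : IsConsistent m) :
    ∃ A : Finset (Option K), (∀ a ∉ A, subMult a m = 0) ∧ (∀ a, IsConsistent (subMult a m)) ∧
      ∑ a ∈ A, pathSum none 0 (subMult a m) ≤ m [] := by
  cases hm with
  | zero => exact ⟨∅, fun _ _ => rfl, fun _ => .zero, by simp⟩
  | node A hA h hsum => exact ⟨A, hA, h, hsum⟩

theorem IsConsistent.sub {m : InfNear K → ℕ} (hm : IsConsistent m) (a : Option K) :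
    IsConsistent (subMult a m) := by
  obtain ⟨A, hA, h, hsum⟩ := hm.exists_finset
  exact h a

theorem finite_support_of_sub {K : Type*} {m : InfNear K → ℕ} (A : Finset (Option K))
    (hA : ∀ a ∉ A, subMult a m = 0)
    (h : ∀ a, (subMult a m).support.Finite) : m.support.Finite := by
  refine ((Set.finite_singleton []).union
    (A.finite_toSet.biUnion fun a _ => (h a).image (List.cons a))).subset ?_
  intro q hq
  cases q with
  | nil => left; rfl
  | cons a q =>
    right
    rw [Set.mem_iUnion₂]
    refine ⟨a, ?_, q, hq, rfl⟩
    by_contra ha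
    exact hq (congrFun (hA a ha) q)

theorem IsConsistent.finite_support {m : InfNear K → ℕ} (hm : IsConsistent m) :
    m.support.Finite := by
  induction hm with
  | zero => simp
  | node A hA _ _ ih => exact finite_support_of_sub A hA ih

/-- Every [a] is proximate to the origin, so a zero there forces zeros at all [a], and so on
upwards. -/
theorem IsConsistent.eq_zero {m : InfNear K → ℕ} (hm : IsConsistent m) (h0 : m [] = 0) :
    m = 0 := by
  induction hm with
  | zero => rfl
  | @node m A hA h hsum ih =>
    funext q
    cases q with
    | nil => exact h0
    | cons a q =>
      refine congrFun (?_ : subMult a m = 0) q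
      by_cases ha : a ∈ A
      · apply ih
        rw [h0, Nat.le_zero, Finset.sum_eq_zero_iff] at hsum
        have := hsum a ha
        rw [pathSum_eq (h a).finite_support] at this
        omega
      · exact hA a ha

theorem IsConsistent.append_eq_zero {m : InfNear K → ℕ} (hm : IsConsistent m) {p : InfNear K}
    (hp : m p = 0) (q : InfNear K) : m (p ++ q) = 0 := by
  induction p generalizing m with
  | nil => rw [hm.eq_zero hp]; rfl
  | cons a p ih => exact ih (hm.sub a) hp

/-! ### Finite colength and Noether's formula along smooth arcs -/

theorem exists_orderIdeal_le_of_sub {m : InfNear K → ℕ} (A : Finset (Option K))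
    (hA : ∀ a ∉ A, subMult a m = 0)
    (h : ∀ a, ∃ N : ℕ, orderIdeal (N : ℕ∞) ≤ multIdeal (subMult a m)) :
    ∃ N : ℕ, orderIdeal (N : ℕ∞) ≤ multIdeal m := by
  choose N hN using h
  -- The weak transform loses m [] in order at most; what is left dominates each N a with a ∈ A.
  refine ⟨∑ a ∈ A, N a + m [], fun f hf => ?_⟩
  rw [mem_orderIdeal] at hf
  refine mem_multIdeal.mpr ⟨le_trans (by exact_mod_cast Nat.le_add_left _ _) hf, fun a => ?_⟩
  by_cases ha : a ∈ A
  · refine hN a ((?_ : (N a : ℕ∞) ≤ _).trans (le_order_weakTransform a hf))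
    exact_mod_cast Finset.single_le_sum (f := N) (fun _ _ => Nat.zero_le _) ha
  · rw [hA a ha, multIdeal_zero]
    trivial

theorem IsConsistent.exists_orderIdeal_le {m : InfNear K → ℕ} (hm : IsConsistent m) :
    ∃ N : ℕ, orderIdeal (N : ℕ∞) ≤ multIdeal m := by
  induction hm with
  | zero => exact ⟨0, by simp⟩
  | node A hA _ _ ih => exact exists_orderIdeal_le_of_sub A hA ih

theorem le_order_iff_X_pow_dvd {f : PowerSeries K} {n : ℕ} :
    (n : ℕ∞) ≤ f.order ↔ PowerSeries.X ^ n ∣ f := by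
  rw [PowerSeries.X_pow_dvd_iff]
  exact ⟨fun h m hm => PowerSeries.coeff_of_lt_order _ (lt_of_lt_of_le (by exact_mod_cast hm) h),
    PowerSeries.nat_le_order f n⟩

/-- The lower bound in Noether's formula. -/
theorem IsConsistent.pathSum_le_order {m : InfNear K → ℕ} (hm : IsConsistent m) (a : Option K)
    (h : PowerSeries K) {f : LocalRing K} (hf : f ∈ multIdeal m) :
    (pathSum a h m : ℕ∞) ≤ (arc a h f).order := by
  induction hm generalizing a h f with
  | zero => simp
  | @node m A hA hsub hsum ih =>
    rw [pathSum_eq (IsConsistent.node A hA hsub hsum).finite_support]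
    rw [mem_multIdeal] at hf
    rw [arc_eq a h hf.1, PowerSeries.order_mul, PowerSeries.order_X_pow]
    push_cast
    gcongr
    exact ih a _ _ (hf.2 a)

/-- Modulo X 0 the germ f is a unit times X 1 ^ e. This converts contact with u = 0 into the
hypothesis needed for interpolation. -/
theorem exists_X_one_pow_sub_mem {J : Ideal (LocalRing K)} {f : LocalRing K} (hf : f ∈ J) {e : ℕ}
    (he : (axis f).order = e) : ∃ p, MvPowerSeries.X 1 ^ e - MvPowerSeries.X 0 * p ∈ J := by
  obtain ⟨p, q, h, hq⟩ := exists_eq_add_of_axis_order he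
  refine ⟨-p * q⁻¹, ?_⟩
  convert J.mul_mem_right q⁻¹ hf using 1
  have := MvPowerSeries.mul_inv_cancel q hq
  rw [h]
  linear_combination (-MvPowerSeries.X 1 ^ e) * this

/-- Every element of the ideal at `[b]` is, up to non-generators, a weak transform. -/
theorem exists_weakTransform_sub_mem_mul {m : InfNear K → ℕ} (A : Finset (Option K))
    (hA : ∀ a ∉ A, subMult a m = 0)
    (hN : ∀ a, ∃ N : ℕ, orderIdeal (N : ℕ∞) ≤ multIdeal (subMult a m))
    (haxis : ∀ a, ∃ f ∈ multIdeal (subMult a m),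
      (axis f).order = pathSum none 0 (subMult a m))
    (hsum : ∑ a ∈ A, pathSum none 0 (subMult a m) ≤ m [])
    (b : Option K) {g : LocalRing K} (hg : g ∈ multIdeal (subMult b m)) :
    ∃ f ∈ multIdeal m, weakTransform (m []) b f - g ∈
      orderIdeal 1 * multIdeal (subMult b m) := by
  classical
  choose N hN using hN
  have hX : ∀ i, (MvPowerSeries.X i : LocalRing K) ∈ orderIdeal (K := K) 1 := fun i =>
    (order_X i).ge
  obtain ⟨f, hf, h⟩ := exists_weakTransform_sub_mem (m []) (insert b A)
    -- At b the target is the maximal ideal times the given one, for which one more order of contact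
    -- is prescribed. With the proximity inequality the total is at most m [] + 1, exactly what
    -- interpolation allows.
    (fun a => pathSum none 0 (subMult a m) + if a = b then 1 else 0)
    (by
      rw [Finset.sum_add_distrib, Finset.sum_ite_eq' (insert b A) b, if_pos (by simp)]
      by_cases hb : b ∈ A
      · rw [Finset.insert_eq_of_mem hb]; omega
      · rw [Finset.sum_insert hb, hA b hb, pathSum_zero]; omega)
    (fun a => if a = b then orderIdeal 1 * multIdeal (subMult a m)
      else multIdeal (subMult a m))
    (∑ a ∈ insert b A, N a + 1)
    (fun a ha => by
      have h1 : (MvPowerSeries.X 0 : LocalRing K) ^ (∑ a ∈ insert b A, N a) ∈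
          multIdeal (subMult a m) := by
        apply hN a
        rw [mem_orderIdeal, order_X_pow]
        exact_mod_cast Finset.single_le_sum (f := N) (fun _ _ => Nat.zero_le _) ha
      rw [pow_succ']
      split_ifs
      · exact Ideal.mul_mem_mul (hX 0) h1
      · exact Ideal.mul_mem_left _ _ h1)
    (fun a ha => by
      obtain ⟨f, hf, hfe⟩ := haxis a
      obtain ⟨p, hp⟩ := exists_X_one_pow_sub_mem hf hfe
      split_ifs
      · refine ⟨MvPowerSeries.X 1 * p, ?_⟩
        convert Ideal.mul_mem_mul (hX 1) hp using 1
        ring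
      · exact ⟨p, by simpa using hp⟩)
    (fun a => if a = b then g else 0)
  have hb := h b (by simp)
  rw [if_pos rfl, if_pos rfl] at hb
  refine ⟨f, mem_multIdeal.mpr ⟨hf, fun a => ?_⟩, hb⟩
  by_cases hab : a = b
  · subst hab
    rw [← sub_add_cancel (weakTransform (m []) a f) g]
    have hle : orderIdeal 1 * multIdeal (subMult a m) ≤ multIdeal (subMult a m) := Ideal.mul_le_right
    exact add_mem (hle hb) hg
  · by_cases ha : a ∈ A
    · have := h a (by simp [ha])
      rw [if_neg hab, if_neg hab, sub_zero] at this
      exact this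
    · rw [hA a ha, multIdeal_zero]
      trivial

/-- Elements of the maximal ideal restrict to multiples of the parameter of the arc. Hence errors of
this kind cannot disturb a leading term of order e. -/
theorem succ_le_order_arc {J : Ideal (LocalRing K)} {e : ℕ} (a : Option K) (h : PowerSeries K)
    (hJ : ∀ f ∈ J, (e : ℕ∞) ≤ (arc a h f).order) {g : LocalRing K} (hg : g ∈ orderIdeal 1 * J) :
    ((e + 1 : ℕ) : ℕ∞) ≤ (arc a h g).order := by
  rw [le_order_iff_X_pow_dvd, ← Ideal.mem_span_singleton]
  refine (Ideal.mul_le.mpr fun r hr s hs => ?_ :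
    _ ≤ (Ideal.span {PowerSeries.X ^ (e + 1)}).comap (arc a h)) hg
  rw [Ideal.mem_comap, map_mul, pow_succ', Ideal.mem_span_singleton]
  refine mul_dvd_mul ?_ (le_order_iff_X_pow_dvd.mp (hJ s hs))
  simpa using X_pow_dvd_arc a h (n := 1) (f := r) (by rw [Nat.cast_one]; exact hr)

/-- Noether's formula is attained. -/
theorem IsConsistent.exists_order_arc_eq {m : InfNear K → ℕ} (hm : IsConsistent m)
    (a : Option K) (h : PowerSeries K) :
    ∃ f ∈ multIdeal m, (arc a h f).order = pathSum a h m := by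
  induction hm generalizing a h with
  | zero => exact ⟨1, by simp, by simp⟩
  | @node m A hA hsub hsum ih =>
    obtain ⟨g, hg, hge⟩ := ih a (some (PowerSeries.constantCoeff h)) (shift h)
    obtain ⟨f, hf, hfg⟩ := exists_weakTransform_sub_mem_mul A hA
      (fun a => (hsub a).exists_orderIdeal_le) (fun a => ih a none 0) hsum a hg
    refine ⟨f, hf, ?_⟩
    rw [pathSum_eq (IsConsistent.node A hA hsub hsum).finite_support,
      arc_eq a h (mem_multIdeal.mp hf).1, PowerSeries.order_mul, PowerSeries.order_X_pow]
    -- The lift differs from g by something of larger order on the arc, so the order attained by g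
    -- survives.
    have h1 := succ_le_order_arc (some (PowerSeries.constantCoeff h)) (shift h)
      (fun f hf => (hsub a).pathSum_le_order _ _ hf) hfg
    rw [map_sub] at h1
    have h2 : arc (some (PowerSeries.constantCoeff h)) (shift h) (weakTransform (m []) a f) =
      arc (some (PowerSeries.constantCoeff h)) (shift h) g +
      (arc (some (PowerSeries.constantCoeff h)) (shift h) (weakTransform (m []) a f) -
        arc (some (PowerSeries.constantCoeff h)) (shift h) g) := by ring
    have h3 : (arc (some (PowerSeries.constantCoeff h)) (shift h) g).order <
      (arc (some (PowerSeries.constantCoeff h)) (shift h) (weakTransform (m []) a f) -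
        arc (some (PowerSeries.constantCoeff h)) (shift h) g).order := by
      refine lt_of_lt_of_le ?_ h1
      rw [hge]
      exact_mod_cast Nat.lt_succ_self _
    rw [h2, PowerSeries.order_add_of_order_ne _ _ h3.ne, inf_eq_left.mpr h3.le, hge]
    push_cast
    rfl

theorem IsConsistent.exists_weakTransform_sub_mem {m : InfNear K → ℕ} (hm : IsConsistent m)
    (b : Option K) {g : LocalRing K} (hg : g ∈ multIdeal (subMult b m)) :
    ∃ f ∈ multIdeal m, weakTransform (m []) b f - g ∈
      orderIdeal 1 * multIdeal (subMult b m) := by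
  obtain ⟨A, hA, h, hsum⟩ := hm.exists_finset
  exact exists_weakTransform_sub_mem_mul A hA (fun a => (h a).exists_orderIdeal_le)
    (fun a => (h a).exists_order_arc_eq none 0) hsum b hg

/-! ### Recovering the multiplicities from their ideal -/

theorem order_le_order_arc (a : Option K) (h : PowerSeries K) (f : LocalRing K) :
    f.order ≤ (arc a h f).order := by
  by_cases hf : f = 0
  · simp [hf]
  · obtain ⟨n, hn⟩ := exists_order_eq hf
    rw [hn, le_order_iff_X_pow_dvd]
    exact X_pow_dvd_arc a h hn.ge

/-- Over an infinite field some direction avoids the finitely many branches. On an arc in that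
direction the Noether sum has the single term m [], and a germ attaining it can have no larger
order. -/
theorem IsConsistent.exists_order_eq [Infinite K] {m : InfNear K → ℕ} (hm : IsConsistent m) :
    ∃ f ∈ multIdeal m, f.order = m [] := by
  obtain ⟨A, hA, h, hsum⟩ := hm.exists_finset
  obtain ⟨a, ha⟩ := Infinite.exists_notMem_finset A
  obtain ⟨f, hf, hfe⟩ := hm.exists_order_arc_eq a 0
  refine ⟨f, hf, le_antisymm ?_ (mem_multIdeal.mp hf).1⟩
  rw [pathSum_eq hm.finite_support, hA a ha, pathSum_zero, add_zero] at hfe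
  exact (order_le_order_arc a 0 f).trans hfe.le

/-- Nakayama's argument: iteration pushes the error into germs of order N, which lie in I. -/
theorem le_of_le_sup_orderIdeal_mul {I J : Ideal (LocalRing K)} {N : ℕ}
    (hN : orderIdeal (N : ℕ∞) ≤ I) (h : J ≤ I ⊔ orderIdeal 1 * J) : J ≤ I := by
  have key : ∀ k : ℕ, J ≤ I ⊔ orderIdeal (k : ℕ∞) * J := by
    intro k
    induction k with
    | zero =>
      have : (orderIdeal ((0 : ℕ) : ℕ∞) : Ideal (LocalRing K)) = ⊤ :=
        (Ideal.eq_top_iff_one _).mpr (by simp [mem_orderIdeal])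
      rw [this, Ideal.top_mul]
      exact le_sup_right
    | succ k ih =>
      refine ih.trans (sup_le le_sup_left ?_)
      refine (Ideal.mul_mono_right h).trans ?_
      rw [Ideal.mul_sup, ← mul_assoc]
      have hI : orderIdeal (k : ℕ∞) * I ≤ I := Ideal.mul_le_right
      refine sup_le (hI.trans le_sup_left) (le_sup_of_le_right (Ideal.mul_mono_left ?_))
      refine Ideal.mul_le.mpr fun r hr s hs => ?_
      rw [mem_orderIdeal, MvPowerSeries.order_mul]
      push_cast
      exact add_le_add hr hs
  have hJ : orderIdeal (N : ℕ∞) * J ≤ orderIdeal (N : ℕ∞) := Ideal.mul_le_left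
  exact (key N).trans (sup_le le_rfl (hJ.trans hN))

/-- Weak transforms of elements of `multIdeal m` fill the ideal at [b] up to multiples by the
maximal ideal. As the root values agree, they also satisfy the conditions of m', and Nakayama
removes the error. -/
theorem IsConsistent.multIdeal_sub_le {m m' : InfNear K → ℕ} (hm : IsConsistent m)
    (hm' : IsConsistent m') (h0 : m [] = m' []) (h : multIdeal m ≤ multIdeal m') (b : Option K) :
    multIdeal (subMult b m) ≤ multIdeal (subMult b m') := by
  obtain ⟨N, hN⟩ := (hm'.sub b).exists_orderIdeal_le
  refine le_of_le_sup_orderIdeal_mul hN fun g hg => ?_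
  obtain ⟨f, hf, hfg⟩ := hm.exists_weakTransform_sub_mem b hg
  have h1 := (mem_multIdeal.mp (h hf)).2 b
  rw [← h0] at h1
  rw [← sub_sub_cancel (weakTransform (m []) b f) g]
  exact sub_mem (Ideal.mem_sup_left h1) (Ideal.mem_sup_right hfg)

/-- Consistent multiplicities are determined by their ideal. -/
theorem IsConsistent.eq_of_multIdeal_eq [Infinite K] {m m' : InfNear K → ℕ} (hm : IsConsistent m)
    (hm' : IsConsistent m') (h : multIdeal m = multIdeal m') : m = m' := by
  -- An element of order exactly m [] lies in both ideals, which bounds the other root value.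
  have root : ∀ {m m' : InfNear K → ℕ}, IsConsistent m → multIdeal m = multIdeal m' →
      m' [] ≤ m [] := fun {m m'} hm h => by
    obtain ⟨f, hf, hfe⟩ := hm.exists_order_eq
    rw [h] at hf
    exact_mod_cast (mem_multIdeal.mp hf).1.trans hfe.le
  induction hm generalizing m' with
  | zero =>
    have := root .zero h
    exact (hm'.eq_zero (Nat.le_zero.mp this)).symm
  | @node m A hA hsub hsum ih =>
    have hm := IsConsistent.node A hA hsub hsum
    have h0 := le_antisymm (root hm' h.symm) (root hm h)
    funext q
    cases q with
    | nil => exact h0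
    | cons a q =>
      exact congrFun (ih a (hm'.sub a) (le_antisymm (hm.multIdeal_sub_le hm' h0 h.le a)
        (hm'.multIdeal_sub_le hm h0.symm h.ge a))) q

end Cluster

/-! ### Smooth germs and their infinitely near points -/

section Smooth

variable {K : Type*} [Field K]

/-- The initial form is linear and cannot have a double zero. -/
theorem axis_weakTransform_order_le_one {L : LocalRing K} (hL : L.order = 1) (a : Option K) :
    (axis (weakTransform 1 a L)).order ≤ 1 := by
  by_contra h
  rw [not_le] at h
  have := sum_le_of_le_axis_order (n := 1) (by simpa using hL) {a} (fun _ => 2) (by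
    intro b hb
    rw [Finset.mem_singleton.mp hb]
    exact_mod_cast Order.add_one_le_of_lt h)
  simp at this

theorem order_weakTransform_le_one {L : LocalRing K} (hL : L.order = 1) (a : Option K) :
    (weakTransform 1 a L).order ≤ 1 :=
  (order_le_order_arc none 0 _).trans (axis_weakTransform_order_le_one hL a)

theorem strictTransform₁_of_order_one {L : LocalRing K} (hL : L.order = 1) (a : Option K) :
    strictTransform₁ a L = weakTransform 1 a L := strictTransform₁_eq (by simpa using hL) a

theorem strictTransform₁_of_isUnit {f : LocalRing K} (hf : IsUnit f) (a : Option K) :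
    strictTransform₁ a f = blowup a f := by
  rw [strictTransform₁_eq (n := 0) (by simpa using isUnit_iff_order_eq_zero.mp hf),
    weakTransform_zero_left]

theorem not_passesThrough_of_isUnit {f : LocalRing K} (hf : IsUnit f) (q : InfNear K) :
    ¬ PassesThrough f q := by
  induction q generalizing f with
  | nil =>
    change ¬ 1 ≤ f.order
    rw [isUnit_iff_order_eq_zero.mp hf]
    simp
  | cons a q ih =>
    change ¬ PassesThrough (strictTransform₁ a f) q
    rw [strictTransform₁_of_isUnit hf]
    exact ih (hf.map _)

theorem passesThrough_cons {f : LocalRing K} {a : Option K} {q : InfNear K} :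
    PassesThrough f (a :: q) ↔ PassesThrough (strictTransform₁ a f) q := Iff.rfl

theorem isUnit_of_not_one_le_order {f : LocalRing K} (h : ¬ 1 ≤ f.order) : IsUnit f := by
  rw [isUnit_iff_order_eq_zero]
  exact Order.lt_one_iff.mp (not_le.mp h)

theorem order_eq_one_or_isUnit {L : LocalRing K} (hL : L.order ≤ 1) : L.order = 1 ∨ IsUnit L := by
  by_cases h : 1 ≤ L.order
  · exact Or.inl (le_antisymm hL h)
  · exact Or.inr (isUnit_of_not_one_le_order h)

theorem one_le_order_of_arc_eq_zero {f : LocalRing K} {a : Option K} {h : PowerSeries K}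
    (hf : arc a h f = 0) : 1 ≤ f.order := by
  rw [one_le_order_iff, ← constantCoeff_algHom (arc a h), hf, map_zero]

theorem arc_weakTransform_eq_zero {f : LocalRing K} {a : Option K} {h : PowerSeries K} {n : ℕ}
    (hn : (n : ℕ∞) ≤ f.order) (hf : arc a h f = 0) :
    arc (some (PowerSeries.constantCoeff h)) (shift h) (weakTransform n a f) = 0 := by
  rw [arc_eq a h hn] at hf
  exact (mul_eq_zero.mp hf).resolve_left (pow_ne_zero _ PowerSeries.X_ne_zero)

/-- The points of a smooth germ are those on the arc that parametrizes it. -/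
theorem passesThrough_iff_of_arc_eq_zero {L : LocalRing K} (hL : L.order = 1) {a : Option K}
    {h : PowerSeries K} (hz : arc a h L = 0) (q : InfNear K) :
    PassesThrough L q ↔ ∃ n, q = pathPoint a h n := by
  classical
  induction q generalizing a h L with
  | nil => exact ⟨fun _ => ⟨0, rfl⟩, fun _ => hL.ge⟩
  | cons b q ih =>
    have hL1 : ((1 : ℕ) : ℕ∞) ≤ L.order := by simpa using hL.ge
    have hz' := arc_weakTransform_eq_zero hL1 hz
    have h1 := one_le_order_of_arc_eq_zero hz'
    rw [passesThrough_cons, strictTransform₁_of_order_one hL]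
    by_cases hba : b = a
    · subst hba
      rw [ih (le_antisymm (order_weakTransform_le_one hL b) h1) hz']
      constructor
      · rintro ⟨n, rfl⟩
        exact ⟨n + 1, rfl⟩
      · rintro ⟨n, hn⟩
        cases n with
        | zero => cases hn
        | succ n => exact ⟨n, (List.cons.inj hn).2⟩
    · constructor
      · intro hp
        exfalso
        refine not_passesThrough_of_isUnit (isUnit_of_not_one_le_order fun h2 => ?_) q hp
        -- A linear initial form cannot vanish in two directions, so away from the arc the strict
        -- transform is a unit.
        have := sum_le_of_le_axis_order (n := 1) (by simpa using hL) {a, b} (fun _ => 1) (by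
          intro c hc
          rw [Nat.cast_one]
          rcases Finset.mem_insert.mp hc with rfl | hc
          · exact h1.trans (order_le_order_arc _ _ _)
          · rw [Finset.mem_singleton.mp hc]
            exact h2.trans (order_le_order_arc _ _ _))
        rw [Finset.sum_pair (Ne.symm hba)] at this
        omega
      · rintro ⟨n, hn⟩
        cases n with
        | zero => cases hn
        | succ n => exact absurd (List.cons.inj hn).1 hba

theorem passesThrough_X_zero_iff (q : InfNear K) :
    PassesThrough (MvPowerSeries.X 0) q ↔ ∃ n, q = pathPoint none 0 n :=
  passesThrough_iff_of_arc_eq_zero (order_X 0) axis_X_zero q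

/-- For L = x p + y q the tangent direction is the zero of p(0) + q(0) t, and ∞ if q(0) = 0. -/
theorem exists_one_le_order_weakTransform {L : LocalRing K} (hL : L.order = 1) :
    ∃ a, 1 ≤ (weakTransform 1 a L).order := by
  obtain ⟨p, q, rfl⟩ := mem_span_X_of_constantCoeff (one_le_order_iff.mp hL.ge)
  by_cases hq : MvPowerSeries.constantCoeff q = 0
  · refine ⟨none, ?_⟩
    rw [weakTransform_eq (g := MvPowerSeries.X 1 * blowup none p + blowup none q) (by
      rw [map_add, map_mul, map_mul, blowup_X_zero_none, blowup_X_one_none]; ring),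
      one_le_order_iff]
    simp [constantCoeff_blowup, hq]
  · refine ⟨some (-(MvPowerSeries.constantCoeff p) / MvPowerSeries.constantCoeff q), ?_⟩
    rw [weakTransform_eq (by
      rw [map_add, map_mul, map_mul, blowup_X_zero_some, blowup_X_one_some, pow_one, mul_assoc,
        ← mul_add]), one_le_order_iff]
    simp only [map_add, map_mul, constantCoeff_blowup, MvPowerSeries.constantCoeff_X,
      MvPowerSeries.constantCoeff_C, zero_add]
    rw [div_mul_cancel₀ _ hq, add_neg_cancel]

theorem order_le_order_axis (f : LocalRing K) : f.order ≤ (axis f).order :=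
  order_le_order_arc none 0 f

/-- The axis u = 0 itself has direction ∞; a germ tangent to it would have contact at least two with
it. -/
theorem exists_slope {L : LocalRing K} (hL : (axis L).order = 1) (hL' : 1 ≤ L.order) :
    ∃ t, 1 ≤ (weakTransform 1 (some t) L).order := by
  have h1 : L.order = 1 := le_antisymm ((order_le_order_axis L).trans hL.le) hL'
  obtain ⟨a, ha⟩ := exists_one_le_order_weakTransform h1
  cases a with
  | some t => exact ⟨t, ha⟩
  | none =>
    exfalso
    have h2 : axis L = PowerSeries.X ^ 1 *
        arc (some (PowerSeries.constantCoeff 0)) (shift 0) (weakTransform 1 none L) :=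
      arc_eq none 0 (by simpa using hL')
    rw [h2, PowerSeries.order_mul, PowerSeries.order_X_pow] at hL
    have h3 := ha.trans (order_le_order_arc (some (PowerSeries.constantCoeff 0)) (shift 0) _)
    have h4 : (1 : ℕ∞) + 1 ≤ 1 := by
      conv_rhs => rw [← hL]
      rw [Nat.cast_one]
      gcongr
    exact absurd h4 (by decide)

/-- Germs that are smooth and transversal to the axis `u = 0`. -/
abbrev TransversalGerm (K : Type*) [Field K] := {L : LocalRing K // (axis L).order = 1 ∧ 1 ≤ L.order}

/-- The direction of a transversal germ. -/
def TransversalGerm.slope (L : TransversalGerm K) : K := (exists_slope L.2.1 L.2.2).choose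

theorem TransversalGerm.order_eq_one (L : TransversalGerm K) : L.1.order = 1 :=
  le_antisymm ((order_le_order_axis L.1).trans L.2.1.le) L.2.2

theorem axis_weakTransform_order_eq_one {L : LocalRing K} (hL : L.order = 1) {a : Option K}
    (ha : 1 ≤ (weakTransform 1 a L).order) : (axis (weakTransform 1 a L)).order = 1 :=
  le_antisymm (axis_weakTransform_order_le_one hL a) (ha.trans (order_le_order_axis _))

/-- The strict transform of a transversal germ. -/
def TransversalGerm.next (L : TransversalGerm K) : TransversalGerm K :=
  ⟨weakTransform 1 (some L.slope) L.1,
    axis_weakTransform_order_eq_one L.order_eq_one (exists_slope L.2.1 L.2.2).choose_spec,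
    (exists_slope L.2.1 L.2.2).choose_spec⟩

/-- The power series whose graph is a given transversal germ. -/
def TransversalGerm.graph (L : TransversalGerm K) : PowerSeries K :=
  PowerSeries.mk fun n => (TransversalGerm.next^[n] L).slope

theorem TransversalGerm.constantCoeff_graph (L : TransversalGerm K) :
    PowerSeries.constantCoeff L.graph = L.slope := by
  rw [← PowerSeries.coeff_zero_eq_constantCoeff_apply, graph, PowerSeries.coeff_mk]; rfl

theorem TransversalGerm.shift_graph (L : TransversalGerm K) : shift L.graph = L.next.graph := by
  ext n
  rw [shift, PowerSeries.coeff_mk, graph, PowerSeries.coeff_mk, graph, PowerSeries.coeff_mk,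
    Function.iterate_succ_apply]

/-- The coefficients of the series are the slopes of the successive strict transforms. Each blowing
up takes a factor X out of the restriction and reproduces the situation, so every power of X divides
the restriction. -/
theorem TransversalGerm.graphArc_graph (L : TransversalGerm K) : graphArc L.graph L.1 = 0 := by
  have key : ∀ (n : ℕ) (L : TransversalGerm K), PowerSeries.X ^ n ∣ graphArc L.graph L.1 := by
    intro n
    induction n with
    | zero => simp
    | succ n ih =>
      intro L
      rw [graphArc_eq_arc, arc_eq (n := 1) _ _ (by simpa using L.2.2), ← graphArc_eq_arc,
        L.shift_graph, L.constantCoeff_graph, pow_one, pow_succ']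
      exact mul_dvd_mul_left _ (ih L.next)
  ext n
  exact PowerSeries.X_pow_dvd_iff.mp (key (n + 1) L) n n.lt_succ_self

/-- Every smooth germ is parametrized by an arc. -/
theorem exists_arc_eq_zero {L : LocalRing K} (hL : L.order = 1) :
    ∃ a h, arc a h L = 0 := by
  obtain ⟨a, ha⟩ := exists_one_le_order_weakTransform hL
  let L' : TransversalGerm K := ⟨weakTransform 1 a L, axis_weakTransform_order_eq_one hL ha, ha⟩
  refine ⟨a, L'.graph, ?_⟩
  rw [arc_eq (n := 1) _ _ (by simpa using hL.ge), ← graphArc_eq_arc]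
  exact mul_eq_zero_of_right _ L'.graphArc_graph

end Smooth

/-! ### Colon ideals and unloading -/

section Colon

variable {K : Type*} [Field K]

open scoped Classical in
/-- Reduction of the multiplicities by one at the points of `S`. -/
def lower (m : InfNear K → ℕ) (S : Set (InfNear K)) : InfNear K → ℕ :=
  fun q => m q - if q ∈ S then 1 else 0

theorem lower_le {K : Type*} (m : InfNear K → ℕ) (S : Set (InfNear K)) : lower m S ≤ m :=
  fun _ => Nat.sub_le _ _

theorem subMult_lower {K : Type*} (a : Option K) (m : InfNear K → ℕ) (S : Set (InfNear K)) :
    subMult a (lower m S) = lower (subMult a m) {q | a :: q ∈ S} := rfl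

theorem zero_lower {K : Type*} (S : Set (InfNear K)) : lower (0 : InfNear K → ℕ) S = 0 :=
  funext fun _ => Nat.zero_sub _

theorem lower_empty {K : Type*} (m : InfNear K → ℕ) : lower m ∅ = m := by
  funext q
  simp [lower]

/-- A smooth factor adds one to the order, and the weak transform of f * L is that of f times the
strict transform of L. Truncated subtraction does no harm, since m vanishes above any point where it
is zero and imposes no condition there. -/
theorem mul_mem_truncMultIdeal_iff (k : ℕ) {m : InfNear K → ℕ}
    (hm : ∀ p q, m p = 0 → m (p ++ q) = 0) {L : LocalRing K} (hL : L.order ≤ 1)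
    (f : LocalRing K) : f * L ∈ truncMultIdeal k m ↔
      f ∈ truncMultIdeal k (lower m {q | PassesThrough L q}) := by
  induction k generalizing m L f with
  | zero => exact iff_of_true trivial trivial
  | succ k ih =>
    rcases order_eq_one_or_isUnit hL with h1 | hu
    · rcases Nat.eq_zero_or_eq_succ_pred (m []) with h0 | h0
      · have : m = 0 := funext fun q => hm [] q h0
        rw [this, zero_lower, truncMultIdeal_zero_right]
        exact iff_of_true trivial trivial
      · set n := (m []).pred
        have hn : lower m {q | PassesThrough L q} [] = n := by
          have : PassesThrough L [] := h1.ge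
          simp [lower, this, h0]
        rw [mem_truncMultIdeal_succ, mem_truncMultIdeal_succ, hn, h0, MvPowerSeries.order_mul, h1]
        have e1 : ((n.succ : ℕ) : ℕ∞) ≤ f.order + 1 ↔ (n : ℕ∞) ≤ f.order := by
          rw [Nat.succ_eq_add_one]
          push_cast
          exact ENat.add_le_add_iff_right (by simp)
        rw [e1]
        refine and_congr_right fun hf => forall_congr' fun a => ?_
        rw [Nat.succ_eq_add_one, weakTransform_mul a hf (by simpa using h1.ge),
          ih (m := subMult a m) (fun p q h => hm (a :: p) q h) (order_weakTransform_le_one h1 a),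
          subMult_lower]
        simp only [Set.mem_ofPred_eq, passesThrough_cons, strictTransform₁_of_order_one h1]
    · have : {q | PassesThrough L q} = ∅ :=
        Set.eq_empty_of_forall_notMem fun q => not_passesThrough_of_isUnit hu q
      rw [this, lower_empty]
      exact Ideal.mul_unit_mem_iff_mem _ hu

/-- The ideal quotient by a smooth germ lowers the virtual multiplicities along it by one. -/
theorem multIdeal_colon {m : InfNear K → ℕ} (hm : ∀ p q, m p = 0 → m (p ++ q) = 0)
    {L : LocalRing K} (hL : L.order ≤ 1) :
    (multIdeal m).colon {L} = multIdeal (lower m {q | PassesThrough L q}) := by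
  ext f
  rw [Submodule.mem_colon_singleton, smul_eq_mul]
  simp only [multIdeal, Ideal.mem_iInf]
  exact forall_congr' fun k => mul_mem_truncMultIdeal_iff k hm hL f

theorem multIdeal_congr {m m' : InfNear K → ℕ} (h0 : m [] = m' [])
    (h : ∀ a, multIdeal (subMult a m) = multIdeal (subMult a m')) :
    multIdeal m = multIdeal m' := by
  ext f
  rw [mem_multIdeal, mem_multIdeal, h0]
  simp only [h]

/-- The multiplicity function with prescribed values at the origin and in the first
neighbourhood. -/
def consMult (n : ℕ) (μ : Option K → InfNear K → ℕ) : InfNear K → ℕ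
  | [] => n
  | a :: q => μ a q

theorem subMult_consMult {K : Type*} (n : ℕ) (μ : Option K → InfNear K → ℕ) (a : Option K) :
    subMult a (consMult n μ) = μ a := rfl

/-- Unloading: if consistent multiplicities are lowered by one at some points, the same ideal is
defined by consistent multiplicities that differ from the given ones by at most one. -/
theorem IsConsistent.exists_unloading {m : InfNear K → ℕ} (hm : IsConsistent m)
    (S : Set (InfNear K)) : ∃ m', IsConsistent m' ∧ multIdeal m' = multIdeal (lower m S) ∧
      m' ≤ m ∧ ∀ q, m q ≤ m' q + 1 := by
  classical
  induction hm generalizing S with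
  | zero => exact ⟨0, .zero, by rw [zero_lower], le_rfl, fun q => Nat.zero_le _⟩
  | @node m A hA hsub hsum ih =>
    have hm := IsConsistent.node A hA hsub hsum
    have hfin := fun a => (hsub a).finite_support
    choose μ hμ hμI hμle hμge using fun a => ih a {q | a :: q ∈ S}
    have hμA : ∀ a ∉ A, μ a = 0 := fun a ha =>
      le_antisymm ((hμle a).trans (hA a ha).le) fun _ => Nat.zero_le _
    have hμsum : ∑ a ∈ A, pathSum none 0 (μ a) ≤ ∑ a ∈ A, pathSum none 0 (subMult a m) :=
      Finset.sum_le_sum fun a _ => pathSum_mono (hfin a) (hμle a) _ _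
    -- After unloading above each direction only the inequality at the root can fail.
    by_cases hle : ∑ a ∈ A, pathSum none 0 (μ a) ≤ lower m S []
    · refine ⟨consMult (lower m S []) μ, .node A hμA hμ hle, multIdeal_congr rfl hμI, ?_, ?_⟩
      · intro q
        cases q with
        | nil => exact lower_le m S []
        | cons a q => exact hμle a q
      · intro q
        cases q with
        | nil => simp only [consMult, lower]; split_ifs <;> omega
        | cons a q => exact hμge a q
    -- Failure means that the root was lowered, while the sum over the points proximate to it is
    -- still m []. Hence μ agrees with m at all these points.
    · have hroot : m [] = lower m S [] + 1 := by
        have : lower m S [] = m [] - if ([] : InfNear K) ∈ S then 1 else 0 := rfl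
        split_ifs at this <;> omega
      have hsumeq : ∑ a ∈ A, pathSum none 0 (μ a) = ∑ a ∈ A, pathSum none 0 (subMult a m) := by
        omega
      have heq : ∀ a n, μ a (pathPoint none 0 n) = subMult a m (pathPoint none 0 n) := by
        intro a n
        by_cases ha : a ∈ A
        · exact eq_of_pathSum_eq (hfin a) (hμle a) _ _ ((Finset.sum_eq_sum_iff_of_le fun a _ =>
            pathSum_mono (hfin a) (hμle a) none 0).mp hsumeq a ha) n
        · rw [hμA a ha, hA a ha]
      -- All germs of the ideal turn out to have order m [] instead of m [] - 1. Dividing by the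
      -- additional factor u replaces each ideal above by its colon by u. Since μ equals m along u =
      -- 0 and is at most one smaller elsewhere, the colon ideal again belongs to m lowered by at
      -- most one at each point, and the induction hypothesis applies a second time.
      choose ν hν hνI hνle hνge using fun a =>
        ih a {q | μ a q < subMult a m q ∨ PassesThrough (MvPowerSeries.X 0) q}
      have hνA : ∀ a ∉ A, ν a = 0 := fun a ha =>
        le_antisymm ((hνle a).trans (hA a ha).le) fun _ => Nat.zero_le _
      have hcolon : ∀ a, multIdeal (ν a) = (multIdeal (μ a)).colon {MvPowerSeries.X 0} := by
        intro a
        rw [hνI, multIdeal_colon (fun p q h => (hμ a).append_eq_zero h q) (order_X 0).le]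
        congr 1
        funext q
        have h1 := hμle a q
        have h2 := hμge a q
        change m (a :: q) ≤ _ at h2
        change _ ≤ m (a :: q) at h1
        simp only [lower, Set.mem_ofPred_eq]
        by_cases hq : PassesThrough (MvPowerSeries.X 0) q
        · obtain ⟨n, rfl⟩ := (passesThrough_X_zero_iff q).mp hq
          simp [hq, heq]
        · by_cases hlt : μ a q < subMult a m q
          · simp only [hlt, hq, or_false, if_true, if_false, tsub_zero]
            change m (a :: q) - 1 = _
            change _ < m (a :: q) at hlt
            omega
          · simp only [hlt, hq, or_false, if_false, tsub_zero]
            exact le_antisymm (not_lt.mp hlt) h1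
      refine ⟨consMult (m []) ν, .node A hνA hν ?_, ?_, ?_, ?_⟩
      · exact (Finset.sum_le_sum fun a _ => pathSum_mono (hfin a) (hνle a) none 0).trans hsum
      · ext f
        rw [mem_multIdeal, mem_multIdeal]
        simp only [subMult_consMult, subMult_lower, ← hμI]
        change (m [] : ℕ∞) ≤ _ ∧ (∀ a, weakTransform (m []) a f ∈ _) ↔ _
        rw [hroot]
        simp only [hcolon, Submodule.mem_colon_singleton, smul_eq_mul]
        constructor
        · rintro ⟨h1, h2⟩
          refine ⟨le_trans (by exact_mod_cast Nat.le_succ _) h1, fun a => ?_⟩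
          rw [weakTransform_succ _ a h1, mul_comm]
          exact h2 a
        · rintro ⟨h1, h2⟩
          -- The weak transforms have more contact with the exceptional line than an initial form of
          -- the lowered degree can have.
          have h3 := succ_le_order_of_lt_sum h1 A (fun a => pathSum none 0 (μ a))
            (fun a _ => (hμ a).pathSum_le_order none 0 (h2 a)) (not_le.mp hle)
          refine ⟨h3, fun a => ?_⟩
          have := h2 a
          rwa [weakTransform_succ _ a h3, mul_comm] at this
      · intro q
        cases q with
        | nil => exact le_rfl
        | cons a q => exact hνle a q
      · intro q
        cases q with
        | nil => exact Nat.le_succ _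
        | cons a q => exact hνge a q

end Colon

/-! ### Cluster ideals of curve germs -/

section ClusterIdeal

variable {K : Type*} [Field K]

open scoped Classical in
/-- The multiplicities of the strict transforms of a germ at the points of a tree. -/
def treeMult (C : LocalRing K) (T : Finset (InfNear K)) : InfNear K → ℕ :=
  fun q => if q ∈ T then (strictTransform q C).order.toNat else 0

open scoped Classical in
/-- The part of a tree above the point `[a]`. -/
def subTree (a : Option K) (T : Finset (InfNear K)) : Finset (InfNear K) :=
  T.preimage (List.cons a) (fun _ _ _ _ h => (List.cons.inj h).2)

theorem mem_subTree {K : Type*} {a : Option K} {T : Finset (InfNear K)} {q : InfNear K} :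
    q ∈ subTree a T ↔ a :: q ∈ T := by
  exact Finset.mem_preimage

theorem subMult_treeMult (a : Option K) (C : LocalRing K) (T : Finset (InfNear K)) :
    subMult a (treeMult C T) = treeMult (strictTransform₁ a C) (subTree a T) := by
  funext q
  unfold subMult treeMult
  by_cases h : a :: q ∈ T
  · rw [if_pos h, if_pos (mem_subTree.mpr h)]
    rfl
  · rw [if_neg h, if_neg (mt mem_subTree.mp h)]

theorem mem_clusterIdeal {C : LocalRing K} {T : Finset (InfNear K)} {f : LocalRing K} :
    f ∈ clusterIdeal C T ↔
      ∀ q ∈ T, (totalTransform q C).order ≤ (totalTransform q f).order := by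
  simp only [clusterIdeal, Ideal.mem_iInf]
  rfl

theorem totalTransform_injective (q : InfNear K) :
    Function.Injective (totalTransform q : LocalRing K → LocalRing K) := by
  induction q with
  | nil => exact Function.injective_id
  | cons a q ih => exact ih.comp (blowup_injective a)

/-- Orders add and the transform of Xⁿ is non-zero, so the common exceptional factor cancels. This
passes between conditions on total transforms and on weak transforms. -/
theorem order_totalTransform_X_pow_mul_le_iff (q : InfNear K) (n : ℕ) (f g : LocalRing K) :
    (totalTransform q (MvPowerSeries.X 0 ^ n * f)).order ≤
      (totalTransform q (MvPowerSeries.X 0 ^ n * g)).order ↔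
    (totalTransform q f).order ≤ (totalTransform q g).order := by
  rw [map_mul, map_mul, MvPowerSeries.order_mul, MvPowerSeries.order_mul]
  refine ENat.add_le_add_iff_left ?_
  rw [Ne, MvPowerSeries.order_eq_top_iff, map_eq_zero_iff _ (totalTransform_injective q)]
  exact pow_ne_zero _ (X_ne_zero 0)

/-- The cluster ideal of a germ is the ideal of the multiplicities of its strict transforms, and
these multiplicities are consistent. -/
theorem isConsistent_treeMult (T : Finset (InfNear K)) (hT : ∀ q ∈ T, ∀ p, p <+: q → p ∈ T)
    {C : LocalRing K} (hC : C ≠ 0) :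
    IsConsistent (treeMult C T) ∧ multIdeal (treeMult C T) = clusterIdeal C T := by
  classical
  obtain ⟨N, hN⟩ : ∃ N, ∀ q ∈ T, q.length < N :=
    ⟨T.sup List.length + 1, fun q hq => Nat.lt_succ_of_le (Finset.le_sup (f := List.length) hq)⟩
  induction N generalizing T C with
  | zero =>
    have : T = ∅ := Finset.eq_empty_of_forall_notMem fun q hq => absurd (hN q hq) (Nat.not_lt_zero _)
    subst this
    have : treeMult C ∅ = 0 := funext fun q => by simp [treeMult]
    rw [this, multIdeal_zero]
    exact ⟨.zero, by ext f; simp [mem_clusterIdeal]⟩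
  | succ N ih =>
    by_cases hnil : [] ∈ T
    · obtain ⟨n, hn⟩ := exists_order_eq hC
      have hst : ∀ a, strictTransform₁ a C = weakTransform n a C := strictTransform₁_eq hn
      have hst0 : ∀ a, strictTransform₁ a C ≠ 0 := fun a h => by
        refine axis_weakTransform_ne_zero hn a ?_
        rw [← hst, h, map_zero]
      have IH := fun a => ih (subTree a T)
        (fun q hq p hp => mem_subTree.mpr (hT _ (mem_subTree.mp hq) _
          ((List.prefix_cons_inj a).mpr hp))) (hst0 a) (fun q hq => by
          have := hN _ (mem_subTree.mp hq)
          simpa using this)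
      have hroot : treeMult C T [] = n := by
        simp only [treeMult, hnil, if_true, strictTransform, hn]; rfl
      constructor
      -- `q.head?.join` is the first direction of q; the root contributes ∞, which may be
      -- superfluous but does no harm.
      · refine .node (T.image fun q => q.head?.join) ?_ ?_ ?_
        · intro a ha
          rw [subMult_treeMult]
          have : subTree a T = ∅ := Finset.eq_empty_of_forall_notMem fun q hq =>
            ha (Finset.mem_image.mpr ⟨a :: q, mem_subTree.mp hq, by simp⟩)
          funext q
          simp [treeMult, this]
        · intro a
          rw [subMult_treeMult]
          exact (IH a).1
        · rw [hroot]
          -- The strict transform lies in its own cluster ideal, so Noether's bound estimates its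
          -- contact with the exceptional line from below; the total contact is at most n.
          refine sum_le_of_le_axis_order hn _ _ fun a _ => ?_
          rw [subMult_treeMult]
          refine (IH a).1.pathSum_le_order none 0 ?_
          rw [(IH a).2, ← hst, mem_clusterIdeal]
          exact fun q _ => le_rfl
      · ext f
        rw [mem_multIdeal, hroot, mem_clusterIdeal]
        simp only [subMult_treeMult, (IH _).2]
        constructor
        · rintro ⟨h1, h2⟩ q hq
          cases q with
          | nil => exact hn.le.trans h1
          | cons a q =>
            have := mem_clusterIdeal.mp (h2 a) q (mem_subTree.mpr hq)
            rw [hst, ← order_totalTransform_X_pow_mul_le_iff q n, X_pow_mul_weakTransform a h1,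
              X_pow_mul_weakTransform a hn.ge] at this
            exact this
        · intro h
          have h1 : (n : ℕ∞) ≤ f.order := hn.ge.trans (h [] hnil)
          refine ⟨h1, fun a => mem_clusterIdeal.mpr fun q hq => ?_⟩
          have := h (a :: q) (mem_subTree.mp hq)
          rw [hst, ← order_totalTransform_X_pow_mul_le_iff q n, X_pow_mul_weakTransform a h1,
            X_pow_mul_weakTransform a hn.ge]
          exact this
    · refine ih T hT hC fun q hq => absurd (hT q hq [] List.nil_prefix) hnil

end ClusterIdeal

/-! ### Degrees -/

section Degree

variable {K : Type*} [Field K]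

/-- The quotient by an ideal that is the kernel of a surjective linear map. -/
def quotientEquivOfKer {A V : Type*} [CommRing A] [Algebra K A] [AddCommGroup V] [Module K V]
    (I : Ideal A) (ψ : A →ₗ[K] V) (hψ : Function.Surjective ψ) (h : ∀ f, ψ f = 0 ↔ f ∈ I) :
    (A ⧸ I) ≃ₗ[K] V :=
  ((Submodule.Quotient.restrictScalarsEquiv K I).symm.trans
    (Submodule.quotEquivOfEq _ _ (by ext f; exact (h f).symm))).trans
    (ψ.quotKerEquivOfSurjective hψ)

/-- The finitely many coefficients with both exponents below N determine a germ up to order N. -/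
theorem finite_quotient_of_orderIdeal_le {I : Ideal (LocalRing K)} {N : ℕ}
    (h : orderIdeal (N : ℕ∞) ≤ I) : Module.Finite K (LocalRing K ⧸ I) := by
  let ψ : LocalRing K →ₗ[K] (Fin N × Fin N → K) := LinearMap.pi fun i =>
    MvPowerSeries.coeff (Finsupp.single 0 (i.1 : ℕ) + Finsupp.single 1 (i.2 : ℕ))
  have hker : LinearMap.ker ψ ≤ LinearMap.ker (Ideal.Quotient.mkₐ K I).toLinearMap := by
    intro f hf
    rw [LinearMap.mem_ker] at hf ⊢
    refine Ideal.Quotient.eq_zero_iff_mem.mpr (h ?_)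
    refine MvPowerSeries.nat_le_order fun d hd => ?_
    rw [degree_fin_two] at hd
    have := congrFun hf (⟨d 0, by omega⟩, ⟨d 1, by omega⟩)
    rw [eq_single_add_single d]
    exact this
  have : Module.Finite K (LocalRing K ⧸ LinearMap.ker ψ) :=
    Module.Finite.equiv ψ.quotKerEquivRange.symm
  refine Module.Finite.of_surjective
    ((LinearMap.ker ψ).liftQ (Ideal.Quotient.mkₐ K I).toLinearMap hker) ?_
  rw [← LinearMap.range_eq_top, Submodule.range_liftQ, LinearMap.range_eq_top]
  exact Ideal.Quotient.mkₐ_surjective K I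

variable {ι : Type*}

/-- The coordinate ring of a scheme concentrated at several points is the product of the local
coordinate rings. -/
def coordRingEquiv (J : ι → Ideal (LocalRing K)) : CoordRing J ≃ₗ[K] ∀ k, LocalRing K ⧸ J k :=
  quotientEquivOfKer (Ideal.pi J)
    (LinearMap.pi fun k => (Ideal.Quotient.mkₐ K (J k)).toLinearMap ∘ₗ LinearMap.proj k)
    (fun g => ⟨fun k => (Ideal.Quotient.mk_surjective (g k)).choose,
      funext fun k => (Ideal.Quotient.mk_surjective (g k)).choose_spec⟩)
    (fun f => by
      rw [Ideal.mem_pi, funext_iff]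
      exact forall_congr' fun k => Ideal.Quotient.eq_zero_iff_mem)

theorem degree_eq_sum [Fintype ι] {J : ι → Ideal (LocalRing K)}
    (hJ : ∀ k, Module.Finite K (LocalRing K ⧸ J k)) :
    degree J = ∑ k, Module.finrank K (LocalRing K ⧸ J k) := by
  rw [degree, (coordRingEquiv J).finrank_eq, Module.finrank_pi_fintype]

/-- Additivity of degrees for the residual and the intersection scheme. -/
theorem finrank_colon_add_finrank_sup (J : Ideal (LocalRing K)) (L : LocalRing K)
    [Module.Finite K (LocalRing K ⧸ J)] :
    Module.finrank K (LocalRing K ⧸ J.colon {L}) +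
      Module.finrank K (LocalRing K ⧸ (J ⊔ Ideal.span {L})) =
        Module.finrank K (LocalRing K ⧸ J) := by
  let π : (LocalRing K ⧸ J) →ₗ[K] (LocalRing K ⧸ (J ⊔ Ideal.span {L})) :=
    (Ideal.Quotient.factorₐ K (le_sup_left : J ≤ J ⊔ Ideal.span {L})).toLinearMap
  have hπmk : ∀ f, π (Ideal.Quotient.mk J f) = Ideal.Quotient.mk (J ⊔ Ideal.span {L}) f :=
    fun f => rfl
  have hπ : Function.Surjective π := fun y => by
    obtain ⟨f, rfl⟩ := Ideal.Quotient.mk_surjective y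
    exact ⟨_, hπmk f⟩
  -- Multiplication by L induces an isomorphism from the quotient by J : L onto the kernel of π;
  -- rank-nullity finishes.
  let ψ₀ : LocalRing K →ₗ[K] (LocalRing K ⧸ J) :=
    (Ideal.Quotient.mkₐ K J).toLinearMap ∘ₗ LinearMap.mulRight K L
  have hψ₀ : ∀ f, ψ₀ f = Ideal.Quotient.mk J (f * L) := fun f => rfl
  let ψ : LocalRing K →ₗ[K] LinearMap.ker π := ψ₀.codRestrict _ fun f => by
    rw [LinearMap.mem_ker, hψ₀, hπmk, Ideal.Quotient.eq_zero_iff_mem]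
    exact Ideal.mem_sup_right (Ideal.mul_mem_left _ _ (Ideal.mem_span_singleton_self L))
  have e : (LocalRing K ⧸ J.colon {L}) ≃ₗ[K] LinearMap.ker π := by
    refine quotientEquivOfKer _ ψ ?_ fun f => ?_
    · rintro ⟨y, hy⟩
      obtain ⟨g, rfl⟩ := Ideal.Quotient.mk_surjective y
      rw [LinearMap.mem_ker, hπmk, Ideal.Quotient.eq_zero_iff_mem, Submodule.mem_sup] at hy
      obtain ⟨j, hj, l, hl, rfl⟩ := hy
      obtain ⟨c, rfl⟩ := Ideal.mem_span_singleton'.mp hl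
      refine ⟨c, Subtype.ext ?_⟩
      change ψ₀ c = _
      rw [hψ₀, Ideal.Quotient.eq]
      have : c * L - (j + c * L) = -j := by ring
      rw [this]
      exact neg_mem hj
    · rw [Submodule.mem_colon_singleton, smul_eq_mul, ← Ideal.Quotient.eq_zero_iff_mem, ← hψ₀,
        ← Submodule.coe_eq_zero]
      rfl
  have := π.finrank_range_add_finrank_ker
  rw [LinearMap.range_eq_top.mpr hπ, finrank_top] at this
  rw [e.finrank_eq, add_comm, this]

/-! ### Intersection with a smooth germ -/

theorem exists_polynomial_sub_mem {L ξ : LocalRing K}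
    (hm : ∀ f, MvPowerSeries.constantCoeff f = 0 → ∃ p q, f = L * p + ξ * q)
    (hξ : 1 ≤ ξ.order) (N : ℕ) (f : LocalRing K) :
    ∃ P : Polynomial K, f - Polynomial.aeval ξ P ∈ Ideal.span {L} ⊔ orderIdeal (N : ℕ∞) := by
  induction N generalizing f with
  | zero => exact ⟨0, Ideal.mem_sup_right (by simp [mem_orderIdeal])⟩
  | succ N ih =>
    -- Modulo L one has f = f(0) + ξ q; expanding q in the same way produces the further
    -- coefficients.
    obtain ⟨p, q, hf⟩ := hm (f - MvPowerSeries.C (MvPowerSeries.constantCoeff f)) (by simp)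
    obtain ⟨P, hP⟩ := ih q
    obtain ⟨l, hl, r, hr, hlr⟩ := Submodule.mem_sup.mp hP
    refine ⟨Polynomial.C (MvPowerSeries.constantCoeff f) + Polynomial.X * P, ?_⟩
    have hC : Polynomial.aeval ξ (Polynomial.C (MvPowerSeries.constantCoeff f)) =
        MvPowerSeries.C (MvPowerSeries.constantCoeff f) := Polynomial.aeval_C _ _
    have : f - Polynomial.aeval ξ (Polynomial.C (MvPowerSeries.constantCoeff f) +
        Polynomial.X * P) = (L * p + ξ * l) + ξ * r := by
      rw [map_add, map_mul, Polynomial.aeval_X, hC]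
      linear_combination hf - ξ * hlr
    rw [this]
    refine add_mem (Ideal.mem_sup_left (add_mem (Ideal.mul_mem_right _ _
      (Ideal.mem_span_singleton_self L)) (Ideal.mul_mem_left _ _ hl))) (Ideal.mem_sup_right ?_)
    rw [mem_orderIdeal, MvPowerSeries.order_mul, add_comm ξ.order]
    push_cast
    exact add_le_add hr hξ

/-- The parameter is X 0 for a finite tangent direction and X 1 for ∞. The coefficient in L of the
other coordinate is then a unit, so L can replace that coordinate as a generator of the maximal
ideal. -/
theorem exists_arc_parameter {L : LocalRing K} (hL : L.order = 1) {a : Option K}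
    {h : PowerSeries K} (hz : arc a h L = 0) :
    ∃ ξ : LocalRing K, ξ.order = 1 ∧ arc a h ξ = PowerSeries.X ∧
      ∀ f, MvPowerSeries.constantCoeff f = 0 → ∃ p q, f = L * p + ξ * q := by
  obtain ⟨p, q, hpq⟩ := mem_span_X_of_constantCoeff (one_le_order_iff.mp hL.ge)
  have hw := one_le_order_iff.mp (one_le_order_of_arc_eq_zero
    (arc_weakTransform_eq_zero (n := 1) (by simpa using hL.ge) hz))
  have hne : MvPowerSeries.constantCoeff p ≠ 0 ∨ MvPowerSeries.constantCoeff q ≠ 0 := by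
    by_contra! hpq0
    have h1 : (2 : ℕ∞) ≤ L.order := by
      rw [hpq]
      have h2 : ∀ i (r : LocalRing K), MvPowerSeries.constantCoeff r = 0 →
          (2 : ℕ∞) ≤ (MvPowerSeries.X i * r).order := fun i r hr => by
        rw [MvPowerSeries.order_mul, order_X]
        exact add_le_add le_rfl (one_le_order_iff.mpr hr)
      exact le_order_add (h2 _ _ hpq0.1) (h2 _ _ hpq0.2)
    rw [hL] at h1
    exact absurd h1 (by decide)
  cases a with
  | some t =>
    rw [hpq, weakTransform_eq (by
      rw [map_add, map_mul, map_mul, blowup_X_zero_some, blowup_X_one_some, pow_one, mul_assoc,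
        ← mul_add])] at hw
    simp only [map_add, map_mul, constantCoeff_blowup, MvPowerSeries.constantCoeff_X,
      MvPowerSeries.constantCoeff_C, zero_add] at hw
    have hq : MvPowerSeries.constantCoeff q ≠ 0 := by
      rcases hne with hp | hq
      · rintro hq
        rw [hq, mul_zero, add_zero] at hw
        exact hp hw
      · exact hq
    have hinv := MvPowerSeries.mul_inv_cancel q hq
    refine ⟨MvPowerSeries.X 0, order_X 0, ?_, fun f hf => ?_⟩
    · rw [arc, AlgHom.comp_apply, blowup_X_zero_some, graphArc_X_zero]
    · obtain ⟨p', q', rfl⟩ := mem_span_X_of_constantCoeff hf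
      refine ⟨q⁻¹ * q', p' - p * q⁻¹ * q', ?_⟩
      rw [hpq]
      linear_combination (-MvPowerSeries.X 1 * q') * hinv
  | none =>
    rw [hpq, weakTransform_eq (g := MvPowerSeries.X 1 * blowup none p + blowup none q) (by
      rw [map_add, map_mul, map_mul, blowup_X_zero_none, blowup_X_one_none]; ring)] at hw
    simp only [map_add, map_mul, constantCoeff_blowup, MvPowerSeries.constantCoeff_X, zero_mul,
      zero_add] at hw
    have hinv := MvPowerSeries.mul_inv_cancel p (hne.resolve_right (not_not.mpr hw))
    refine ⟨MvPowerSeries.X 1, order_X 1, ?_, fun f hf => ?_⟩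
    · rw [arc, AlgHom.comp_apply, blowup_X_one_none, graphArc_X_zero]
    · obtain ⟨p', q', rfl⟩ := mem_span_X_of_constantCoeff hf
      refine ⟨p⁻¹ * p', q' - q * p⁻¹ * p', ?_⟩
      rw [hpq]
      linear_combination (-MvPowerSeries.X 0 * p') * hinv

/-- The intersection of a cluster with a smooth germ has as its degree the sum of the
multiplicities along the germ. -/
theorem IsConsistent.finrank_sup {m : InfNear K → ℕ} (hm : IsConsistent m) {L : LocalRing K}
    (hL : L.order = 1) {a : Option K} {h : PowerSeries K} (hz : arc a h L = 0) :
    Module.finrank K (LocalRing K ⧸ (multIdeal m ⊔ Ideal.span {L})) = pathSum a h m := by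
  obtain ⟨ξ, hξ1, hξ, hdec⟩ := exists_arc_parameter hL hz
  obtain ⟨N₀, hN₀⟩ := hm.exists_orderIdeal_le
  set e := pathSum a h m with he
  set I := multIdeal m ⊔ Ideal.span {L} with hI
  have hLI : L ∈ I := Ideal.mem_sup_right (Ideal.mem_span_singleton_self L)
  have harcP : ∀ P : Polynomial K, arc a h (Polynomial.aeval ξ P) = (P : PowerSeries K) := by
    intro P
    rw [← Polynomial.aeval_algHom_apply, hξ]
    induction P using Polynomial.induction_on' with
    | add p q hp hq => rw [map_add, hp, hq, Polynomial.coe_add]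
    | monomial n c =>
      rw [Polynomial.aeval_monomial, ← Polynomial.C_mul_X_pow_eq_monomial]
      push_cast
      rfl
  -- One polynomial in ξ approximates f both modulo I and on the arc; the precision N₀ + e + 1
  -- serves both purposes.
  have hred : ∀ f : LocalRing K, ∃ P : Polynomial K, f - Polynomial.aeval ξ P ∈ I ∧
      PowerSeries.X ^ (e + 1) ∣ arc a h f - (P : PowerSeries K) := by
    intro f
    obtain ⟨P, hP⟩ := exists_polynomial_sub_mem hdec hξ1.ge (N₀ + e + 1) f
    refine ⟨P, ?_, ?_⟩
    · refine (sup_le ?_ ?_ : _ ≤ I) hP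
      · exact le_sup_right
      · refine le_trans ((orderIdeal_anti ?_).trans hN₀) le_sup_left
        exact_mod_cast (by omega : N₀ ≤ N₀ + e + 1)
    · rw [← harcP, ← map_sub, ← Ideal.mem_span_singleton]
      refine (sup_le ?_ ?_ : _ ≤ (Ideal.span {PowerSeries.X ^ (e + 1)}).comap (arc a h)) hP
      · rw [Ideal.span_singleton_le_iff_mem, Ideal.mem_comap, hz]
        exact zero_mem _
      · intro r hr
        rw [Ideal.mem_comap, Ideal.mem_span_singleton]
        exact (pow_dvd_pow _ (by omega)).trans (X_pow_dvd_arc a h hr)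
  have hpoly : ∀ P : Polynomial K, PowerSeries.X ^ e ∣ (P : PowerSeries K) →
      Polynomial.X ^ e ∣ P := by
    intro P hP
    rw [Polynomial.X_pow_dvd_iff]
    intro d hd
    rw [← Polynomial.coeff_coe]
    exact PowerSeries.X_pow_dvd_iff.mp hP d hd
  -- An element attaining Noether's formula is, modulo I, ξ ^ e times a unit.
  have hξe : ξ ^ e ∈ I := by
    obtain ⟨j, hj, hje⟩ := hm.exists_order_arc_eq a h
    obtain ⟨P, hP, hPe⟩ := hred j
    have h1 : PowerSeries.X ^ e ∣ arc a h j := le_order_iff_X_pow_dvd.mp hje.ge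
    have h2 : PowerSeries.X ^ e ∣ (P : PowerSeries K) := by
      rw [← sub_sub_cancel (arc a h j) (P : PowerSeries K)]
      exact dvd_sub h1 ((pow_dvd_pow _ e.le_succ).trans hPe)
    obtain ⟨Q, rfl⟩ := hpoly P h2
    have hQ : Q.coeff 0 ≠ 0 := by
      intro hQ0
      have h3 : PowerSeries.X ^ (e + 1) ∣ ((Polynomial.X ^ e * Q : Polynomial K) : PowerSeries K) := by
        obtain ⟨Q', rfl⟩ := Polynomial.X_dvd_iff.mpr hQ0
        exact ⟨(Q' : PowerSeries K), by push_cast; ring⟩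
      have h4 : PowerSeries.X ^ (e + 1) ∣ arc a h j := by
        have := dvd_add hPe h3
        rwa [sub_add_cancel] at this
      rw [← le_order_iff_X_pow_dvd, hje] at h4
      norm_cast at h4
      omega
    have hu : IsUnit (Polynomial.aeval ξ Q) := by
      rw [MvPowerSeries.isUnit_iff_constantCoeff, isUnit_iff_ne_zero,
        ← constantCoeff_algHom (arc a h), harcP]
      simpa using hQ
    have h5 : Polynomial.aeval ξ (Polynomial.X ^ e * Q) ∈ I := by
      rw [← sub_sub_cancel j (Polynomial.aeval ξ (Polynomial.X ^ e * Q))]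
      exact sub_mem (Ideal.mem_sup_left hj) hP
    rw [map_mul, map_pow, Polynomial.aeval_X] at h5
    exact (Ideal.mul_unit_mem_iff_mem I hu).mp h5
  -- Truncated restriction to the arc: Noether's bound puts I into the kernel, and ξ ^ e ∈ I gives
  -- the converse.
  let ψ : LocalRing K →ₗ[K] (Fin e → K) := LinearMap.pi fun i =>
    (PowerSeries.coeff (i : ℕ)) ∘ₗ (arc a h).toLinearMap
  have hψ : ∀ f, ψ f = 0 ↔ PowerSeries.X ^ e ∣ arc a h f := by
    intro f
    rw [PowerSeries.X_pow_dvd_iff, funext_iff]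
    exact ⟨fun hf i hi => hf ⟨i, hi⟩, fun hf i => hf i i.2⟩
  rw [(quotientEquivOfKer I ψ ?_ ?_).finrank_eq, Module.finrank_fin_fun]
  · intro c
    refine ⟨Polynomial.aeval ξ (∑ i : Fin e, Polynomial.monomial (i : ℕ) (c i)), funext fun i => ?_⟩
    change PowerSeries.coeff (i : ℕ) (arc a h _) = _
    rw [harcP, Polynomial.coeff_coe, Polynomial.finsetSum_coeff, Finset.sum_eq_single i]
    · simp
    · intro j _ hj
      rw [Polynomial.coeff_monomial, if_neg]
      exact fun h => hj (Fin.ext h)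
    · simp
  · intro f
    rw [hψ]
    constructor
    · intro hf
      obtain ⟨P, hP, hPe⟩ := hred f
      have h2 : PowerSeries.X ^ e ∣ (P : PowerSeries K) := by
        rw [← sub_sub_cancel (arc a h f) (P : PowerSeries K)]
        exact dvd_sub hf ((pow_dvd_pow _ e.le_succ).trans hPe)
      obtain ⟨Q, rfl⟩ := hpoly P h2
      rw [map_mul, map_pow, Polynomial.aeval_X] at hP
      have := add_mem hP (I.mul_mem_right (Polynomial.aeval ξ Q) hξe)
      rwa [sub_add_cancel] at this
    · intro hf
      rw [← Ideal.mem_span_singleton]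
      refine (sup_le ?_ ?_ : I ≤ (Ideal.span {PowerSeries.X ^ e}).comap (arc a h)) hf
      · intro g hg
        rw [Ideal.mem_comap, Ideal.mem_span_singleton, ← le_order_iff_X_pow_dvd]
        exact hm.pathSum_le_order a h hg
      · rw [Ideal.span_singleton_le_iff_mem, Ideal.mem_comap, hz]
        exact zero_mem _

theorem IsConsistent.finrank_sup_eq_sum {m : InfNear K → ℕ} (hm : IsConsistent m)
    {L : LocalRing K} (hL : L.order ≤ 1) (T : Finset (InfNear K))
    (hT : ∀ q, m q ≠ 0 → (q ∈ T ↔ PassesThrough L q))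
    (hT' : ∀ q ∈ T, PassesThrough L q) :
    Module.finrank K (LocalRing K ⧸ (multIdeal m ⊔ Ideal.span {L})) = ∑ q ∈ T, m q := by
  rcases order_eq_one_or_isUnit hL with h1 | hu
  · obtain ⟨a, h, hz⟩ := exists_arc_eq_zero h1
    rw [hm.finrank_sup h1 hz, pathSum, ← finsum_mem_range (pathPoint_injective a h)]
    apply finsum_mem_eq_sum_of_inter_support_eq
    ext q
    simp only [Set.mem_inter_iff, Set.mem_range, Function.mem_support, Finset.mem_coe]
    refine and_congr_left fun hq => ?_
    rw [hT q hq, passesThrough_iff_of_arc_eq_zero h1 hz]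
    simp only [eq_comm]
  · have hT0 : T = ∅ := Finset.eq_empty_of_forall_notMem fun q hq =>
      not_passesThrough_of_isUnit hu q (hT' q hq)
    have htop : multIdeal m ⊔ Ideal.span {L} = ⊤ := by
      rw [Ideal.span_singleton_eq_top.mpr hu, sup_top_eq]
    rw [htop, hT0, Finset.sum_empty]
    have : Subsingleton (LocalRing K ⧸ (⊤ : Ideal (LocalRing K))) :=
      Ideal.Quotient.subsingleton_iff.mpr rfl
    exact Module.finrank_zero_of_subsingleton

end Degree

/-! ### Germs in general position with respect to given multiplicities -/

section General

variable {K : Type*} [Field K]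

/-- The germ `f` has the multiplicities `m`, and outside the support of `m` it is transversal to the
exceptional divisor; here `ε` is an equation of the exceptional divisor at the present point. -/
inductive IsGeneral : LocalRing K → (InfNear K → ℕ) → LocalRing K → Prop
  | unit {ε f : LocalRing K} (hf : IsUnit f) : IsGeneral ε 0 f
  | transversal {w f : LocalRing K} (hw : IsUnit w) (hf : (axis f).order = 1)
      (hf' : 1 ≤ f.order) : IsGeneral (MvPowerSeries.X 0 * w) 0 f
  | node {ε f : LocalRing K} {m : InfNear K → ℕ} (hf : f.order = m []) (hm : 0 < m [])
      (h : ∀ a, IsGeneral (MvPowerSeries.X 0 * strictTransform₁ a ε) (subMult a m)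
        (weakTransform (m []) a f)) : IsGeneral ε m f

/-- The strict transform of u = 0 passes only through the direction ∞. -/
theorem strictTransform₁_X_zero_mul (t : K) {w : LocalRing K} (hw : IsUnit w) :
    IsUnit (strictTransform₁ (some t) (MvPowerSeries.X 0 * w)) := by
  have h1 : (MvPowerSeries.X 0 * w).order = ((1 : ℕ) : ℕ∞) := by
    rw [MvPowerSeries.order_mul, isUnit_iff_order_eq_zero.mp hw, order_X]; simp
  rw [strictTransform₁_eq h1, weakTransform_eq (g := blowup (some t) w) (by
    rw [map_mul, blowup_X_zero_some, pow_one])]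
  exact hw.map _

/-- Transversality gives f = x p + y q with q(0) ≠ 0. In the product with x w the y² term is absent
and the xy coefficient is non-zero. -/
theorem isNode_mul_X_zero {f w : LocalRing K} (hw : IsUnit w) (hf : (axis f).order = 1)
    (hf' : 1 ≤ f.order) : IsNode (f * (MvPowerSeries.X 0 * w)) := by
  have h1 : f.order = 1 := le_antisymm ((order_le_order_axis f).trans hf.le) hf'
  obtain ⟨p, q, rfl, hq⟩ := exists_eq_add_of_axis_order (e := 1) (by simpa using hf)
  have hw0 : MvPowerSeries.constantCoeff w ≠ 0 :=
    (MvPowerSeries.isUnit_iff_constantCoeff.mp hw).ne_zero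
  refine ⟨?_, ?_⟩
  · rw [MvPowerSeries.order_mul, MvPowerSeries.order_mul, h1, order_X,
      isUnit_iff_order_eq_zero.mp hw]
    rfl
  · set g : LocalRing K := (MvPowerSeries.X 0 * p + MvPowerSeries.X 1 ^ 1 * q) * w with hg
    have e1 : (MvPowerSeries.X 0 * p + MvPowerSeries.X 1 ^ 1 * q) * (MvPowerSeries.X 0 * w) =
        MvPowerSeries.X 0 * g := by rw [hg]; ring
    rw [e1]
    have c1 : MvPowerSeries.coeff (Finsupp.single 1 2) (MvPowerSeries.X 0 * g) = 0 :=
      MvPowerSeries.X_dvd_iff.mp (Dvd.intro _ rfl) _ (by simp)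
    have c2 : MvPowerSeries.coeff (Finsupp.single 0 1 + Finsupp.single 1 1)
        (MvPowerSeries.X 0 * g) = MvPowerSeries.coeff (Finsupp.single 1 1) g := by
      rw [MvPowerSeries.X, MvPowerSeries.coeff_add_monomial_mul, one_mul]
    have c3 : MvPowerSeries.coeff (Finsupp.single 1 1) g =
        MvPowerSeries.constantCoeff (q * w) := by
      have : g = MvPowerSeries.X 0 * (p * w) + MvPowerSeries.X 1 * (q * w) := by rw [hg]; ring
      rw [this, map_add, MvPowerSeries.X_dvd_iff.mp (Dvd.intro _ rfl) (Finsupp.single 1 1) (by simp),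
        zero_add]
      have := MvPowerSeries.coeff_add_monomial_mul (Finsupp.single (1 : Fin 2) 1) 0 (q * w) (1 : K)
      rw [add_zero, one_mul, MvPowerSeries.coeff_zero_eq_constantCoeff_apply] at this
      exact this
    rw [c1, c2, c3, mul_zero, sub_zero, map_mul]
    exact pow_ne_zero _ (mul_ne_zero hq hw0)

/-- A germ transversal to the exceptional divisor remains transversal after blowing up. -/
theorem isNode_of_passesThrough {f w : LocalRing K} (hw : IsUnit w) (hf : (axis f).order = 1)
    (hf' : 1 ≤ f.order) (q : InfNear K) (hq : PassesThrough f q) :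
    IsNode (strictTransform q f * exceptionalAux (MvPowerSeries.X 0 * w) q) := by
  induction q generalizing f w with
  | nil => exact isNode_mul_X_zero hw hf hf'
  | cons a q ih =>
    have h1 : f.order = 1 := le_antisymm ((order_le_order_axis f).trans hf.le) hf'
    rw [passesThrough_cons, strictTransform₁_of_order_one h1] at hq
    have h2 : 1 ≤ (weakTransform 1 a f).order := by
      by_contra h
      exact not_passesThrough_of_isUnit (isUnit_of_not_one_le_order h) q hq
    change IsNode (strictTransform q (strictTransform₁ a f) * exceptionalAux (MvPowerSeries.X 0 *
      strictTransform₁ a (MvPowerSeries.X 0 * w)) q)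
    rw [strictTransform₁_of_order_one h1]
    cases a with
    | some t =>
      exact ih (strictTransform₁_X_zero_mul t hw) (axis_weakTransform_order_eq_one h1 h2) h2 hq
    | none =>
      -- The direction ∞ is that of u = 0, to which f is transversal.
      exfalso
      obtain ⟨p, r, hf3, hr⟩ := exists_eq_add_of_axis_order (e := 1) (by simpa using hf)
      rw [hf3, weakTransform_eq (g := MvPowerSeries.X 1 * blowup none p + blowup none r) (by
        rw [map_add, map_mul, map_mul, pow_one, blowup_X_zero_none, blowup_X_one_none]; ring),
        one_le_order_iff, map_add, map_mul, MvPowerSeries.constantCoeff_X, zero_mul, zero_add,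
        constantCoeff_blowup] at h2
      exact hr h2

theorem IsGeneral.order_strictTransform {ε f : LocalRing K} {m : InfNear K → ℕ}
    (h : IsGeneral ε m f) (q : InfNear K) (hq : m q ≠ 0) : (strictTransform q f).order = m q := by
  induction h generalizing q with
  | unit => exact absurd rfl hq
  | transversal => exact absurd rfl hq
  | node hf hm h ih =>
    cases q with
    | nil => exact hf
    | cons a q =>
      change (strictTransform q (strictTransform₁ a _)).order = _
      rw [strictTransform₁_eq hf]
      exact ih a q hq

theorem IsGeneral.isNode {ε f : LocalRing K} {m : InfNear K → ℕ} (h : IsGeneral ε m f)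
    (q : InfNear K) (hq : m q = 0) (hp : PassesThrough f q) :
    IsNode (strictTransform q f * exceptionalAux ε q) := by
  induction h generalizing q with
  | unit hf => exact absurd hp (not_passesThrough_of_isUnit hf q)
  | transversal hw hf hf' => exact isNode_of_passesThrough hw hf hf' q hp
  | node hf hm h ih =>
    cases q with
    | nil => exact absurd hq hm.ne'
    | cons a q =>
      rw [passesThrough_cons, strictTransform₁_eq hf] at hp
      change IsNode (strictTransform q (strictTransform₁ a _) * _)
      rw [strictTransform₁_eq hf]
      exact ih a q hq hp

theorem IsGeneral.of_subMult_eq_zero {ε f : LocalRing K} {m : InfNear K → ℕ}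
    (h : IsGeneral ε m f) (hm : m = 0) :
    IsUnit f ∨ ∃ w, IsUnit w ∧ ε = MvPowerSeries.X 0 * w ∧ (axis f).order = 1 ∧ 1 ≤ f.order := by
  cases h with
  | unit hf => exact Or.inl hf
  | transversal hw hf hf' => exact Or.inr ⟨_, hw, rfl, hf, hf'⟩
  | node hf hm' h => rw [hm] at hm'; exact absurd hm' (lt_irrefl _)

theorem arc_strictTransform₁_eq_zero {ε : LocalRing K} {b : Option K} {h : PowerSeries K}
    (hε : arc b h ε = 0) :
    arc (some (PowerSeries.constantCoeff h)) (shift h) (strictTransform₁ b ε) = 0 := by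
  by_cases h0 : ε = 0
  · have : strictTransform₁ b (0 : LocalRing K) = 0 := weakTransform_zero _ _
    rw [h0, this, map_zero]
  · obtain ⟨n, hn⟩ := PlaneCurveGerm.exists_order_eq h0
    rw [strictTransform₁_eq hn]
    exact arc_weakTransform_eq_zero hn.ge hε

/-- A germ in general position meets the exceptional divisor only in the given points. -/
theorem IsGeneral.order_arc {ε f : LocalRing K} {m : InfNear K → ℕ} (hg : IsGeneral ε m f)
    (hfin : m.support.Finite) {b : Option K} {h : PowerSeries K} (hε : arc b h ε = 0)
    (hu : m = 0 → IsUnit f) : (arc b h f).order = pathSum b h m := by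
  have hunit : ∀ {f : LocalRing K}, IsUnit f → (arc b h f).order = pathSum b h 0 := fun {f} hf => by
    rw [pathSum_zero, PowerSeries.order_zero_of_unit (hf.map _)]; rfl
  induction hg generalizing b h with
  | unit hf => exact hunit hf
  | transversal => exact hunit (hu rfl)
  | @node ε f m hf hm hsub ih =>
    have h1 := arc_strictTransform₁_eq_zero hε
    have h2 : subMult b m = 0 → IsUnit (weakTransform (m []) b f) := by
      intro h0
      -- In the transversal case the new exceptional line would be the only exceptional component at
      -- [b], yet the arc, a component of the old divisor, passes through it too.
      rcases (hsub b).of_subMult_eq_zero h0 with h3 | ⟨w, hw, hεw, -⟩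
      · exact h3
      · exfalso
        rw [mul_left_cancel₀ (X_ne_zero 0) hεw] at h1
        exact (hw.map (arc (some (PowerSeries.constantCoeff h)) (shift h))).ne_zero h1
    rw [pathSum_eq hfin, arc_eq b h hf.ge, PowerSeries.order_mul, PowerSeries.order_X_pow,
      ih b (support_sub_finite hfin b) (by rw [map_mul, h1, mul_zero]) h2 fun {f} hf => by
        rw [pathSum_zero, PowerSeries.order_zero_of_unit (hf.map _)]; rfl]
    push_cast
    rfl

theorem order_mul_isUnit {f c : LocalRing K} (hc : IsUnit c) : (f * c).order = f.order := by
  rw [MvPowerSeries.order_mul, isUnit_iff_order_eq_zero.mp hc, add_zero]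

theorem order_eq_of_lt {f g : LocalRing K} (h : f.order < (g - f).order) : g.order = f.order := by
  have := MvPowerSeries.order_add_of_order_ne h.ne
  rwa [add_sub_cancel, inf_eq_left.mpr h.le] at this

/-- The constant term and the linear part decide between the two cases; a perturbation of order two
and a unit factor do not affect them. -/
theorem IsGeneral.zero_of_le_order_sub {ε f : LocalRing K} {m : InfNear K → ℕ}
    (h : IsGeneral ε m f) (hm : m = 0) {g c : LocalRing K} (hc : IsUnit c)
    (hg : 2 ≤ (g - f * c).order) : IsGeneral ε m g := by
  subst hm
  rcases h.of_subMult_eq_zero rfl with hf | ⟨w, hw, rfl, hf, hf'⟩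
  · refine .unit (isUnit_iff_order_eq_zero.mpr ?_)
    have h0 := isUnit_iff_order_eq_zero.mp (hf.mul hc)
    rw [order_eq_of_lt (f := f * c), h0]
    rw [h0]
    exact lt_of_lt_of_le (by decide) hg
  · have h1 : f.order = 1 := le_antisymm ((order_le_order_axis f).trans hf.le) hf'
    have h2 : (f * c).order = 1 := by rw [order_mul_isUnit hc, h1]
    have h3 : g.order = 1 := by
      rw [order_eq_of_lt (f := f * c), h2]
      rw [h2]
      exact lt_of_lt_of_le (by decide) hg
    refine .transversal hw ?_ h3.ge
    have h4 : (axis (f * c)).order = 1 := by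
      rw [map_mul, PowerSeries.order_mul, hf, PowerSeries.order_zero_of_unit (hc.map _), add_zero]
    have h5 : (axis (f * c)).order < (axis (g - f * c)).order := by
      rw [h4]
      exact lt_of_lt_of_le (by decide) (hg.trans (order_le_order_axis _))
    have := PowerSeries.order_add_of_order_ne _ _ h5.ne
    rwa [← map_add, add_sub_cancel, inf_eq_left.mpr h5.le, h4] at this

/-- Being in general position is an open condition, and it is invariant under multiplication
by units. -/
theorem IsGeneral.exists_forall_le_order_sub {ε f : LocalRing K} {m : InfNear K → ℕ}
    (h : IsGeneral ε m f) (hfin : m.support.Finite) :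
    ∃ N : ℕ, ∀ g c : LocalRing K, IsUnit c → (N : ℕ∞) ≤ (g - f * c).order → IsGeneral ε m g := by
  classical
  induction h with
  | unit hf =>
    exact ⟨2, fun g c hc hg => (IsGeneral.unit hf).zero_of_le_order_sub rfl hc (by simpa using hg)⟩
  | transversal hw hf hf' =>
    exact ⟨2, fun g c hc hg =>
      (IsGeneral.transversal hw hf hf').zero_of_le_order_sub rfl hc (by simpa using hg)⟩
  | @node ε f m hf hm hsub ih =>
    choose N hN using fun a => ih a (support_sub_finite hfin a)
    let A : Finset (Option K) := hfin.toFinset.image fun q => q.head?.join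
    have hA : ∀ a ∉ A, subMult a m = 0 := fun a ha => funext fun q => by
      by_contra hne
      exact ha (Finset.mem_image.mpr ⟨a :: q, hfin.mem_toFinset.mpr hne, by simp⟩)
    -- The weak transform costs m []; what remains covers N a for the directions in A, and 2 for all
    -- others, where m is zero.
    refine ⟨2 + ∑ a ∈ A, N a + m [], fun g c hc hg => ?_⟩
    have hfc : (f * c).order = m [] := by rw [order_mul_isUnit hc, hf]
    have hlt : (f * c).order < (g - f * c).order := by
      rw [hfc]
      refine lt_of_lt_of_le ?_ hg
      exact_mod_cast (by omega : m [] < 2 + ∑ a ∈ A, N a + m [])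
    have hgo : g.order = m [] := (order_eq_of_lt hlt).trans hfc
    refine .node hgo hm fun a => ?_
    have h1 := le_order_weakTransform a hg
    rw [weakTransform_sub, weakTransform_mul_blowup a c hf.ge] at h1
    by_cases ha : a ∈ A
    · refine hN a _ _ (hc.map _) (le_trans ?_ h1)
      have := Finset.single_le_sum (f := N) (fun _ _ => Nat.zero_le _) ha
      exact_mod_cast (by omega : N a ≤ 2 + ∑ a ∈ A, N a)
    · refine (hsub a).zero_of_le_order_sub (hA a ha) (hc.map (blowup a)) (le_trans ?_ h1)
      exact_mod_cast (by omega : 2 ≤ 2 + ∑ a ∈ A, N a)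

theorem strictTransform₁_ne_zero {ε : LocalRing K} (hε : ε ≠ 0) (a : Option K) :
    strictTransform₁ a ε ≠ 0 := fun h => by
  obtain ⟨n, hn⟩ := PlaneCurveGerm.exists_order_eq hε
  rw [strictTransform₁_eq hn] at h
  exact axis_weakTransform_ne_zero hn a (by rw [h, map_zero])

/-- Each such direction is a zero of the initial form of ε. -/
theorem finite_setOf_not_isUnit_strictTransform₁ {ε : LocalRing K} (hε : ε ≠ 0) :
    {a | ¬ IsUnit (strictTransform₁ a ε)}.Finite := by
  by_contra hinf
  obtain ⟨n, hn⟩ := PlaneCurveGerm.exists_order_eq hε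
  obtain ⟨A, hA, hcard⟩ := Set.Infinite.exists_subset_card_eq hinf (n + 1)
  have := sum_le_of_le_axis_order hn A (fun _ => 1) (fun a ha => by
    have h1 := hA ha
    rw [Set.mem_ofPred_eq, strictTransform₁_eq hn, isUnit_iff_order_eq_zero] at h1
    rw [Nat.cast_one]
    exact (Order.one_le_iff_ne_zero.mpr h1).trans (order_le_order_axis _))
  simp [hcard] at this

/-- Germs in general position exist for all consistent multiplicities. -/
theorem IsConsistent.exists_isGeneral [Infinite K] {m : InfNear K → ℕ} (hm : IsConsistent m)
    {ε : LocalRing K} (hε : ε ≠ 0) : ∃ f, IsGeneral ε m f := by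
  classical
  induction hm generalizing ε with
  | zero => exact ⟨1, .unit isUnit_one⟩
  | @node m A hA hsub hsum ih =>
    have hm := IsConsistent.node A hA hsub hsum
    rcases Nat.eq_zero_or_pos (m []) with h0 | hpos
    · rw [hm.eq_zero h0]
      exact ⟨1, .unit isUnit_one⟩
    have hε' : ∀ a, MvPowerSeries.X 0 * strictTransform₁ a ε ≠ 0 := fun a =>
      mul_ne_zero (X_ne_zero 0) (strictTransform₁_ne_zero hε a)
    choose f hf using fun a => ih a (hε' a)
    choose N hN using fun a => (hf a).exists_forall_le_order_sub (hsub a).finite_support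
    set n := m [] with hn
    let e : Option K → ℕ := fun a => pathSum none 0 (subMult a m)
    have hfe : ∀ a, subMult a m ≠ 0 → (axis (f a)).order = e a := fun a ha =>
      (hf a).order_arc (hsub a).finite_support (by rw [map_mul, axis_X_zero, zero_mul])
        fun h => absurd h ha
    -- auxiliary directions, in which the germ is smooth and transversal
    obtain ⟨B, hB, hBcard⟩ := Set.Infinite.exists_subset_card_eq
      ((A.finite_toSet.union (finite_setOf_not_isUnit_strictTransform₁ hε)).infinite_compl)
      (n - ∑ a ∈ A, e a)
    have hBA : Disjoint A B := Finset.disjoint_left.mpr fun a ha hb => hB hb (Or.inl ha)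
    -- The simple zeros in B raise the total contact to exactly n, so a product of lines of degree n
    -- has these zeros and no others.
    let e' : Option K → ℕ := fun a => if a ∈ A then e a else if a ∈ B then 1 else 0
    have hsum' : A.sum e ≤ n := hsum
    have he'sum : ∑ a ∈ A ∪ B, e' a = n := by
      rw [Finset.sum_union hBA, Finset.sum_congr rfl (g := e) fun a ha => by simp [e', ha],
        Finset.sum_congr rfl (g := fun _ => 1) (s₁ := B) fun a ha => by
          simp [e', ha, Finset.disjoint_right.mp hBA ha]]
      rw [Finset.sum_const, smul_eq_mul, mul_one, hBcard]
      exact Nat.add_sub_cancel' hsum'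
    obtain ⟨F, hF, hF'⟩ := exists_prod_lines (A ∪ B) e' (by
      intro a ha
      rw [Finset.mem_union, not_or] at ha
      simp [e', ha.1, ha.2])
    rw [he'sum] at hF hF'
    choose w hw hFw using hF'
    -- On u = 0 the weak transform of F and the chosen germ f a have the same order, so they agree
    -- there up to a unit; only a multiple of u needs correction.
    have key : ∀ a, ∃ p k : LocalRing K, subMult a m ≠ 0 → IsUnit k ∧
        weakTransform n a F + MvPowerSeries.X 0 * p = f a * k := by
      intro a
      by_cases ha : subMult a m = 0
      · exact ⟨0, 0, fun h => absurd ha h⟩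
      · obtain ⟨p, q, hpq, hq⟩ := exists_eq_add_of_axis_order (hfe a ha)
        refine ⟨p * (q⁻¹ * w a), q⁻¹ * w a, fun _ => ⟨?_, ?_⟩⟩
        · rw [MvPowerSeries.isUnit_iff_constantCoeff, isUnit_iff_ne_zero, map_mul,
            MvPowerSeries.constantCoeff_inv]
          exact mul_ne_zero (inv_ne_zero hq) (hw a)
        · have haA : a ∈ A := by
            by_contra h
            exact ha (hA a h)
          have he : e' a = e a := by simp [e', haA]
          rw [hFw, hpq, he]
          linear_combination (-MvPowerSeries.X 1 ^ e a * w a) * MvPowerSeries.mul_inv_cancel q hq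
    choose p k hpk using key
    set N₀ := ∑ a ∈ A, N a with hN₀
    let A' := A.filter fun a => subMult a m ≠ 0
    -- The correction has order n + 1 and leaves the restriction to the exceptional line unchanged.
    -- It makes the weak transform a unit multiple of f a up to order N₀, and openness preserves
    -- general position.
    obtain ⟨F', hF'o, hF'⟩ := PlaneCurveGerm.exists_weakTransform_sub_mem (n + 1) A' e
      ((Finset.sum_le_sum_of_subset (Finset.filter_subset _ _)).trans (hsum.trans (by omega)))
      (fun a => Ideal.span {f a} ⊔ orderIdeal (N₀ : ℕ∞)) N₀
      (fun a _ => Ideal.mem_sup_right (X_pow_mem_orderIdeal 0 N₀))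
      (fun a ha => exists_X_one_pow_sub_mem
        (Ideal.mem_sup_left (Ideal.mem_span_singleton_self (f a)))
        (hfe a (Finset.mem_filter.mp ha).2)) p
    have hF'o' : (n : ℕ∞) ≤ F'.order := le_trans (by exact_mod_cast n.le_succ) hF'o
    have hC : ∀ a, weakTransform n a (F + F') =
        MvPowerSeries.X 1 ^ e' a * w a + MvPowerSeries.X 0 * weakTransform (n + 1) a F' :=
      fun a => by rw [weakTransform_add, hFw, weakTransform_succ n a hF'o]
    have haxis : ∀ a, (axis (weakTransform n a (F + F'))).order = e' a := fun a =>
      axis_order_eq (by rw [hC a, add_comm]) (hw a)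
    have hle : (n : ℕ∞) ≤ (F + F').order := le_order_add hF hF'o'
    have hord : (F + F').order = n := by
      by_contra hne
      have hlt : ((n + 1 : ℕ) : ℕ∞) ≤ (F + F').order := by
        have := Order.add_one_le_of_lt (lt_of_le_of_ne hle (Ne.symm hne))
        exact_mod_cast this
      have := haxis none
      rw [weakTransform_succ n none hlt, map_mul, axis_X_zero, zero_mul,
        PowerSeries.order_zero] at this
      exact absurd this (by simp)
    refine ⟨F + F', .node hord hpos fun a => ?_⟩
    rw [← hn]
    by_cases ha : subMult a m = 0
    · rw [ha]
      by_cases haB : a ∈ B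
      · have haA : a ∉ A := Finset.disjoint_right.mp hBA haB
        have h1 : e' a = 1 := by simp [e', haA, haB]
        refine .transversal ?_ (by rw [haxis, h1]; rfl) ?_
        · by_contra h
          exact hB haB (Or.inr h)
        · rw [one_le_order_iff, hC, h1]
          simp
      · have h1 : e' a = 0 := by
          by_cases haA : a ∈ A <;> simp [e', haA, haB, e, ha]
        refine .unit ?_
        rw [MvPowerSeries.isUnit_iff_constantCoeff, isUnit_iff_ne_zero, hC, h1]
        simpa using hw a
    · have haA : a ∈ A := by
        by_contra h
        exact ha (hA a h)
      obtain ⟨hk, hpka⟩ := hpk a ha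
      obtain ⟨l, hl, r, hr, hlr⟩ := Submodule.mem_sup.mp
        (hF' a (Finset.mem_filter.mpr ⟨haA, ha⟩))
      obtain ⟨s, rfl⟩ := Ideal.mem_span_singleton'.mp hl
      refine hN a _ (k a + MvPowerSeries.X 0 * s) ?_ ?_
      · rw [MvPowerSeries.isUnit_iff_constantCoeff] at hk ⊢
        simpa using hk
      · have h2 : weakTransform n a (F + F') - f a * (k a + MvPowerSeries.X 0 * s) =
            r * MvPowerSeries.X 0 := by
          rw [weakTransform_add, weakTransform_succ n a hF'o]
          linear_combination hpka - MvPowerSeries.X 0 * hlr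
        rw [h2]
        refine le_order_mul_left _ (le_trans ?_ hr)
        exact_mod_cast Finset.single_le_sum (f := N) (fun _ _ => Nat.zero_le _) haA

end General

/-! ### Approximation by reduced germs -/

section Squarefree

variable {K : Type*} [Field K]

open Polynomial

theorem axis_eq_zero_iff {f : LocalRing K} : axis f = 0 ↔ MvPowerSeries.X 0 ∣ f := by
  constructor
  · intro hf
    rw [MvPowerSeries.X_dvd_iff]
    by_contra! h
    obtain ⟨d, hd, hne⟩ := h
    have hex : ∃ j, MvPowerSeries.coeff (Finsupp.single 1 j) f ≠ 0 :=
      ⟨d 1, by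
        have := eq_single_add_single d
        rw [hd, Finsupp.single_zero, zero_add] at this
        exact fun h0 => hne ((congrArg (fun m => MvPowerSeries.coeff m f) this).trans h0)⟩
    classical
    obtain ⟨p, q, h, hq⟩ := exists_eq_add_of_coeff_eq_zero f (Nat.find hex)
      (fun j hj => not_not.mp (Nat.find_min hex hj))
    have := axis_order_eq h (hq ▸ Nat.find_spec hex)
    rw [hf, PowerSeries.order_zero] at this
    exact absurd this (by simp)
  · rintro ⟨g, rfl⟩
    rw [map_mul, axis_X_zero, zero_mul]

/-- Restriction to the axis has kernel generated by X 0, and its target is a domain. -/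
theorem X_zero_prime : Prime (MvPowerSeries.X 0 : LocalRing K) := by
  refine ⟨X_ne_zero 0, fun h => ?_, fun f g h => ?_⟩
  · rw [isUnit_iff_order_eq_zero, order_X] at h
    exact one_ne_zero h
  · rw [← axis_eq_zero_iff, map_mul, mul_eq_zero, axis_eq_zero_iff, axis_eq_zero_iff] at h
    exact h

/-- Polynomials in `y` over `K[x]` as power series. -/
def polyGerm : K[X][X] →+* LocalRing K :=
  eval₂RingHom (aeval (R := K) (MvPowerSeries.X 0 : LocalRing K)).toRingHom (MvPowerSeries.X 1)

theorem polyGerm_C (c : K[X]) : polyGerm (C c) = aeval (MvPowerSeries.X 0 : LocalRing K) c :=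
  eval₂_C _ _

theorem polyGerm_X : polyGerm (X : K[X][X]) = MvPowerSeries.X 1 := eval₂_X _ _

theorem axis_aeval (c : K[X]) :
    axis (aeval (MvPowerSeries.X 0 : LocalRing K) c) = PowerSeries.C (c.coeff 0) := by
  rw [← aeval_algHom_apply, axis_X_zero, aeval_def, eval₂_at_zero]
  rfl

theorem axis_polyGerm (P : K[X][X]) :
    axis (polyGerm P) = (P.map (evalRingHom 0) : K[X]) := by
  induction P using Polynomial.induction_on' with
  | add p q hp hq => rw [map_add, map_add, hp, hq, Polynomial.map_add, coe_add]
  | monomial n c =>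
    rw [← C_mul_X_pow_eq_monomial, map_mul, map_pow, polyGerm_C, polyGerm_X, map_mul, map_pow,
      axis_aeval, axis_X_one]
    simp [coeff_zero_eq_eval_zero]

theorem pderiv_polyGerm (P : K[X][X]) :
    MvPowerSeries.pderiv K 1 (polyGerm P) = polyGerm (derivative P) := by
  have hc : ∀ c : K[X], MvPowerSeries.pderiv K 1 (aeval (MvPowerSeries.X 0 : LocalRing K) c) = 0 := by
    intro c
    rw [Derivation.map_aeval]
    simp [MvPowerSeries.pderiv_X_of_ne]
  induction P using Polynomial.induction_on' with
  | add p q hp hq => rw [map_add, map_add, hp, hq, derivative_add, map_add]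
  | monomial n c =>
    rw [← C_mul_X_pow_eq_monomial, map_mul, map_pow, polyGerm_C, polyGerm_X, Derivation.leibniz,
      hc, smul_zero, add_zero, Derivation.leibniz_pow, MvPowerSeries.pderiv_X_self,
      derivative_C_mul_X_pow, map_mul, map_pow, polyGerm_C, polyGerm_X]
    simp
    ring

/-- Polynomial approximation of germs. -/
theorem exists_polyGerm_sub_mem (f : LocalRing K) (N : ℕ) :
    ∃ P : K[X][X], P.degree < N ∧ (N : ℕ∞) ≤ (polyGerm P - f).order := by
  induction N generalizing f with
  | zero => exact ⟨0, by simp, by simp⟩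
  | succ N ih =>
    obtain ⟨p, q, hpq⟩ := mem_span_X_of_constantCoeff
      (f := f - MvPowerSeries.C (MvPowerSeries.constantCoeff f)) (by simp)
    obtain ⟨P, hP, hP'⟩ := ih p
    obtain ⟨Q, hQ, hQ'⟩ := ih q
    refine ⟨C (C (MvPowerSeries.constantCoeff f)) + (C X * P + X * Q), ?_, ?_⟩
    · refine (degree_add_le _ _).trans_lt (max_lt ?_ ((degree_add_le _ _).trans_lt (max_lt ?_ ?_)))
      · exact degree_C_le.trans_lt (by exact_mod_cast N.succ_pos)
      · refine lt_of_le_of_lt ?_ (hP.trans (by exact_mod_cast N.lt_succ_self))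
        rw [degree_mul, degree_C Polynomial.X_ne_zero, zero_add]
      · rw [mul_comm, degree_mul, degree_X]
        by_cases hQ0 : Q = 0
        · rw [hQ0, degree_zero, WithBot.bot_add]
          exact WithBot.bot_lt_coe _
        · rw [degree_eq_natDegree hQ0] at hQ ⊢
          norm_cast at hQ ⊢
          omega
    · have e1 : polyGerm (C (C (MvPowerSeries.constantCoeff f)) + (C X * P + X * Q)) - f =
          MvPowerSeries.X 0 * (polyGerm P - p) + MvPowerSeries.X 1 * (polyGerm Q - q) := by
        rw [map_add, map_add, map_mul, map_mul, polyGerm_C, polyGerm_C, polyGerm_X, aeval_X, aeval_C]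
        have : algebraMap K (LocalRing K) (MvPowerSeries.constantCoeff f) =
          MvPowerSeries.C (MvPowerSeries.constantCoeff f) := rfl
        rw [this]
        linear_combination -hpq
      rw [e1, add_comm N 1]
      exact le_order_add (le_order_mul_of_le (by simp) hP') (le_order_mul_of_le (by simp) hQ')

/-- If `P` is monic and coprime to its derivative over `K(x)`, then it is reduced as a germ. -/
theorem squarefree_polyGerm {P : K[X][X]} (hP : P.Monic)
    (hcop : IsCoprime (P.map (algebraMap K[X] (FractionRing K[X])))
      ((derivative P).map (algebraMap K[X] (FractionRing K[X])))) : Squarefree (polyGerm P) := by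
  obtain ⟨a, b, hab⟩ := hcop
  have hinj : Function.Injective (algebraMap K[X] (FractionRing K[X])) :=
    IsFractionRing.injective _ _
  obtain ⟨ca, hca, ha⟩ := IsLocalization.integerNormalization_spec (nonZeroDivisors K[X]) a
  obtain ⟨cb, hcb, hb⟩ := IsLocalization.integerNormalization_spec (nonZeroDivisors K[X]) b
  set a' := IsLocalization.integerNormalization (nonZeroDivisors K[X]) a
  set b' := IsLocalization.integerNormalization (nonZeroDivisors K[X]) b
  -- Clearing denominators in the Bézout relation yields a non-zero polynomial in x alone in the
  -- ideal generated by P and its y-derivative.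
  have hd : C cb * a' * P + C ca * b' * derivative P = C (ca * cb) := by
    apply Polynomial.map_injective _ hinj
    have hs : ∀ (c : K[X]) (p : (FractionRing K[X])[X]),
        c • p = C (algebraMap K[X] (FractionRing K[X]) c) * p := fun c p => by
      rw [← smul_eq_C_mul, algebraMap_smul]
    simp only [Polynomial.map_add, Polynomial.map_mul, map_C, ha, hb, hs, map_mul]
    linear_combination C (algebraMap K[X] (FractionRing K[X]) ca) *
      C (algebraMap K[X] (FractionRing K[X]) cb) * hab
  have hd0 : ca * cb ≠ 0 := mul_ne_zero (nonZeroDivisors.ne_zero hca) (nonZeroDivisors.ne_zero hcb)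
  -- A germ whose square divides P divides P and its y-derivative, hence that polynomial in x, which
  -- is a power of x times a unit.
  intro g hg
  obtain ⟨s, hs⟩ := hg
  have hgP : g ∣ polyGerm P := ⟨g * s, by rw [hs]; ring⟩
  have hgP' : g ∣ polyGerm (derivative P) := by
    rw [← pderiv_polyGerm, hs, Derivation.leibniz, Derivation.leibniz]
    simp only [smul_eq_mul]
    exact ⟨g * MvPowerSeries.pderiv K 1 s + 2 * s * MvPowerSeries.pderiv K 1 g, by ring⟩
  have hgd : g ∣ aeval (MvPowerSeries.X 0 : LocalRing K) (ca * cb) := by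
    rw [← polyGerm_C, ← hd, map_add, map_mul polyGerm _ P, map_mul polyGerm _ (derivative P)]
    exact dvd_add (hgP.mul_left _) (hgP'.mul_left _)
  obtain ⟨D, hD, hD0⟩ := exists_eq_pow_rootMultiplicity_mul_and_not_dvd (ca * cb) hd0 0
  rw [C_0, sub_zero, X_dvd_iff] at hD0
  rw [hD, C_0, sub_zero, map_mul, map_pow, aeval_X] at hgd
  have hu : IsUnit (aeval (MvPowerSeries.X 0 : LocalRing K) D) := by
    rw [MvPowerSeries.isUnit_iff_constantCoeff, isUnit_iff_ne_zero, ← constantCoeff_algHom axis,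
      axis_aeval, PowerSeries.constantCoeff_C]
    exact hD0
  obtain ⟨r, hr⟩ := (hu.dvd_mul_right).mp hgd
  -- A monic P does not vanish on x = 0. So g divides a power of x without being divisible by the
  -- prime x, and is a unit.
  have hX : ¬ MvPowerSeries.X 0 ∣ g := by
    intro h
    have h1 := axis_eq_zero_iff.mpr (h.trans hgP)
    rw [axis_polyGerm, coe_eq_zero_iff] at h1
    exact (hP.map (evalRingHom 0)).ne_zero h1
  obtain ⟨r', rfl⟩ := X_zero_prime.pow_dvd_of_dvd_mul_left _ hX (dvd_of_eq hr)
  refine IsUnit.of_mul_eq_one r' (mul_left_cancel₀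
    (pow_ne_zero (Polynomial.rootMultiplicity 0 (ca * cb)) (X_ne_zero 0)) ?_)
  linear_combination -hr

/-- Germs can be approximated by reduced germs. -/
theorem exists_squarefree_sub_mem [CharZero K] (f : LocalRing K) (N : ℕ) :
    ∃ g, Squarefree g ∧ (N : ℕ∞) ≤ (g - f).order := by
  classical
  obtain ⟨P, hP, hPf⟩ := exists_polyGerm_sub_mem f (N + 1)
  -- Both added terms have order N + 1 as germs. The first makes the polynomial monic; the second
  -- moves it in a family with constant y-derivative, which is non-zero in characteristic zero.
  let Q : K → K[X][X] := fun c => X ^ (N + 1) + (P + C (C c * X ^ (N + 1)))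
  have hdeg : ∀ c, (P + C (C c * X ^ (N + 1))).degree < ((N + 1 : ℕ) : WithBot ℕ) := fun c =>
    (degree_add_le _ _).trans_lt (max_lt hP (degree_C_le.trans_lt (by exact_mod_cast N.succ_pos)))
  have hmonic : ∀ c, (Q c).Monic := fun c => monic_X_pow_add (by exact_mod_cast hdeg c)
  have hnat : ∀ c, (Q c).natDegree = N + 1 := fun c =>
    natDegree_eq_of_degree_eq_some (by
      rw [degree_add_eq_left_of_degree_lt, degree_X_pow]
      rw [degree_X_pow]; exact hdeg c)
  have hder : ∀ c, derivative (Q c) = derivative (Q 0) := fun c => by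
    simp only [Q, derivative_add, derivative_C]
  let φ := algebraMap K[X] (FractionRing K[X])
  have hinj : Function.Injective φ := IsFractionRing.injective _ _
  set D := (derivative (Q 0)).map φ with hD
  have hD0 : D ≠ 0 := by
    rw [hD, Ne, Polynomial.map_eq_zero_iff hinj, ← Ne]
    intro h
    have := derivative_eq_zero.mp h
    rw [hnat] at this
    omega
  obtain ⟨c, hc⟩ : ∃ c, IsCoprime ((Q c).map φ) D := by
    by_contra! hno
    have key : ∀ c, ∃ π ∈ (UniqueFactorizationMonoid.normalizedFactors D).toFinset,
        π ∣ (Q c).map φ ∧ Irreducible π := by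
      intro c
      have h1 : ¬ IsUnit (EuclideanDomain.gcd ((Q c).map φ) D) := fun h =>
        hno c (EuclideanDomain.gcd_isUnit_iff.mp h)
      have h2 : EuclideanDomain.gcd ((Q c).map φ) D ≠ 0 := fun h =>
        hD0 (EuclideanDomain.gcd_eq_zero_iff.mp h).2
      obtain ⟨π, hπ, hπd⟩ := WfDvdMonoid.exists_irreducible_factor h1 h2
      obtain ⟨π', hπ', hass⟩ := UniqueFactorizationMonoid.exists_mem_normalizedFactors_of_dvd hD0 hπ
        (hπd.trans (EuclideanDomain.gcd_dvd_right _ _))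
      exact ⟨π', Multiset.mem_toFinset.mpr hπ',
        hass.symm.dvd.trans (hπd.trans (EuclideanDomain.gcd_dvd_left _ _)),
        hass.irreducible hπ⟩
    choose π hπ hπd hirr using key
    -- The derivative has finitely many prime factors, so two parameters share one. It divides the
    -- difference, a non-zero element of the field K(x), which is absurd.
    obtain ⟨c, d, hcd, heq⟩ := Finite.exists_ne_map_eq_of_infinite fun c =>
      (⟨π c, hπ c⟩ : (UniqueFactorizationMonoid.normalizedFactors D).toFinset)
    have heq' : π c = π d := congrArg Subtype.val heq
    have h3 : π c ∣ (Q c).map φ - (Q d).map φ := dvd_sub (hπd c) (heq' ▸ hπd d)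
    have h4 : (Q c).map φ - (Q d).map φ = C (φ (C (c - d) * X ^ (N + 1))) := by
      rw [← Polynomial.map_sub, ← map_C]
      congr 1
      simp only [Q, C_sub, C_mul, sub_mul]
      ring
    rw [h4] at h3
    refine (hirr c).not_isUnit (isUnit_of_dvd_unit h3 (isUnit_C.mpr (isUnit_iff_ne_zero.mpr ?_)))
    rw [Ne, map_eq_zero_iff _ hinj]
    exact mul_ne_zero (C_ne_zero.mpr (sub_ne_zero.mpr hcd)) (pow_ne_zero _ Polynomial.X_ne_zero)
  refine ⟨polyGerm (Q c), squarefree_polyGerm (hmonic c) (by rw [hder]; exact hc), ?_⟩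
  have e1 : polyGerm (Q c) - f = MvPowerSeries.X 1 ^ (N + 1) + ((polyGerm P - f) +
      MvPowerSeries.X 0 ^ (N + 1) * MvPowerSeries.C c) := by
    simp only [Q, map_add, map_mul, map_pow, polyGerm_X, polyGerm_C, aeval_X, aeval_C]
    have : algebraMap K (LocalRing K) c = MvPowerSeries.C c := rfl
    rw [this]
    ring
  refine le_trans (by exact_mod_cast N.le_succ : (N : ℕ∞) ≤ ((N + 1 : ℕ) : ℕ∞)) ?_
  rw [e1]
  exact le_order_add (order_X_pow 1 _).ge (le_order_add hPf
    (le_order_mul_left _ (order_X_pow 0 _).ge))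

end Squarefree

/-! ### Generalized singularity schemes and consistent multiplicities -/

section GenSing

variable {K : Type*} [Field K] {ι : Type*}

theorem GenSing.curve_ne_zero (X : GenSing K ι) (k : ι) : X.curve k ≠ 0 :=
  (X.reduced k).ne_zero

theorem GenSing.isConsistent_mult (X : GenSing K ι) (k : ι) : IsConsistent (X.mult k) :=
  (isConsistent_treeMult (X.tree k) (X.connected k) (X.curve_ne_zero k)).1

theorem GenSing.multIdeal_mult (X : GenSing K ι) (k : ι) : multIdeal (X.mult k) = X.ideal k :=
  (isConsistent_treeMult (X.tree k) (X.connected k) (X.curve_ne_zero k)).2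

theorem strictTransform_ne_zero {f : LocalRing K} (hf : f ≠ 0) (q : InfNear K) :
    strictTransform q f ≠ 0 := by
  induction q generalizing f with
  | nil => exact hf
  | cons a q ih => exact ih (strictTransform₁_ne_zero hf a)

/-- Every point of the tree lies on the strict transform, so the tree is the support of the
multiplicities and can be recovered from them. -/
theorem GenSing.mult_ne_zero_iff (X : GenSing K ι) (k : ι) (q : InfNear K) :
    X.mult k q ≠ 0 ↔ q ∈ X.tree k := by
  classical
  constructor
  · intro h
    by_contra hq
    exact h (if_neg hq)
  · intro hq
    have h1 : 1 ≤ (strictTransform q (X.curve k)).order := X.subset_resolution k hq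
    obtain ⟨n, hn⟩ := exists_order_eq (strictTransform_ne_zero (X.curve_ne_zero k) q)
    have h2 : X.mult k q = (strictTransform q (X.curve k)).order.toNat := if_pos hq
    rw [hn] at h1 h2
    rw [h2, ENat.toNat_natCast]
    norm_cast at h1
    omega

/-- Consistent multiplicities define generalized singularity schemes. -/
theorem exists_genSing [CharZero K] {μ : ι → InfNear K → ℕ}
    (hμ : ∀ k, IsConsistent (μ k)) :
    ∃ Y : GenSing K ι, Y.ideal = fun k => multIdeal (μ k) := by
  classical
  -- Since general position is open, a general germ may be replaced by a sufficiently close reduced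
  -- one.
  have key : ∀ k, ∃ C : LocalRing K, Squarefree C ∧ IsGeneral 1 (μ k) C := fun k => by
    obtain ⟨f, hf⟩ := (hμ k).exists_isGeneral one_ne_zero
    obtain ⟨N, hN⟩ := hf.exists_forall_le_order_sub (hμ k).finite_support
    obtain ⟨g, hg, hgf⟩ := exists_squarefree_sub_mem f N
    exact ⟨g, hg, hN g 1 isUnit_one (by rwa [mul_one])⟩
  choose C hC hgen using key
  have hpass : ∀ k q, μ k q ≠ 0 → PassesThrough (C k) q := fun k q hq => by
    change 1 ≤ _
    rw [(hgen k).order_strictTransform q hq]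
    exact_mod_cast Nat.one_le_iff_ne_zero.mpr hq
  let Y : GenSing K ι :=
    { curve := C
      tree := fun k => (hμ k).finite_support.toFinset
      reduced := hC
      essential_subset := by
        intro k q hq
        obtain ⟨h1, h2, h3⟩ := hq
        simp only [Set.Finite.coe_toFinset, Function.mem_support]
        intro h0
        cases q with
        | nil =>
          -- At the origin there is no exceptional divisor: its equation 1 is not a multiple of u,
          -- so only the unit case is left.
          rcases (hgen k).of_subMult_eq_zero ((hμ k).eq_zero h0) with hu | ⟨w, -, hw, -⟩
          · exact not_passesThrough_of_isUnit hu _ h1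
          · have := congrArg MvPowerSeries.constantCoeff hw
            simp at this
        | cons a q => exact h3 (by simp) ((hgen k).isNode _ h0 h1)
      subset_resolution := by
        intro k q hq
        exact hpass k q (by simpa using hq)
      connected := by
        intro k q hq p hp
        rw [Set.Finite.mem_toFinset, Function.mem_support] at hq ⊢
        obtain ⟨r, rfl⟩ := hp
        exact fun h => hq ((hμ k).append_eq_zero h r) }
  refine ⟨Y, funext fun k => ?_⟩
  rw [← Y.multIdeal_mult]
  congr 1
  funext q
  by_cases hq : μ k q = 0
  · rw [hq]
    by_contra h
    rw [← ne_eq, Y.mult_ne_zero_iff] at h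
    exact ((hμ k).finite_support.mem_toFinset.mp h) hq
  · have hq' : q ∈ Y.tree k := (hμ k).finite_support.mem_toFinset.mpr hq
    have h2 : Y.mult k q = (strictTransform q (C k)).order.toNat := if_pos hq'
    rw [h2, (hgen k).order_strictTransform q hq, ENat.toNat_natCast]

theorem GenSing.reduction_ideal (X : GenSing K ι) (L : ι → LocalRing K)
    (hL : ∀ k, (L k).order ≤ 1) (k : ι) : reduction X.ideal L k =
      multIdeal (lower (X.mult k) {q | PassesThrough (L k) q}) := by
  rw [reduction, ← X.multIdeal_mult]
  exact multIdeal_colon (fun p q h => (X.isConsistent_mult k).append_eq_zero h q) (hL k)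

/-- The residual scheme with respect to a smooth germ, and its degree. -/
theorem GenSing.reduction_smooth [CharZero K] [Fintype ι] (X : GenSing K ι)
    (L : ι → LocalRing K) (hL : ∀ k, (L k).order ≤ 1) :
    (∃ Y : GenSing K ι, Y.ideal = reduction X.ideal L) ∧
      (∀ Y : GenSing K ι, Y.ideal = reduction X.ideal L →
        (∀ k, Y.tree k ⊆ X.tree k) ∧
        (∀ k, ∀ q ∈ X.tree k, X.mult k q ≤ Y.mult k q + 1 ∧ Y.mult k q ≤ X.mult k q)) ∧
      Module.Finite K (CoordRing X.ideal) ∧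
      degree (reduction X.ideal L) + degree (intersection X.ideal L) = degree X.ideal ∧
      degree (intersection X.ideal L) = ∑ k, ∑ q ∈ X.treeInter L k, X.mult k q := by
  choose μ hμ hμI hμle hμge using fun k =>
    (X.isConsistent_mult k).exists_unloading {q | PassesThrough (L k) q}
  have hred : reduction X.ideal L = fun k => multIdeal (μ k) := funext fun k => by
    rw [X.reduction_ideal L hL, hμI]
  have hfin : ∀ k, Module.Finite K (LocalRing K ⧸ X.ideal k) := fun k => by
    obtain ⟨N, hN⟩ := (X.isConsistent_mult k).exists_orderIdeal_le
    rw [X.multIdeal_mult] at hN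
    exact finite_quotient_of_orderIdeal_le hN
  have hfin' : ∀ k (I : Ideal (LocalRing K)), X.ideal k ≤ I → Module.Finite K (LocalRing K ⧸ I) :=
    fun k I hI => by
      obtain ⟨N, hN⟩ := (X.isConsistent_mult k).exists_orderIdeal_le
      rw [X.multIdeal_mult] at hN
      exact finite_quotient_of_orderIdeal_le (hN.trans hI)
  have hfin₁ : ∀ k, Module.Finite K (LocalRing K ⧸ reduction X.ideal L k) := fun k =>
    hfin' k _ fun f hf => Submodule.mem_colon_singleton.mpr (Ideal.mul_mem_right _ _ hf)
  have hfin₂ : ∀ k, Module.Finite K (LocalRing K ⧸ intersection X.ideal L k) := fun k =>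
    hfin' k _ le_sup_left
  refine ⟨?_, fun Y hY => ?_, ?_, ?_, ?_⟩
  · rw [hred]
    exact exists_genSing hμ
  -- The ideal determines consistent multiplicities, so every presentation has the unloaded ones.
  · have hYμ : ∀ k, Y.mult k = μ k := fun k =>
      (Y.isConsistent_mult k).eq_of_multIdeal_eq (hμ k) (by
        rw [Y.multIdeal_mult, hY, hred])
    refine ⟨fun k q hq => ?_, fun k q _ => ?_⟩
    · rw [← X.mult_ne_zero_iff]
      rw [← Y.mult_ne_zero_iff, hYμ] at hq
      exact fun h => hq (Nat.le_zero.mp ((hμle k q).trans h.le))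
    · rw [hYμ]
      exact ⟨hμge k q, hμle k q⟩
  · exact Module.Finite.equiv (coordRingEquiv X.ideal).symm
  · rw [degree_eq_sum hfin₁, degree_eq_sum hfin₂, degree_eq_sum hfin, ← Finset.sum_add_distrib]
    exact Finset.sum_congr rfl fun k _ => finrank_colon_add_finrank_sup (X.ideal k) (L k)
  · rw [degree_eq_sum hfin₂]
    refine Finset.sum_congr rfl fun k _ => ?_
    rw [intersection, ← X.multIdeal_mult]
    refine (X.isConsistent_mult k).finrank_sup_eq_sum (hL k) _ (fun q hq => ?_) fun q hq => ?_
    · classical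
      rw [GenSing.treeInter, Finset.mem_filter, ← X.mult_ne_zero_iff]
      exact and_iff_right hq
    · classical exact (Finset.mem_filter.mp hq).2

end GenSing

/-! ### Short exact sequences of sheaves of modules -/

section Sheaf

open CategoryTheory TopologicalSpace Opposite

/-- A sequence of sheaves is short exact if it is left exact on sections and locally surjective. -/
theorem shortExact_of_sections {K : Type u} [Ring K] {X : TopCat.{u}}
    {S : ShortComplex (TopCat.Sheaf (ModuleCat.{u} K) X)}
    (hinj : ∀ U : (Opens X)ᵒᵖ, Function.Injective (S.f.hom.app U))
    (hker : ∀ (U : (Opens X)ᵒᵖ) (s : S.X₂.obj.obj U), S.g.hom.app U s = 0 →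
      ∃ t, S.f.hom.app U t = s)
    (hsurj : ∀ (U : Opens X) (t : S.X₃.obj.obj (op U)), ∀ x ∈ U, ∃ (V : Opens X) (i : V ⟶ U),
      x ∈ V ∧ ∃ s, S.g.hom.app (op V) s = S.X₃.obj.map i.op t) : S.ShortExact := by
  have hmono : Mono S.f := Sheaf.mono_of_injective _ hinj
  have hepi : Epi S.g := by
    rw [← TopCat.Sheaf.isLocallySurjective_iff_epi, TopCat.Presheaf.isLocallySurjective_iff]
    intro U t x hx
    obtain ⟨V, i, hxV, h⟩ := hsurj U t x hx
    exact ⟨V, leOfHom i, h, hxV⟩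
  -- Sections killed by g lift uniquely along f; uniqueness makes the lifts linear and natural, so f
  -- is a kernel of g.
  refine ShortComplex.ShortExact.mk' (ShortComplex.exact_of_f_is_kernel _
    (Limits.KernelFork.IsLimit.ofι' _ _ fun {W} k hk => ?_)) hmono hepi
  have key : ∀ (U : (Opens X)ᵒᵖ) (w : W.obj.obj U), ∃ t, S.f.hom.app U t = k.hom.app U w :=
    fun U w => hker U _ (ConcreteCategory.congr_hom
      (congrArg (fun m : W ⟶ S.X₃ => m.hom.app U) hk) w)
  choose φ hφ using key
  let ψ : ∀ U, W.obj.obj U ⟶ S.X₁.obj.obj U := fun U => ModuleCat.ofHom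
    { toFun := φ U
      map_add' := fun v w => hinj U (by rw [map_add, hφ, hφ, hφ, map_add])
      map_smul' := fun c w => hinj U (by rw [RingHom.id_apply, map_smul, hφ, hφ, map_smul]) }
  refine ⟨⟨{ app := ψ, naturality := fun U V i => ?_ }⟩, ?_⟩
  · ext w
    refine hinj V ?_
    change S.f.hom.app V (φ V (W.obj.map i w)) = S.f.hom.app V (S.X₁.obj.map i (φ U w))
    rw [hφ, NatTrans.naturality_apply, NatTrans.naturality_apply, hφ]
  · refine ObjectProperty.hom_ext _ (NatTrans.ext (funext fun U => ?_))
    ext w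
    exact hφ U w

end Sheaf

/-! ### The fibres `A_p / I A_p` -/

section Fibre

variable {K : Type u} [Field K] {I : Ideal (HomogCoordRing K)}
  {p : ProjectiveSpectrum (grading K)}

theorem isUnit_fibreAt {b : HomogCoordRing K} (hb : b ∉ p.asHomogeneousIdeal) :
    IsUnit (algebraMap (HomogCoordRing K) (FibreAt I p) b) :=
  (IsLocalization.map_units (At p)
    (⟨b, hb⟩ : p.asHomogeneousIdeal.toIdeal.primeCompl)).map (Ideal.Quotient.mk _)

theorem exists_mul_eq_fibreAt (y : FibreAt I p) : ∃ a b, b ∉ p.asHomogeneousIdeal ∧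
    algebraMap (HomogCoordRing K) (FibreAt I p) b * y =
      algebraMap (HomogCoordRing K) (FibreAt I p) a := by
  obtain ⟨z, rfl⟩ := Ideal.Quotient.mk_surjective y
  obtain ⟨⟨a, b⟩, h⟩ := IsLocalization.surj p.asHomogeneousIdeal.toIdeal.primeCompl z
  rw [mul_comm] at h
  exact ⟨a, b, b.2, congrArg (Ideal.Quotient.mk _) h⟩

theorem algebraMap_fibreAt_eq_zero_iff {a : HomogCoordRing K} :
    algebraMap (HomogCoordRing K) (FibreAt I p) a = 0 ↔
      ∃ c ∉ p.asHomogeneousIdeal, c * a ∈ I := by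
  have h1 : algebraMap (HomogCoordRing K) (FibreAt I p) a = 0 ↔
      algebraMap (HomogCoordRing K) (At p) a ∈ I.map (algebraMap (HomogCoordRing K) (At p)) :=
    Ideal.Quotient.eq_zero_iff_mem
  rw [h1, IsLocalization.algebraMap_mem_map_algebraMap_iff p.asHomogeneousIdeal.toIdeal.primeCompl]
  rfl

theorem eq_zero_of_mul_fibreAt_bot {ℓ : HomogCoordRing K} (hℓ : ℓ ≠ 0) {y : FibreAt ⊥ p}
    (h : algebraMap (HomogCoordRing K) (FibreAt ⊥ p) ℓ * y = 0) : y = 0 := by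
  obtain ⟨a, b, hb, hab⟩ := exists_mul_eq_fibreAt y
  have h1 : algebraMap (HomogCoordRing K) (FibreAt ⊥ p) (ℓ * a) = 0 := by
    rw [map_mul, ← hab, mul_left_comm, h, mul_zero]
  obtain ⟨c, hc, hca⟩ := algebraMap_fibreAt_eq_zero_iff.mp h1
  have hc0 : c ≠ 0 := fun h0 => hc (h0 ▸ zero_mem _)
  have ha : a = 0 := by
    simpa [hc0, hℓ] using hca
  rw [ha, map_zero] at hab
  exact (isUnit_fibreAt hb).mul_right_eq_zero.mp hab

theorem mul_fibreAt_bot_injective {ℓ : HomogCoordRing K} (hℓ : ℓ ≠ 0) :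
    Function.Injective fun y : FibreAt ⊥ p => algebraMap (HomogCoordRing K) (FibreAt ⊥ p) ℓ * y :=
  fun y z h => sub_eq_zero.mp (eq_zero_of_mul_fibreAt_bot hℓ (by
    rw [mul_sub]; exact sub_eq_zero.mpr h))

/-- After multiplication by some c outside p the numerator is divisible by ℓ, and c and the
denominator are units in the fibre. -/
theorem exists_mul_eq_of_fibreMap_eq_zero {ℓ : HomogCoordRing K} {y : FibreAt ⊥ p}
    (h : fibreMap (bot_le : ⊥ ≤ Ideal.span {ℓ}) p y = 0) :
    ∃ z, algebraMap (HomogCoordRing K) (FibreAt ⊥ p) ℓ * z = y := by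
  obtain ⟨a, b, hb, hab⟩ := exists_mul_eq_fibreAt y
  have h1 := congrArg (fibreMap (bot_le : ⊥ ≤ Ideal.span {ℓ}) p) hab
  rw [map_mul, h, mul_zero, AlgHom.commutes, eq_comm, algebraMap_fibreAt_eq_zero_iff] at h1
  obtain ⟨c, hc, hca⟩ := h1
  obtain ⟨a', ha'⟩ := Ideal.mem_span_singleton'.mp hca
  have hcb : c * b ∉ p.asHomogeneousIdeal := fun h0 => (p.isPrime.mem_or_mem h0).elim hc hb
  obtain ⟨u, hu⟩ := isUnit_fibreAt (I := ⊥) hcb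
  refine ⟨↑u⁻¹ * algebraMap (HomogCoordRing K) (FibreAt ⊥ p) a', ?_⟩
  rw [mul_left_comm, ← map_mul, mul_comm ℓ, ha', map_mul, ← hab, ← mul_assoc (algebraMap (HomogCoordRing K) (FibreAt ⊥ p) c),
    ← map_mul, ← hu, Units.inv_mul_cancel_left]

end Fibre

/-! ### Frames and linear forms -/

section Frame

variable {K : Type u} [Field K]

open MvPolynomial

theorem prime_of_mem_grading_one {ℓ : HomogCoordRing K} (hℓ : ℓ ∈ grading K 1) (h0 : ℓ ≠ 0) :
    Prime ℓ := by
  rw [← irreducible_iff_prime]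
  refine irreducible_of_totalDegree_eq_one (IsHomogeneous.totalDegree hℓ h0) fun r hr => ?_
  rw [isUnit_iff_ne_zero]
  rintro rfl
  exact h0 (MvPolynomial.ext _ _ fun m => by simpa using hr m)

/-- The component of degree j of any cofactor is again a cofactor. -/
theorem exists_eq_mul_of_dvd {a ℓ : HomogCoordRing K} {i j : ℕ} (ha : a ∈ grading K (i + j))
    (hℓ : ℓ ∈ grading K i) (h : ℓ ∣ a) : ∃ a' ∈ grading K j, a = ℓ * a' := by
  obtain ⟨c, rfl⟩ := h
  refine ⟨_, SetLike.coe_mem (DirectSum.decompose (grading K) c j), ?_⟩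
  have h1 := DirectSum.coe_decompose_mul_of_left_mem_of_le (grading K) (b := c) hℓ
    (Nat.le_add_right i j)
  rw [DirectSum.decompose_of_mem_same _ ha, Nat.add_sub_cancel_left] at h1
  exact h1

theorem aeval_mul_const {B : Type*} [CommRing B] [Algebra K B] {f : HomogCoordRing K} {n : ℕ}
    (hf : f ∈ grading K n) (v : Fin 3 → K) (c : B) :
    aeval (fun i => algebraMap K B (v i) * c) f = algebraMap K B (eval v f) * c ^ n := by
  rw [aeval_def, eval₂_eq', eval_eq', map_sum, Finset.sum_mul]
  refine Finset.sum_congr rfl fun d hd => ?_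
  have h1 : d 0 + d 1 + d 2 = n := by
    have := (mem_homogeneousSubmodule n f).mp hf (mem_support_iff.mp hd)
    rw [← this, Finsupp.weight_apply, Finsupp.sum_fintype _ _ (by simp)]
    simp [Fin.sum_univ_three]
  rw [← h1]
  simp only [Fin.prod_univ_three, map_mul, map_pow]
  ring

/-- The linear form of a functional on `K³`. -/
def linearForm (φ : (Fin 3 → K) →ₗ[K] K) : HomogCoordRing K :=
  ∑ i, C (φ (Pi.single i 1)) * X i

theorem linearForm_mem (φ : (Fin 3 → K) →ₗ[K] K) : linearForm φ ∈ grading K 1 :=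
  sum_mem fun i _ => (isHomogeneous_X K i).C_mul _

theorem eval_linearForm (φ : (Fin 3 → K) →ₗ[K] K) (v : Fin 3 → K) :
    eval v (linearForm φ) = φ v := by
  rw [linearForm, map_sum, LinearMap.pi_apply_eq_sum_univ φ v]
  exact Finset.sum_congr rfl fun i _ => by
    rw [map_mul, eval_C, eval_X, smul_eq_mul, mul_comm]
    congr 2
    funext j
    simp [Pi.single_apply, eq_comm]

namespace Frame

variable (e : Frame K)

/-- The homogeneous coordinates with respect to a frame. -/
def dual (m : Fin 3) : HomogCoordRing K := linearForm (e.coord m)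

theorem dual_mem (m : Fin 3) : e.dual m ∈ grading K 1 := linearForm_mem _

theorem eval_dual (m n : Fin 3) : eval (e n) (e.dual m) = if n = m then 1 else 0 := by
  rw [dual, eval_linearForm, Module.Basis.coord_apply, Module.Basis.repr_self,
    Finsupp.single_apply]

theorem germ_linearForm (φ : (Fin 3 → K) →ₗ[K] K) : e.germ (linearForm φ) =
    MvPowerSeries.C (φ (e 0)) + MvPowerSeries.X 0 * MvPowerSeries.C (φ (e 1)) +
      MvPowerSeries.X 1 * MvPowerSeries.C (φ (e 2)) := by
  simp only [← eval_linearForm φ]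
  simp only [linearForm, germ, map_add, map_mul, aeval_X, Fin.sum_univ_three, eval_C,
    eval_X, aeval_C]
  have : ∀ c : K, algebraMap K (LocalRing K) c = MvPowerSeries.C c := fun _ => rfl
  simp only [this]
  ring

theorem germ_dual_zero : e.germ (e.dual 0) = 1 := by
  rw [dual, germ_linearForm]
  simp

theorem germ_dual_one : e.germ (e.dual 1) = MvPowerSeries.X 0 := by
  rw [dual, germ_linearForm]
  simp

theorem germ_dual_two : e.germ (e.dual 2) = MvPowerSeries.X 1 := by
  rw [dual, germ_linearForm]
  simp

theorem germ_C (c : K) : e.germ (C c) = MvPowerSeries.C c := aeval_C _ c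

theorem X_eq (i : Fin 3) : (X i : HomogCoordRing K) = ∑ m, C (e m i) * e.dual m := by
  refine MvPolynomial.ext _ _ fun d => ?_
  have key : ∀ j, ∑ m, e m i * e.coord m (Pi.single j 1) = if j = i then 1 else 0 := fun j => by
    have := congrFun (e.sum_repr (Pi.single j 1)) i
    rw [Finset.sum_apply] at this
    simp only [Pi.smul_apply, smul_eq_mul] at this
    simp only [Module.Basis.coord_apply, mul_comm (e _ i), this, Pi.single_apply, eq_comm]
  have h2 : ∑ m, C (e m i) * e.dual m = ∑ j, C (if j = i then (1 : K) else 0) * X j := by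
    simp only [← key, map_sum, Finset.sum_mul, dual, linearForm, Finset.mul_sum, map_mul, mul_assoc]
    exact Finset.sum_comm
  rw [h2]
  simp

theorem mem_center_iff {f : HomogCoordRing K} {n : ℕ} (hf : f ∈ grading K n) :
    f ∈ e.center.asHomogeneousIdeal ↔ eval (e 0) f = 0 := by
  constructor
  · intro h
    exact Ideal.toIdeal_homogeneousCore_le (grading K) _ h
  · intro h
    exact Ideal.mem_homogeneousCore_of_homogeneous_of_mem ⟨n, hf⟩ h

/-- The centre is the only point where the dual coordinates 1 and 2 vanish: modulo the prime of such
a point, a form of degree n equals its value at e 0 times the n-th power of the dual coordinate 0,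
so both primes contain the same forms. -/
theorem isClosed_center : IsClosed ({e.center} : Set (Plane K)) := by
  have : ({e.center} : Set (Plane K)) =
      ProjectiveSpectrum.zeroLocus (grading K) {e.dual 1, e.dual 2} := by
    ext x
    rw [Set.mem_singleton_iff, ProjectiveSpectrum.mem_zeroLocus]
    constructor
    · rintro rfl
      rintro f (rfl | rfl)
      · exact (e.mem_center_iff (e.dual_mem 1)).mpr (by rw [eval_dual]; simp)
      · exact (e.mem_center_iff (e.dual_mem 2)).mpr (by rw [eval_dual]; simp)
    · intro h
      have h1 : e.dual 1 ∈ x.asHomogeneousIdeal := h (by simp)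
      have h2 : e.dual 2 ∈ x.asHomogeneousIdeal := h (by simp)
      let π := Ideal.Quotient.mkₐ K x.asHomogeneousIdeal.toIdeal
      have hπ : ∀ f, π f = 0 ↔ f ∈ x.asHomogeneousIdeal := fun f => Ideal.Quotient.eq_zero_iff_mem
      have hX : ∀ i, π (X i) = algebraMap K _ (e 0 i) * π (e.dual 0) := fun i => by
        rw [e.X_eq i, Fin.sum_univ_three, map_add, map_add, map_mul, map_mul, map_mul,
          (hπ _).mpr h1, (hπ _).mpr h2, mul_zero, mul_zero, add_zero, add_zero]
        rfl
      have hπf : ∀ n, ∀ f ∈ grading K n, π f = algebraMap K _ (eval (e 0) f) * π (e.dual 0) ^ n :=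
        fun n f hfn => by
          rw [← aeval_mul_const hfn, ← funext hX]
          exact (DFunLike.congr_fun (aeval_unique π) f)
      have hdual : e.dual 0 ∉ x.asHomogeneousIdeal := fun h0 => by
        refine x.not_irrelevant_le fun f hf => ?_
        obtain ⟨m, c, hm, hc, hcx⟩ := exists_homogeneous_not_mem x
        refine absurd ((hπ c).mp ?_) hcx
        rw [hπf m c hc, (hπ _).mpr h0, zero_pow hm.ne', mul_zero]
      have hiff : ∀ n, ∀ f ∈ grading K n,
          (f ∈ x.asHomogeneousIdeal ↔ f ∈ e.center.asHomogeneousIdeal) := fun n f hfn => by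
        rw [e.mem_center_iff hfn, ← hπ, hπf n f hfn]
        constructor
        · intro h0
          by_contra hne
          have hu : IsUnit (algebraMap K
              (HomogCoordRing K ⧸ x.asHomogeneousIdeal.toIdeal) (eval (e 0) f)) :=
            (isUnit_iff_ne_zero.mpr hne).map _
          rw [hu.mul_right_eq_zero, ← map_pow, hπ] at h0
          exact hdual (x.isPrime.mem_of_pow_mem _ h0)
        · intro h0
          rw [h0, map_zero, zero_mul]
      refine ProjectiveSpectrum.ext (HomogeneousIdeal.ext' fun n f hfn => hiff n f hfn)
  rw [this]
  exact ProjectiveSpectrum.isClosed_zeroLocus _ _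

/-- The dual coordinate 0 has germ 1, so its powers homogenize a Taylor polynomial without changing
the germ. -/
theorem exists_germ_sub_mem (h : LocalRing K) (N : ℕ) :
    ∃ f ∈ grading K N, (N : ℕ∞) ≤ (e.germ f - h).order := by
  induction N generalizing h with
  | zero => exact ⟨0, zero_mem _, by simp⟩
  | succ N ih =>
    obtain ⟨p, q, hpq⟩ := mem_span_X_of_constantCoeff
      (f := h - MvPowerSeries.C (MvPowerSeries.constantCoeff h)) (by simp)
    obtain ⟨P, hP, hP'⟩ := ih p
    obtain ⟨Q, hQ, hQ'⟩ := ih q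
    refine ⟨C (MvPowerSeries.constantCoeff h) * e.dual 0 ^ (N + 1) +
      (P * e.dual 1 + Q * e.dual 2), ?_, ?_⟩
    · refine add_mem ?_ (add_mem (IsHomogeneous.mul hP (e.dual_mem 1))
        (IsHomogeneous.mul hQ (e.dual_mem 2)))
      have := IsHomogeneous.pow (e.dual_mem 0) (N + 1)
      rw [one_mul] at this
      exact this.C_mul _
    · have e1 : e.germ (C (MvPowerSeries.constantCoeff h) * e.dual 0 ^ (N + 1) +
          (P * e.dual 1 + Q * e.dual 2)) - h =
          MvPowerSeries.X 0 * (e.germ P - p) + MvPowerSeries.X 1 * (e.germ Q - q) := by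
        simp only [map_add, map_mul, map_pow, germ_dual_zero, germ_dual_one, germ_dual_two, germ_C]
        linear_combination -hpq
      rw [e1, add_comm N 1]
      exact le_order_add (le_order_mul_of_le (by simp) hP') (le_order_mul_of_le (by simp) hQ')

end Frame

end Frame

/-! ### The exact sequence of a line -/

section LineSequence

variable {K : Type u} [Field K] {ι : Type*}

open CategoryTheory TopologicalSpace Opposite

/-- The open set of the points of `U` outside the zeros of `f`. -/
abbrev restrictBasicOpen (U : Opens (Plane K)) (f : HomogCoordRing K) : Opens (Plane K) :=
  U ⊓ ProjectiveSpectrum.basicOpen (grading K) f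

theorem algebraMap_fibreAt_span_self (ℓ : HomogCoordRing K) (p : Plane K) :
    algebraMap (HomogCoordRing K) (FibreAt (Ideal.span {ℓ}) p) ℓ = 0 :=
  algebraMap_fibreAt_eq_zero_iff.mpr
    ⟨1, fun h0 => p.isPrime.ne_top ((Ideal.eq_top_iff_one _).mpr h0),
      by simp [Ideal.mem_span_singleton_self ℓ]⟩

/-- A section of the ideal sheaf on `ℙ²` that is divisible by the equation of a line in all fibres
is divisible by it. -/
theorem mem_sections_of_mul {e : ι → Frame K} {J : ι → Ideal (LocalRing K)} {d : ℤ}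
    {ℓ : HomogCoordRing K} (hℓ : ℓ ∈ grading K 1) (hℓ0 : ℓ ≠ 0) {U : Opens (Plane K)}
    {t : ∀ p : U, FibreAt ⊥ p.1}
    (ht : (fun p : U => algebraMap (HomogCoordRing K) (FibreAt ⊥ p.1) ℓ * t p) ∈
      sections ⊥ e J d U) :
    t ∈ sections ⊥ e (reduction J fun k => (e k).germ ℓ) (d - 1) U := by
  intro x
  obtain ⟨V, hxV, f, i, j, a, b, ha, hb, hd, hJ, hV⟩ := ht x
  have h : ∀ (p : Plane K) (hp : p ∈ V), b ∉ p.asHomogeneousIdeal ∧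
      algebraMap (HomogCoordRing K) (FibreAt ⊥ p) b *
        (algebraMap (HomogCoordRing K) (FibreAt ⊥ p) ℓ * t ⟨p, f.le hp⟩) =
          algebraMap (HomogCoordRing K) (FibreAt ⊥ p) a := fun p hp => hV ⟨p, hp⟩
  simp only [Ideal.map_bot, sup_bot_eq] at hJ
  -- On the line, the prime ℓ divides the numerator and is cancelled; the factor c of positive
  -- degree keeps i + m - 1 a genuine degree when i = 0. Off the line, ℓ is moved into the
  -- denominator.
  by_cases hx : ℓ ∈ x.1.asHomogeneousIdeal
  · obtain ⟨m, c, hm, hc, hcx⟩ := exists_homogeneous_not_mem x.1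
    have hdvd : ℓ ∣ a := by
      have h1 : algebraMap (HomogCoordRing K) (FibreAt (Ideal.span {ℓ}) x.1) a = 0 := by
        rw [← AlgHom.commutes (fibreMap (bot_le : ⊥ ≤ Ideal.span {ℓ}) x.1), ← (h x.1 hxV).2,
          map_mul, map_mul, AlgHom.commutes, AlgHom.commutes, algebraMap_fibreAt_span_self,
          zero_mul, mul_zero]
      obtain ⟨c', hc', hca⟩ := algebraMap_fibreAt_eq_zero_iff.mp h1
      refine ((prime_of_mem_grading_one hℓ hℓ0).dvd_or_dvd
        (Ideal.mem_span_singleton.mp hca)).resolve_left fun h0 => hc' ?_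
      exact Ideal.mem_of_dvd _ h0 hx
    have hac : a * c ∈ grading K (1 + (i + m - 1)) := by
      rw [show 1 + (i + m - 1) = i + m by omega]
      exact ha.mul hc
    obtain ⟨a', ha', haa'⟩ := exists_eq_mul_of_dvd hac hℓ (hdvd.mul_right c)
    refine ⟨restrictBasicOpen V c, ⟨hxV, hcx⟩, Opens.infLELeft _ _ ≫ f, i + m - 1, j + m, a', b * c,
      ha', hb.mul hc, by push_cast [show 1 ≤ i + m by omega]; omega, fun k hk => ?_,
      fun p => ⟨fun h0 => ?_, ?_⟩⟩
    · refine Ideal.mem_sup_left (Submodule.mem_colon_singleton.mpr ?_)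
      rw [smul_eq_mul, ← map_mul, mul_comm, ← haa', map_mul]
      exact Ideal.mul_mem_right _ _ (hJ k hk.1)
    · exact (p.1.isPrime.mem_or_mem h0).elim (h p.1 p.2.1).1 p.2.2
    · refine mul_fibreAt_bot_injective hℓ0 ?_
      change _ * (_ * t ⟨p.1, f.le p.2.1⟩) = _ * _
      rw [← map_mul, ← haa', map_mul, map_mul, ← (h p.1 p.2.1).2]
      ring
  · refine ⟨restrictBasicOpen V ℓ, ⟨hxV, hx⟩, Opens.infLELeft _ _ ≫ f, i, 1 + j, a, ℓ * b, ha,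
      hℓ.mul hb, by push_cast; omega, fun k hk => ?_, fun p => ⟨fun h0 => ?_, ?_⟩⟩
    · refine Ideal.mem_sup_left (Submodule.mem_colon_singleton.mpr ?_)
      exact Ideal.mul_mem_right _ _ (hJ k hk.1)
    · exact (p.1.isPrime.mem_or_mem h0).elim p.2.2 (h p.1 p.2.1).1
    · change _ * t ⟨p.1, f.le p.2.1⟩ = _
      rw [← (h p.1 p.2.1).2, map_mul]
      ring

theorem exists_open_avoiding [Finite ι] (e : ι → Frame K) (x : Plane K) :
    ∃ W : Opens (Plane K), x ∈ W ∧ ∀ k, (e k).center ∈ W → (e k).center = x := by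
  have hfin : IsClosed (⋃ k ∈ {k | (e k).center ≠ x}, ({(e k).center} : Set (Plane K))) :=
    (Set.toFinite {k | (e k).center ≠ x}).isClosed_biUnion fun k _ => (e k).isClosed_center
  refine ⟨⟨_, hfin.isOpen_compl⟩, fun h => ?_, fun k hk => ?_⟩
  · obtain ⟨k, hk, hxk⟩ := Set.mem_iUnion₂.mp h
    exact hk hxk.symm
  · by_contra hne
    exact hk (Set.mem_iUnion₂.mpr ⟨k, hne, rfl⟩)

/-- Fractions on a line can locally be lifted to the plane. -/
theorem exists_isFraction_lift [Finite ι] {e : ι → Frame K}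
    (he : Function.Injective fun k => (e k).center) {J : ι → Ideal (LocalRing K)}
    (hJ : ∀ k, ∃ N : ℕ, orderIdeal N ≤ J k) {d : ℤ} {ℓ : HomogCoordRing K} (hℓ : ℓ ∈ grading K 1)
    {V : Opens (Plane K)} {t : ∀ p : V, FibreAt (Ideal.span {ℓ}) p.1}
    (ht : IsFraction (Ideal.span {ℓ}) e J d t) {x : Plane K} (hx : x ∈ V) :
    ∃ (W : Opens (Plane K)) (hW : W ≤ V) (s : ∀ p : W, FibreAt ⊥ p.1), x ∈ W ∧
      IsFraction ⊥ e J d s ∧ ∀ p : W, fibreMap bot_le p.1 (s p) = t ⟨p.1, hW p.2⟩ := by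
  obtain ⟨i, j, a, b, ha, hb, hd, hJa, h⟩ := ht
  obtain ⟨W, hxW, hW⟩ := exists_open_avoiding e x
  -- A multiple of ℓ is invisible on the line, so it may be subtracted to bring the numerator into J
  -- at the centre. Its cofactor w, a power series, is truncated at order N, which is harmless since
  -- J contains all germs of order N. Powers of the dual coordinate 0 balance the degrees: i + (N +
  -- 1) = 1 + (i + N).
  obtain ⟨m, c, g, n, hc, hcx, hg, hmn, hgJ⟩ : ∃ (m : ℕ) (c g : HomogCoordRing K) (n : ℕ),
      c ∈ grading K m ∧ c ∉ x.asHomogeneousIdeal ∧ g ∈ grading K n ∧ i + m = 1 + n ∧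
      ∀ k, (e k).center = x → (e k).germ (a * c - ℓ * g) ∈ J k := by
    by_cases hk : ∃ k, (e k).center = x
    · obtain ⟨k, rfl⟩ := hk
      obtain ⟨N, hN⟩ := hJ k
      have h1 := hJa k hx
      rw [Ideal.map_span, Set.image_singleton] at h1
      obtain ⟨y, hy, z, hz, hyz⟩ := Submodule.mem_sup.mp h1
      obtain ⟨w, rfl⟩ := Ideal.mem_span_singleton'.mp hz
      obtain ⟨f, hf, hfw⟩ := (e k).exists_germ_sub_mem w N
      have hpow : ∀ r, (e k).dual 0 ^ r ∈ grading K r := fun r => by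
        have := MvPolynomial.IsHomogeneous.pow ((e k).dual_mem 0) r
        rwa [one_mul] at this
      refine ⟨N + 1, (e k).dual 0 ^ (N + 1), (e k).dual 0 ^ i * f, i + N, hpow _, fun h0 => ?_,
        (hpow i).mul hf, by omega, fun k' hk' => ?_⟩
      · have h2 := Ideal.IsPrime.mem_of_pow_mem (e k).center.isPrime _ h0
        have h3 := ((e k).mem_center_iff ((e k).dual_mem 0)).mp h2
        rw [(e k).eval_dual, if_pos rfl] at h3
        exact one_ne_zero h3
      · obtain rfl := he hk'
        have h4 : (e k').germ (a * (e k').dual 0 ^ (N + 1) - ℓ * ((e k').dual 0 ^ i * f)) =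
            y - (e k').germ ℓ * ((e k').germ f - w) := by
          simp only [map_sub, map_mul, map_pow, (e k').germ_dual_zero, one_pow, mul_one, one_mul,
            ← hyz]
          ring
        rw [h4]
        exact sub_mem hy (Ideal.mul_mem_left _ _ (hN hfw))
    · push Not at hk
      obtain ⟨m, c, hm, hc, hcx⟩ := exists_homogeneous_not_mem x
      exact ⟨m, c, 0, i + m - 1, hc, hcx, zero_mem _, by omega, fun k hkx => absurd hkx (hk k)⟩
  have hbc : ∀ p : restrictBasicOpen (V ⊓ W) c, b * c ∉ p.1.asHomogeneousIdeal := fun p h0 =>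
    (p.1.isPrime.mem_or_mem h0).elim (h ⟨p.1, p.2.1.1⟩).1 p.2.2
  choose s hs using fun p : restrictBasicOpen (V ⊓ W) c =>
    (isUnit_fibreAt (I := ⊥) (hbc p)).dvd (a := algebraMap (HomogCoordRing K) (FibreAt ⊥ p.1)
      (a * c - ℓ * g))
  refine ⟨restrictBasicOpen (V ⊓ W) c, fun p hp => hp.1.1, s, ⟨⟨hx, hxW⟩, hcx⟩,
    ⟨i + m, j + m, a * c - ℓ * g, b * c, sub_mem (ha.mul hc) (hmn ▸ hℓ.mul hg), hb.mul hc,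
      by push_cast; omega, fun k hk => Ideal.mem_sup_left (hgJ k (hW k hk.1.2)),
      fun p => ⟨hbc p, (hs p).symm⟩⟩, fun p => ?_⟩
  refine (isUnit_fibreAt (I := Ideal.span {ℓ}) (hbc p)).mul_left_cancel ?_
  rw [← AlgHom.commutes (fibreMap (bot_le : ⊥ ≤ Ideal.span {ℓ}) p.1), ← map_mul, ← hs,
    AlgHom.commutes, AlgHom.commutes, map_sub, map_mul, map_mul, map_mul,
    algebraMap_fibreAt_span_self, zero_mul, sub_zero, ← (h ⟨p.1, p.2.1.1⟩).2]
  ring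

/-- The exact sequence `0 → 𝒥_{Z : L}(d - 1) → 𝒥_Z(d) → 𝒥_{Z ∩ L / L}(d) → 0`. -/
theorem lineSequence_shortExact [Finite ι] {e : ι → Frame K}
    (he : Function.Injective fun k => (e k).center) {J : ι → Ideal (LocalRing K)}
    (hJ : ∀ k, ∃ N : ℕ, orderIdeal N ≤ J k) {ℓ : HomogCoordRing K} (hℓ : ℓ ∈ grading K 1)
    (hℓ0 : ℓ ≠ 0) (d : ℤ) : (lineSequence e J d ℓ hℓ).ShortExact := by
  refine shortExact_of_sections (fun U s t hst => ?_) (fun U s hs => ?_) (fun U t x hx => ?_)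
  · exact Subtype.ext (funext fun p => mul_fibreAt_bot_injective hℓ0
      (congrFun (congrArg Subtype.val hst) p))
  -- Quotients by ℓ are chosen fibre by fibre; local divisibility of the numerators shows that they
  -- form a section.
  · choose t ht using fun p : U.unop => exists_mul_eq_of_fibreMap_eq_zero (y := s.1 p)
      (congrFun (congrArg Subtype.val hs) p)
    exact ⟨⟨t, mem_sections_of_mul hℓ hℓ0 (by rw [funext ht]; exact s.2)⟩,
      Subtype.ext (funext ht)⟩
  · obtain ⟨V, hxV, f, hV⟩ := t.2 ⟨x, hx⟩
    obtain ⟨W, hW, s, hxW, hs, hst⟩ := exists_isFraction_lift he hJ hℓ hV hxV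
    exact ⟨W, homOfLE hW ≫ f, hxW, ⟨s, fun y => ⟨W, y.2, 𝟙 W, hs⟩⟩,
      Subtype.ext (funext fun p => hst p)⟩

theorem GenSing.exists_orderIdeal_le (X : GenSing K ι) (k : ι) :
    ∃ N : ℕ, orderIdeal N ≤ X.ideal k := by
  obtain ⟨N, hN⟩ := (X.isConsistent_mult k).exists_orderIdeal_le
  exact ⟨N, X.multIdeal_mult k ▸ hN⟩

end LineSequence

end PlaneCurveGerm

end

/-! ### The residual scheme and the exact sequence of a line -/

theorem proposition1p11 {K : Type*} [Field K] [IsAlgClosed K] [CharZero K]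
    {ι : Type*} [Fintype ι] (X : GenSing K ι) :
    (∀ L : ι → LocalRing K, (∀ k, (L k).order ≤ 1) →
      (∃ Y : GenSing K ι, Y.ideal = reduction X.ideal L) ∧
      (∀ Y : GenSing K ι, Y.ideal = reduction X.ideal L →
        (∀ k, Y.tree k ⊆ X.tree k) ∧
        (∀ k, ∀ q ∈ X.tree k, X.mult k q ≤ Y.mult k q + 1 ∧ Y.mult k q ≤ X.mult k q)) ∧
      Module.Finite K (CoordRing X.ideal) ∧
      degree (reduction X.ideal L) + degree (intersection X.ideal L) = degree X.ideal ∧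
      degree (intersection X.ideal L) = ∑ k, ∑ q ∈ X.treeInter L k, X.mult k q) ∧
    (∀ e : ι → Frame K, Function.Injective (fun k => (e k).center) →
      ∀ (ℓ : HomogCoordRing K) (hℓ : ℓ ∈ grading K 1), ℓ ≠ 0 →
        ∀ d : ℤ, (lineSequence e X.ideal d ℓ hℓ).ShortExact) :=
  ⟨fun L hL => X.reduction_smooth L hL, fun _ he _ hℓ hℓ0 d =>
    lineSequence_shortExact he (fun k => X.exists_orderIdeal_le k) hℓ hℓ0 d⟩
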